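/- **Setting.** Let $d\ge1$, $n\ge0$, let $\Omega\subseteq\mathbb R^d$ be open with finite Lebesgue measure, and $H=L_2(\Omega,\mathbb C^n)$ with $(u,v)=\int_\Omega u\cdot\overline v\,dx$. Let $V\subseteq W^{1,2}(\Omega,\mathbb C^n)$ be a closed subspace that is dense in $H$. Let $p_*=\frac{2d}{d-2}$ if $d\ge3$, and let $p_*\in(2,\infty)$ be arbitrary but fixed if $d\le2$. Assume that there is a continuous embedding $V\subseteq L_{p_*}(\Omega,\mathbb C^n)$. *Power scale.* For an operator $A$ of positive type in $H$ let, for $0<\theta<1$, $A^{-\theta}=\frac{\sin\pi\theta}{\pi}\int_0^\infty s^{-\theta}(s+A)^{-1}ds$, $A^0=I$, and $A^\theta=(A^{-\theta})^{-1}$. For $\alpha\in[0,1)$, $H_\alpha$ is $D(A^\alpha)$ with the norm $|A^\alpha u|$. For $\gamma\in[0,1)$, $H_{-\gamma}$ is the completion of $H$ in the norm $|A^{-\gamma}u|$. The scalar product extends by continuity to a pairing of $H_{-\gamma}$ with $D((A^*)^\gamma)$. A measurable $v\colon\Omega\to\mathbb C^n$ is said to belong to $H_{-\gamma}$, and is identified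 with $F\in H_{-\gamma}$, if $v\cdot\overline\varphi$ is integrable and $\int_\Omega v\cdot\overline\varphi\,dx=(F,\varphi)$ for all $\varphi\in D((A^*)^\gamma)$. *Kato operator.* Let $A$ be a Kato operator with a form on $V$: $A$ is the operator in $H$ associated with a continuous sesquilinear form $a$ on $V$ such that $\operatorname{Re}a(u,u)\ge c\|u\|_V^2$ for all $u\in V$ with some $c>0$ (that is, $u\in D(A)$ and $Au=w$ if and only if $u\in V$, $w\in H$ and $a(u,\varphi)=(w,\varphi)$ for all $\varphi\in V$), and $H_{1/2}=V$ with equivalent norms. *Nonlinearity.* Let $r\in[1,\infty]$, $\sigma\in[1,\infty)$, $\widetilde B\in L_r(\Omega,\mathbb C^{n\times n})$, and let $\widetilde f,\widetilde g\colon[0,\infty)\times\Omega\times\mathbb C^n\to2^{\mathbb C^n}$ satisfy $\widetilde f(t,x,u)=\widetilde B(x)u+\widetilde g(t,x,u)$ for all $(t,x,u)$. Suppose that for almost all $x\in\Omega$ $$\lim_{|u|\to0}\frac{\sup\{|v|:v\in\widetilde g((0,\infty)\times\{x\}\times\{u\})\}}{|u|}=0\qquad(\sup\emptyset:=0),$$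 and that there is $C_0\in(0,\infty)$ such that for almost all $x\in\Omega$, for all $t\in[0,\infty)$, $u\in\mathbb C^n$ and $v\in\widetilde g(t,x,u)$, $|v|\le C_0(|u|+|u|^\sigma)$. Let $f(t,u)$ be the set of all measurable $v\colon\Omega\to\mathbb C^n$ with $v(x)\in\widetilde f(t,x,u(x))$ for almost all $x\in\Omega$. Assume that $u_0=0$ is an equilibrium, i.e. $0\in f(t,0)$ for every $t>0$. *Conclusion $\mathcal B(\alpha,\gamma)$.* We say that $\mathcal B(\alpha,\gamma)$ holds if $f\colon[0,\infty)\times H_\alpha\to2^{H_{-\gamma}}$ (every $v\in f(t,u)$ with $t\ge0$, $u\in H_\alpha$, belongs to $H_{-\gamma}$), the multiplication $Bu(x)=\widetilde B(x)u(x)$ defines a bounded linear operator $B\colon H_\alpha\to H_{-\gamma}$, and hypothesis $(B_\gamma)$ holds at $u_0=0$ with this $B$: $0$ is a $\gamma$-weak equilibrium ($0\in f(t,0)$ in $H_{-\gamma}$ for all $t>0$), $f$ is defined on $[0,\infty)\times U_1$ for an open neighborhood $U_1$ of $0$ in $H_\alpha$, and $g(t,u)=f(t,u)-Bu$ satisfies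 $$\lim_{\|u\|_{H_\alpha}\to0}\frac{\sup\{\|v\|_{H_{-\gamma}}:v\in g((0,\infty)\times\{u\})\}}{\|u\|_{H_\alpha}}=0.$$ **Proposition.** 1. Let $\alpha=0$ (so $H_\alpha=L_2(\Omega,\mathbb C^n)$). If $d=1$, suppose that there is a continuous embedding $V\subseteq L_\infty(\Omega,\mathbb C^n)$; if $d=2$, suppose that there are continuous embeddings $V\subseteq L_q(\Omega,\mathbb C^n)$ for all $q\in(2,\infty)$. Assume $r=2$ if $d=1$, $r>2$ if $d=2$, $r=\frac{2p_*}{p_*-2}$ $(=d)$ if $d\ge3$, and $\sigma=2$ if $d=1$, $\sigma<2$ if $d=2$, $\sigma=2-\frac2{p_*}$ $(=1+\frac2d)$ if $d\ge3$. Then $\mathcal B(0,\gamma)$ holds for every $\gamma\in[1/2,1)$. 2. Let $\alpha=0$. Assume that for some $p\in(p_*,\infty)$ there is a continuous embedding $D(A^*)\subseteq L_p(\Omega,\mathbb C^n)$, and that $r>\frac{2p}{p-2}$ and $\sigma<2-\frac2p$. Then $$\gamma_0:=\frac{(\sigma-2)p_*p-2p_*+4p}{4(p-p_*)}<1,\qquad\gamma_1:=\frac{2pp_*\frac1r-(pp_*+2p_*-4p)}{4(p-p_*)}<1\qquad(\tfrac1\infty:=0),$$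 and $\mathcal B(0,\gamma)$ holds for every $\gamma\in[\max\{\gamma_0,\gamma_1,1/2\},1)$. 3. Let $\alpha=1/2$ (so $H_\alpha=V$ with equivalent norms). Assume $r>\frac{p_*}{p_*-2}$ and $\sigma<p_*-1$. Then $$\gamma_0:=\frac{2\sigma-p_*}{2p_*-4}<\frac12,\qquad\gamma_1:=\frac{p_*}{p_*-2}\cdot\frac1r-\frac12<\frac12\qquad(\tfrac1\infty:=0),$$ and $\mathcal B(1/2,\gamma)$ holds for every $\gamma\in[\max\{0,\gamma_0,\gamma_1\},1/2)$. -/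

import Mathlib

open MeasureTheory Filter Topology Set
open scoped ENNReal ContDiff

namespace KatoScale

/-! ### Fractional powers and the extrapolated power scale of an unbounded operator -/

section Scale

variable {H : Type*} [NormedAddCommGroup H] [InnerProductSpace ℂ H]

/-- `R` is the bounded, everywhere defined, two-sided inverse of `s + A`. -/
def IsResolvent (A : H →ₗ.[ℂ] H) (s : ℝ) (R : H →L[ℂ] H) : Prop :=
  (∀ h : H, ∃ hR : R h ∈ A.domain, (s : ℂ) • R h + A ⟨R h, hR⟩ = h) ∧
    ∀ u : A.domain, R ((s : ℂ) • (u : H) + A u) = u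

open scoped Classical in
/-- The resolvent `(s + A)⁻¹` (and `0` if `s + A` has no bounded inverse). -/
noncomputable def res (A : H →ₗ.[ℂ] H) (s : ℝ) : H →L[ℂ] H :=
  if h : ∃ R, IsResolvent A s R then h.choose else 0

/-- The bounded operator `A ^ (-θ)` for `θ ≥ 0`, for an operator `A` of positive type: for
`0 < θ < 1` it is `(sin (π θ) / π) ∫₀^∞ s ^ (-θ) (s + A)⁻¹ ds`, and in general it is
`(A⁻¹) ^ ⌊θ⌋ A ^ (-(θ - ⌊θ⌋))`. -/
noncomputable def negPow (A : H →ₗ.[ℂ] H) (θ : ℝ) : H →L[ℂ] H :=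
  (res A 0) ^ ⌊θ⌋₊ *
    if Int.fract θ = 0 then 1
    else ((Real.sin (Real.pi * Int.fract θ) / Real.pi : ℝ) : ℂ) •
      ∫ s in Ioi (0 : ℝ), ((s ^ (-Int.fract θ) : ℝ) : ℂ) • res A s

/-- The fractional power `A ^ α` as an operator in `H`: everywhere defined for `α ≤ 0`, and the
inverse of `A ^ (-α)`, with domain the range of `A ^ (-α)`, for `α > 0`. -/
noncomputable def fracPow (A : H →ₗ.[ℂ] H) (α : ℝ) : H →ₗ.[ℂ] H :=
  if α ≤ 0 then ((negPow A (-α) : H →L[ℂ] H) : H →ₗ[ℂ] H).toPMap ⊤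
  else (((negPow A α : H →L[ℂ] H) : H →ₗ[ℂ] H).toPMap ⊤).inverse

/-- The domain `D(A ^ α)`, to be normed by `‖u‖ = |A ^ α u|`. For `α ≥ 0` this is `H_α`;
for `α < 0` its underlying space is all of `H`. -/
def PowDom (A : H →ₗ.[ℂ] H) (α : ℝ) : Type _ := (fracPow A α).domain

variable {A : H →ₗ.[ℂ] H} {α : ℝ}

noncomputable instance : AddCommGroup (PowDom A α) :=
  inferInstanceAs (AddCommGroup (fracPow A α).domain)

noncomputable instance : Module ℂ (PowDom A α) :=
  inferInstanceAs (Module ℂ (fracPow A α).domain)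

/-- The linear map `A ^ α : D(A ^ α) → H`. -/
noncomputable def PowDom.pow (A : H →ₗ.[ℂ] H) (α : ℝ) : PowDom A α →ₗ[ℂ] H :=
  (fracPow A α).toFun

/-- The inclusion `D(A ^ α) → H`. -/
noncomputable def PowDom.val (A : H →ₗ.[ℂ] H) (α : ℝ) : PowDom A α →ₗ[ℂ] H :=
  (fracPow A α).domain.subtype

/-- The norm `‖u‖ = |A ^ α u|`. -/
noncomputable instance : SeminormedAddCommGroup (PowDom A α) :=
  SeminormedAddCommGroup.induced (PowDom A α) H (PowDom.pow A α)

noncomputable instance : NormedSpace ℂ (PowDom A α) :=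
  NormedSpace.induced ℂ (PowDom A α) H (PowDom.pow A α)

/-- The extrapolation space `H_{-γ}`, `γ ≥ 0`: the completion of `H` in the norm
`h ↦ |A ^ (-γ) h|`. -/
abbrev Extrap (A : H →ₗ.[ℂ] H) (γ : ℝ) : Type _ :=
  UniformSpace.Completion (PowDom A (-γ))

/-- The (anti)dual pairing of `F ∈ H_{-γ}` with `φ ∈ D((A*) ^ γ)` has the value `c`, where the
pairing is the extension by continuity in the norm of `H_{-γ}` of the scalar product
`(h, φ)`, `h ∈ H` (linear in `h`, antilinear in `φ`). -/
def PairsTo (γ : ℝ) (F : Extrap A γ) (φ : H) (c : ℂ) : Prop :=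
  Tendsto (fun h : PowDom A (-γ) => inner ℂ φ (PowDom.val A (-γ) h))
    (comap (fun h : PowDom A (-γ) => (h : Extrap A γ)) (𝓝 F)) (𝓝 c)

end Scale

/-! ### Operators associated with forms, Kato operators -/

section Form

variable {H : Type*} [NormedAddCommGroup H] [InnerProductSpace ℂ H]
  {V : Type*} [NormedAddCommGroup V] [NormedSpace ℂ V]

/-- The graph `{(u, w) | u ∈ V, a(u, φ) = (w, φ) for all φ ∈ V}`, where `V` is embedded
into `H` by `ι`. -/
def formGraph (ι : V →L[ℂ] H) (a : V →ₗ[ℂ] V →ₗ⋆[ℂ] ℂ) : Submodule ℂ (H × H) where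
  carrier := {z | ∃ u : V, ι u = z.1 ∧ ∀ φ : V, a u φ = inner ℂ (ι φ) z.2}
  zero_mem' := ⟨0, by simp, by simp⟩
  add_mem' := by
    rintro z z' ⟨u, hu, h⟩ ⟨u', hu', h'⟩
    exact ⟨u + u', by simp [hu, hu'], fun φ => by simp [h φ, h' φ]⟩
  smul_mem' := by
    rintro c z ⟨u, hu, h⟩
    exact ⟨c • u, by simp [hu], fun φ => by simp [h φ]⟩

/-- The operator in `H` associated with the sesquilinear form `a` on `V`. -/
noncomputable def formOperator (ι : V →L[ℂ] H) (a : V →ₗ[ℂ] V →ₗ⋆[ℂ] ℂ) : H →ₗ.[ℂ] H :=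
  (formGraph ι a).toLinearPMap

/-- `A` is a Kato operator with a form on `V`: it is associated with a continuous strongly
accretive sesquilinear form on `V`, and `H_{1/2} = D(A ^ (1/2))` and `V` are the same subspace
of `H` with equivalent norms. -/
def IsKatoOperator (ι : V →L[ℂ] H) (A : H →ₗ.[ℂ] H) : Prop :=
  (∃ a : V →ₗ[ℂ] V →ₗ⋆[ℂ] ℂ,
    (∃ C : ℝ, 0 ≤ C ∧ ∀ u v : V, ‖a u v‖ ≤ C * ‖u‖ * ‖v‖) ∧
    (∃ c : ℝ, 0 < c ∧ ∀ u : V, c * ‖u‖ ^ 2 ≤ (a u u).re) ∧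
    A = formOperator ι a) ∧
  range (PowDom.val A (1 / 2)) = range ι ∧
  ∃ c C : ℝ, 0 < c ∧ ∀ (u : PowDom A (1 / 2)) (v : V), PowDom.val A (1 / 2) u = ι v →
    c * ‖v‖ ≤ ‖u‖ ∧ ‖u‖ ≤ C * ‖v‖

end Form

/-! ### `L_2(Ω, ℂⁿ)` and `W^{1,2}(Ω, ℂⁿ)` -/

section Spaces

variable {d n : ℕ}

/-- The space `ℂⁿ` with the Euclidean norm. -/
abbrev Cn (n : ℕ) : Type := EuclideanSpace ℂ (Fin n)

/-- The space `L_2(Ω, ℂⁿ)`. -/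
abbrev L2 (Ω : Set (EuclideanSpace ℝ (Fin d))) (n : ℕ) : Type :=
  Lp (Cn n) 2 (volume.restrict Ω)

/-- A scalar test function on `Ω`: smooth with compact support in `Ω`. -/
structure IsTestFunction (Ω : Set (EuclideanSpace ℝ (Fin d)))
    (ψ : EuclideanSpace ℝ (Fin d) → ℝ) : Prop where
  smooth : ContDiff ℝ ∞ ψ
  compact : HasCompactSupport ψ
  supp : tsupport ψ ⊆ Ω

/-- The partial derivative `∂ψ/∂xᵢ`. -/
noncomputable def partialDeriv (i : Fin d) (ψ : EuclideanSpace ℝ (Fin d) → ℝ)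
    (x : EuclideanSpace ℝ (Fin d)) : ℝ :=
  fderiv ℝ ψ x (EuclideanSpace.single i 1)

/-- `g` is the weak partial derivative `∂u/∂xᵢ` on `Ω`. -/
def IsWeakPartial (Ω : Set (EuclideanSpace ℝ (Fin d))) (i : Fin d) (u g : L2 Ω n) : Prop :=
  ∀ ψ : EuclideanSpace ℝ (Fin d) → ℝ, IsTestFunction Ω ψ →
    ∫ x in Ω, partialDeriv i ψ x • u x = -∫ x in Ω, ψ x • g x

theorem IsTestFunction.integrable_smul {Ω : Set (EuclideanSpace ℝ (Fin d))}
    {ψ : EuclideanSpace ℝ (Fin d) → ℝ} (hψ : IsTestFunction Ω ψ) (u : L2 Ω n) :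
    Integrable (fun x => ψ x • u x) (volume.restrict Ω) := by
  have h : MemLp ψ 2 (volume.restrict Ω) :=
    hψ.smooth.continuous.memLp_of_hasCompactSupport hψ.compact
  exact memLp_one_iff_integrable.1 ((Lp.memLp u).smul (r := 1) h)

theorem IsTestFunction.integrable_partialDeriv_smul {Ω : Set (EuclideanSpace ℝ (Fin d))}
    {ψ : EuclideanSpace ℝ (Fin d) → ℝ} (hψ : IsTestFunction Ω ψ) (i : Fin d) (u : L2 Ω n) :
    Integrable (fun x => partialDeriv i ψ x • u x) (volume.restrict Ω) := by
  have hc : Continuous (partialDeriv i ψ) :=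
    (hψ.smooth.continuous_fderiv (by simp)).clm_apply continuous_const
  have hs : HasCompactSupport (partialDeriv i ψ) :=
    (hψ.compact.fderiv (𝕜 := ℝ)).comp_left
      (g := fun L : EuclideanSpace ℝ (Fin d) →L[ℝ] ℝ => L (EuclideanSpace.single i 1)) rfl
  have h : MemLp (partialDeriv i ψ) 2 (volume.restrict Ω) := hc.memLp_of_hasCompactSupport hs
  exact memLp_one_iff_integrable.1 ((Lp.memLp u).smul (r := 1) h)

theorem IsWeakPartial.zero (Ω : Set (EuclideanSpace ℝ (Fin d))) (i : Fin d) :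
    IsWeakPartial Ω i (0 : L2 Ω n) 0 := by
  intro ψ _
  have h0 : ⇑(0 : L2 Ω n) =ᵐ[volume.restrict Ω] 0 := Lp.coeFn_zero _ _ _
  rw [integral_eq_zero_of_ae, integral_eq_zero_of_ae, neg_zero]
  · filter_upwards [h0] with x hx
    rw [hx]; simp
  · filter_upwards [h0] with x hx
    rw [hx]; simp

theorem IsWeakPartial.add {Ω : Set (EuclideanSpace ℝ (Fin d))} {i : Fin d} {u g u' g' : L2 Ω n}
    (h : IsWeakPartial Ω i u g) (h' : IsWeakPartial Ω i u' g') :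
    IsWeakPartial Ω i (u + u') (g + g') := by
  intro ψ hψ
  have e1 : ∫ x in Ω, partialDeriv i ψ x • (u + u') x =
      ∫ x in Ω, (partialDeriv i ψ x • u x + partialDeriv i ψ x • u' x) := by
    refine integral_congr_ae ?_
    filter_upwards [Lp.coeFn_add u u'] with x hx
    rw [hx]; simp
  have e2 : ∫ x in Ω, ψ x • (g + g') x = ∫ x in Ω, (ψ x • g x + ψ x • g' x) := by
    refine integral_congr_ae ?_
    filter_upwards [Lp.coeFn_add g g'] with x hx
    rw [hx]; simp
  rw [e1, e2, integral_add (hψ.integrable_partialDeriv_smul i u)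
    (hψ.integrable_partialDeriv_smul i u'), integral_add (hψ.integrable_smul g)
    (hψ.integrable_smul g'), h ψ hψ, h' ψ hψ, neg_add]

theorem IsWeakPartial.smul {Ω : Set (EuclideanSpace ℝ (Fin d))} {i : Fin d} {u g : L2 Ω n}
    (c : ℂ) (h : IsWeakPartial Ω i u g) : IsWeakPartial Ω i (c • u) (c • g) := by
  intro ψ hψ
  have e1 : ∫ x in Ω, partialDeriv i ψ x • (c • u) x =
      ∫ x in Ω, c • (partialDeriv i ψ x • u x) := by
    refine integral_congr_ae ?_
    filter_upwards [Lp.coeFn_smul c u] with x hx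
    simp [hx, smul_comm c]
  have e2 : ∫ x in Ω, ψ x • (c • g) x = ∫ x in Ω, c • (ψ x • g x) := by
    refine integral_congr_ae ?_
    filter_upwards [Lp.coeFn_smul c g] with x hx
    simp [hx, smul_comm c]
  rw [e1, e2, integral_smul, integral_smul, h ψ hψ, smul_neg]

/-- The Hilbert space `L_2(Ω, ℂⁿ) × L_2(Ω, ℂⁿ)ᵈ` with the norm `(‖u‖² + ∑ᵢ ‖gᵢ‖²) ^ (1/2)`. -/
abbrev L2Jet (Ω : Set (EuclideanSpace ℝ (Fin d))) (n : ℕ) : Type :=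
  WithLp 2 (L2 Ω n × PiLp 2 (fun _ : Fin d => L2 Ω n))

/-- The space `W^{1,2}(Ω, ℂⁿ)`: the pairs `(u, ∇u)` of `u ∈ L_2` and its weak gradient in `L_2`,
with the norm `(‖u‖² + ∑ᵢ ‖∂u/∂xᵢ‖²) ^ (1/2)`. The weak gradient is determined by `u`, and
the space of these pairs is closed in `L_2 × L_2ᵈ`. -/
def W12 (Ω : Set (EuclideanSpace ℝ (Fin d))) (n : ℕ) : Submodule ℂ (L2Jet Ω n) where
  carrier := {z | ∀ i, IsWeakPartial Ω i z.fst (z.snd i)}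
  zero_mem' := fun i => IsWeakPartial.zero Ω i
  add_mem' := fun h h' i => (h i).add (h' i)
  smul_mem' := fun c _ h i => (h i).smul c

/-- The map `(u, ∇u) ↦ u` from a subspace `V` of `W^{1,2}(Ω, ℂⁿ)` into `L_2(Ω, ℂⁿ)`. -/
noncomputable def toL2 {Ω : Set (EuclideanSpace ℝ (Fin d))} (V : Submodule ℂ (L2Jet Ω n)) :
    V →L[ℂ] L2 Ω n :=
  (WithLp.fstL 2 ℂ (L2 Ω n) (PiLp 2 (fun _ : Fin d => L2 Ω n))).comp V.subtypeL

/-- The continuous embedding `V ⊆ L_p(Ω, ℂⁿ)` for a subspace `V` of `W^{1,2}(Ω, ℂⁿ)`. -/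
def EmbedsInLp {Ω : Set (EuclideanSpace ℝ (Fin d))} (V : Submodule ℂ (L2Jet Ω n))
    (p : ℝ≥0∞) : Prop :=
  ∃ C : ℝ, ∀ u : V, eLpNorm (toL2 V u) p (volume.restrict Ω) ≤ ENNReal.ofReal (C * ‖u‖)

/-- The continuous embedding `D(T) ⊆ L_p(Ω, ℂⁿ)` for an operator `T` in `L_2(Ω, ℂⁿ)`, where
`D(T)` has the graph norm. -/
def DomainEmbedsInLp {Ω : Set (EuclideanSpace ℝ (Fin d))} (T : L2 Ω n →ₗ.[ℂ] L2 Ω n)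
    (p : ℝ≥0∞) : Prop :=
  ∃ C : ℝ, ∀ u : T.domain,
    eLpNorm (u : L2 Ω n) p (volume.restrict Ω) ≤ ENNReal.ofReal (C * (‖(u : L2 Ω n)‖ + ‖T u‖))

end Spaces

/-! ### Superposition operators -/

section Superposition

variable {d n : ℕ} {Ω : Set (EuclideanSpace ℝ (Fin d))}

/-- The value at `(t, u)` of the superposition operator generated by the multivalued function
`ft`: all measurable selections `v` of `x ↦ ft t x (u x)` on `Ω`. -/
def superposition (Ω : Set (EuclideanSpace ℝ (Fin d)))
    (ft : ℝ → EuclideanSpace ℝ (Fin d) → Cn n → Set (Cn n)) (t : ℝ) (u : L2 Ω n) :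
    Set (EuclideanSpace ℝ (Fin d) → Cn n) :=
  {v | AEStronglyMeasurable v (volume.restrict Ω) ∧
    ∀ᵐ x ∂volume.restrict Ω, v x ∈ ft t x (u x)}

/-- The function `v` on `Ω` is identified with the element `F` of `H_{-γ} ≅ D((A*) ^ γ)'`, that
is, `∫_Ω v(x) · conj φ(x) dx` exists and is the pairing of `F` with `φ`, for all
`φ ∈ D((A*) ^ γ)`. -/
def Represents {A : L2 Ω n →ₗ.[ℂ] L2 Ω n} (γ : ℝ) (v : EuclideanSpace ℝ (Fin d) → Cn n)
    (F : Extrap A γ) : Prop :=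
  ∀ φ ∈ (fracPow A.adjoint γ).domain,
    Integrable (fun x => inner ℂ (φ x) (v x)) (volume.restrict Ω) ∧
      PairsTo γ F φ (∫ x in Ω, inner ℂ (φ x) (v x))

/-- The superposition operator as a multivalued function with values in `H_{-γ}`. -/
def superpositionExtrap (A : L2 Ω n →ₗ.[ℂ] L2 Ω n) (α γ : ℝ)
    (ft : ℝ → EuclideanSpace ℝ (Fin d) → Cn n → Set (Cn n)) (t : ℝ) (u : PowDom A α) :
    Set (Extrap A γ) :=
  {F | ∃ v ∈ superposition Ω ft t (PowDom.val A α u), Represents γ v F}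

/-- `f : [0, ∞) × H_α → 2 ^ H_{-γ}`: every element of every value `f(t, u)` belongs
to `H_{-γ}`. -/
def MapsIntoExtrap (A : L2 Ω n →ₗ.[ℂ] L2 Ω n) (α γ : ℝ)
    (ft : ℝ → EuclideanSpace ℝ (Fin d) → Cn n → Set (Cn n)) : Prop :=
  ∀ t : ℝ, 0 ≤ t → ∀ u : PowDom A α, ∀ v ∈ superposition Ω ft t (PowDom.val A α u),
    ∃ F : Extrap A γ, Represents γ v F

/-- Multiplication of `u : Ω → ℂⁿ` by the matrix function `Bt`. -/
noncomputable def multiplier (Bt : EuclideanSpace ℝ (Fin d) → Matrix (Fin n) (Fin n) ℂ)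
    (u : EuclideanSpace ℝ (Fin d) → Cn n) (x : EuclideanSpace ℝ (Fin d)) : Cn n :=
  WithLp.toLp 2 ((Bt x).mulVec (u x))

/-- The assumptions on the function `ft` generating the superposition operator: on
`[0, ∞) × Ω × ℂⁿ` it is the sum of the linear part `Bt x u` and a remainder `gt` which for almost
all `x ∈ Ω` is `o(|u|)` as `u → 0`, uniformly in `t > 0` (with `sup ∅ = 0`), and bounded by
`C₀ (|u| + |u| ^ σ)` for all `t ≥ 0` and all `u`. -/
structure IsLinearizable (Ω : Set (EuclideanSpace ℝ (Fin d)))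
    (ft gt : ℝ → EuclideanSpace ℝ (Fin d) → Cn n → Set (Cn n))
    (Bt : EuclideanSpace ℝ (Fin d) → Matrix (Fin n) (Fin n) ℂ) (σ : ℝ) : Prop where
  decomp : ∀ t : ℝ, 0 ≤ t → ∀ x ∈ Ω, ∀ u : Cn n,
    ft t x u = (fun v => WithLp.toLp 2 ((Bt x).mulVec u) + v) '' gt t x u
  small : ∀ᵐ x ∂volume.restrict Ω,
    Tendsto (fun u : Cn n => (⨆ t ∈ Ioi (0 : ℝ), ⨆ v ∈ gt t x u, ‖v‖ₑ) / ‖u‖ₑ) (𝓝[≠] 0) (𝓝 0)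
  growth : ∃ C₀ : ℝ, 0 < C₀ ∧ ∀ᵐ x ∂volume.restrict Ω, ∀ t : ℝ, 0 ≤ t → ∀ u : Cn n,
    ∀ v ∈ gt t x u, ‖v‖ ≤ C₀ * (‖u‖ + ‖u‖ ^ σ)

end Superposition

/-! ### The hypothesis `(B_γ)` -/

section Hypothesis

variable {H : Type*} [NormedAddCommGroup H] [InnerProductSpace ℂ H] {A : H →ₗ.[ℂ] H} {α γ : ℝ}

/-- The hypothesis `(B_γ)` for `f : U → 2 ^ H_{-γ}`, `U ⊆ ℝ × H_α`, at the point `u₀ = 0` (where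
`A_{-γ} u₀ = 0`), with the bounded linear map `B : H_α → H_{-γ}`: `0` is a `γ`-weak equilibrium,
`U` contains `[0, ∞) × U₁` for a neighborhood `U₁` of `0`, and `g(t, u) = f(t, u) - B u` is
`o(‖u‖)` as `u → 0` in `H_α`, uniformly in `t > 0` (with `sup ∅ = 0`). -/
structure HypothesisB (U : Set (ℝ × PowDom A α)) (f : ℝ → PowDom A α → Set (Extrap A γ))
    (B : PowDom A α →L[ℂ] Extrap A γ) : Prop where
  equilibrium : ∀ t : ℝ, 0 < t → (0 : Extrap A γ) ∈ f t 0
  nhd : ∃ U₁ : Set (PowDom A α), IsOpen U₁ ∧ 0 ∈ U₁ ∧ Ici (0 : ℝ) ×ˢ U₁ ⊆ U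
  small : Tendsto
    (fun u : PowDom A α => (⨆ t ∈ Ioi (0 : ℝ), ⨆ F ∈ f t u, ‖F - B u‖ₑ) / ‖u‖ₑ)
    (𝓝[≠] 0) (𝓝 0)

end Hypothesis

/-- The superposition operator generated by `ft` maps `[0, ∞) × H_α` into `2 ^ H_{-γ}`, the
multiplication by `Bt` is a bounded operator `B : H_α → H_{-γ}`, and `(B_γ)` holds at `u₀ = 0`
with this `B`. -/
def SatisfiesB {d n : ℕ} {Ω : Set (EuclideanSpace ℝ (Fin d))} (A : L2 Ω n →ₗ.[ℂ] L2 Ω n)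
    (α γ : ℝ) (ft : ℝ → EuclideanSpace ℝ (Fin d) → Cn n → Set (Cn n))
    (Bt : EuclideanSpace ℝ (Fin d) → Matrix (Fin n) (Fin n) ℂ) : Prop :=
  MapsIntoExtrap A α γ ft ∧
    ∃ B : PowDom A α →L[ℂ] Extrap A γ,
      (∀ u : PowDom A α, Represents γ (multiplier Bt (PowDom.val A α u)) (B u)) ∧
      HypothesisB (Ici (0 : ℝ) ×ˢ univ) (superpositionExtrap A α γ ft) B

end KatoScale

set_option linter.unusedSectionVars false
set_option linter.unusedVariables false

/-! The nonlinearity enters only through Hölder's inequality. The substance is a sharp embedding of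
D((A*)^γ) into a Lebesgue space L_q. By duality such an embedding gives L_{q'} ⊆ H_{-γ}, where 1/q +
1/q' = 1. If moreover H_α ⊆ L_m, the conclusion follows from the three inequalities 1/m + 1/q < 1,
σ/m + 1/q ≤ 1 and 1/r + 1/m + 1/q ≤ 1 (`satisfiesB_of_mapsIntoLp`). The thresholds γ₀ and γ₁ are the
values of γ at which the last two become equalities. As these values are admitted, the embedding is
needed at the exact interpolation exponent, without an ε of loss.

For γ ≥ 1/2 one has D((A*)^γ) ⊆ V. If γ > 1/2, this is because the integral defining (A*)^(-γ)
converges in V. If γ = 1/2, it is dual to the Kato inclusion V ⊆ D(A^(1/2)), by means of A^(-1/2)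
A^(-1/2) = A^(-1) (`fracInt_half_sq`, `exists_fracInt_half_adjoint`).

The remaining embeddings, between L_2 and L_{p_*} for γ < 1/2 and between L_{p_*} and L_p for γ >
1/2, are real interpolation carried out by hand. One writes (A*)^(-γ) ψ = ∫ Φ(s) ds, where the two
endpoint norms of Φ(s) are at most s^(-β-1/2) b(s) and s^(-β) b(s), and b(s) is a multiple of the
V-norm of (s + A*)^(-1) ψ. That b is square integrable is `quadratic_estimate`, an
almost-orthogonality argument using coercivity alone. `exists_eLpNorm_le_of_integral` then bounds ∫
Φ in L_q: it tests with a truncated duality function that is split, for each s, at a level depending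
on s.

The passage from the pointwise o(|u|) to o(‖u‖) is `exists_eLpNorm_superposition_le`: along a
subsequence the quotient |v|/|u| tends to zero in the Lebesgue space that Hölder's inequality asks
for. -/

namespace KatoScale

/-! ### Coercive forms: Lax–Milgram and resolvent estimates -/

section Coercive

variable {H : Type*} [NormedAddCommGroup H] [InnerProductSpace ℂ H] [CompleteSpace H]
  {V : Type*} [NormedAddCommGroup V] [InnerProductSpace ℂ V] [CompleteSpace V]

open scoped InnerProduct

/-- The bounded operator `T` on `V` is coercive with constant `c`. -/
structure IsCoerciveOp (T : V →L[ℂ] V) (c : ℝ) : Prop where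
  pos : 0 < c
  le_re : ∀ u : V, c * ‖u‖ ^ 2 ≤ (inner ℂ u (T u)).re

/-- The operator `T + s ι† ι` on `V`, which represents the form `a + s (·, ·)`. -/
noncomputable def shiftedOp (T : V →L[ℂ] V) (ι : V →L[ℂ] H) (s : ℝ) : V →L[ℂ] V :=
  T + (s : ℂ) • (ι.adjoint ∘L ι)

/-- The map `(s + A)⁻¹ : H → V`. -/
noncomputable def solve (T : V →L[ℂ] V) (ι : V →L[ℂ] H) (s : ℝ) : H →L[ℂ] V :=
  Ring.inverse (shiftedOp T ι s) ∘L ι.adjoint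

/-- The map `(s + A)⁻¹ : H → H`. -/
noncomputable def resol (T : V →L[ℂ] V) (ι : V →L[ℂ] H) (s : ℝ) : H →L[ℂ] H :=
  ι ∘L solve T ι s

variable {T : V →L[ℂ] V} {ι : V →L[ℂ] H} {c : ℝ}

theorem resol_apply (s : ℝ) (h : H) : resol T ι s h = ι (solve T ι s h) := rfl

theorem re_inner_comm (u v : V) : (inner ℂ u v).re = (inner ℂ v u).re := by
  rw [← inner_conj_symm, Complex.conj_re]

theorem IsCoerciveOp.adjoint (hT : IsCoerciveOp T c) : IsCoerciveOp T.adjoint c :=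
  ⟨hT.pos, fun u => by
    rw [ContinuousLinearMap.adjoint_inner_right, re_inner_comm]; exact hT.le_re u⟩

theorem inner_shiftedOp (s : ℝ) (u v : V) :
    inner ℂ u (shiftedOp T ι s v) = inner ℂ u (T v) + s * inner ℂ (ι u) (ι v) := by
  simp [shiftedOp, ContinuousLinearMap.adjoint_inner_right]

theorem shiftedOp_adjoint (s : ℝ) : (shiftedOp T ι s).adjoint = shiftedOp T.adjoint ι s := by
  refine ContinuousLinearMap.ext fun x => ext_inner_left ℂ fun v => ?_
  rw [ContinuousLinearMap.adjoint_inner_right, inner_shiftedOp, ← inner_conj_symm,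
    inner_shiftedOp, map_add, map_mul, inner_conj_symm, inner_conj_symm, Complex.conj_ofReal,
    ContinuousLinearMap.adjoint_inner_right]

/-- ι†ι is nonnegative, so the coercivity constant survives every shift s ≥ 0. This is why all later
bounds are uniform in s. -/
theorem IsCoerciveOp.shifted (hT : IsCoerciveOp T c) (ι : V →L[ℂ] H) {s : ℝ} (hs : 0 ≤ s) :
    IsCoerciveOp (shiftedOp T ι s) c := by
  refine ⟨hT.pos, fun u => (hT.le_re u).trans ?_⟩
  rw [inner_shiftedOp, inner_self_eq_norm_sq_to_K]
  have : ((s : ℂ) * ((‖ι u‖ : ℂ)) ^ 2).re = s * ‖ι u‖ ^ 2 := by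
    norm_cast
  simp only [Complex.add_re, Complex.coe_algebraMap, this]
  nlinarith [mul_nonneg hs (sq_nonneg ‖ι u‖)]

theorem IsCoerciveOp.isUnit (hT : IsCoerciveOp T c) : IsUnit T := by
  refine ContinuousLinearMap.isUnit_of_forall_le_norm_inner_map T (c := ⟨c, hT.pos.le⟩) hT.pos ?_
  intro x
  rw [mul_comm]
  refine (hT.le_re x).trans ?_
  rw [re_inner_comm]
  exact Complex.re_le_norm _

theorem IsCoerciveOp.apply_inverse (hT : IsCoerciveOp T c) (x : V) : T (Ring.inverse T x) = x := by
  have := Ring.mul_inverse_cancel T hT.isUnit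
  exact congrArg (fun S : V →L[ℂ] V => S x) this

theorem IsCoerciveOp.inverse_apply (hT : IsCoerciveOp T c) (x : V) : Ring.inverse T (T x) = x := by
  have := Ring.inverse_mul_cancel T hT.isUnit
  exact congrArg (fun S : V →L[ℂ] V => S x) this

theorem IsCoerciveOp.norm_le (hT : IsCoerciveOp T c) (x : V) : c * ‖x‖ ≤ ‖T x‖ := by
  rcases eq_or_ne x 0 with rfl | hx
  · simp
  have h1 := (hT.le_re x).trans ((Complex.re_le_norm _).trans (norm_inner_le_norm x (T x)))
  have : 0 < ‖x‖ := norm_pos_iff.2 hx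
  nlinarith

theorem inverse_adjoint (hT : IsCoerciveOp T c) :
    (Ring.inverse T).adjoint = Ring.inverse T.adjoint := by
  ext x
  have h : T.adjoint ((Ring.inverse T).adjoint x) = x := by
    refine ext_inner_left ℂ fun v => ?_
    rw [ContinuousLinearMap.adjoint_inner_right, ContinuousLinearMap.adjoint_inner_right,
      hT.inverse_apply]
  rw [← hT.adjoint.inverse_apply ((Ring.inverse T).adjoint x), h]

theorem shiftedOp_solve (hT : IsCoerciveOp T c) {s : ℝ} (hs : 0 ≤ s) (h : H) :
    shiftedOp T ι s (solve T ι s h) = ι.adjoint h :=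
  (hT.shifted ι hs).apply_inverse _

theorem solve_eq (hT : IsCoerciveOp T c) {s : ℝ} (hs : 0 ≤ s) {h : H} {u : V}
    (hu : shiftedOp T ι s u = ι.adjoint h) : solve T ι s h = u := by
  rw [solve, ContinuousLinearMap.comp_apply, ← hu, (hT.shifted ι hs).inverse_apply]

theorem op_solve (hT : IsCoerciveOp T c) {s : ℝ} (hs : 0 ≤ s) (h : H) :
    T (solve T ι s h) = ι.adjoint (h - (s : ℂ) • resol T ι s h) := by
  have := shiftedOp_solve (ι := ι) hT hs h
  simp only [shiftedOp, add_apply, smul_apply,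
    ContinuousLinearMap.comp_apply] at this
  rw [map_sub, map_smul, ← this, resol_apply]
  abel

/-- T† represents the adjoint form and is coercive with the same constant, so every estimate for the
resolvents of A transfers to A*. -/
theorem resol_adjoint (hT : IsCoerciveOp T c) {s : ℝ} (hs : 0 ≤ s) :
    (resol T ι s).adjoint = resol T.adjoint ι s := by
  rw [resol, resol, solve, solve, ContinuousLinearMap.adjoint_comp,
    ContinuousLinearMap.adjoint_comp, ContinuousLinearMap.adjoint_adjoint,
    inverse_adjoint (hT.shifted ι hs), shiftedOp_adjoint]
  rfl

/-- The resolvent identity. -/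
theorem solve_sub_solve (hT : IsCoerciveOp T c) {s t : ℝ} (hs : 0 ≤ s) (ht : 0 ≤ t) (h : H) :
    solve T ι s h - solve T ι t h = ((t : ℂ) - s) • solve T ι t (resol T ι s h) := by
  rw [← map_smul, sub_eq_iff_eq_add, ← map_add]
  refine solve_eq hT hs ?_
  have h1 := shiftedOp_solve (ι := ι) hT ht (((t : ℂ) - s) • resol T ι s h + h)
  set y := solve T ι t (((t : ℂ) - s) • resol T ι s h + h) with hy
  -- This is (t + A)(s + A)^(-1) h = (t - s)(s + A)^(-1) h + h, read in V.
  have h2 : y = solve T ι s h := by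
    refine solve_eq hT ht ?_
    have h3 := op_solve (ι := ι) hT hs h
    simp only [shiftedOp, add_apply, smul_apply, ContinuousLinearMap.comp_apply]
    rw [h3, ← resol_apply]
    simp only [map_sub, map_add, map_smul]
    module
  rw [h2, shiftedOp_solve hT hs]

theorem solve_sub_solve' (hT : IsCoerciveOp T c) {s t : ℝ} (hs : 0 ≤ s) (ht : 0 ≤ t) :
    solve T ι s - solve T ι t = ((t : ℂ) - s) • (solve T ι t ∘L resol T ι s) :=
  ContinuousLinearMap.ext fun h => solve_sub_solve hT hs ht h

theorem resol_sub_resol (hT : IsCoerciveOp T c) {s t : ℝ} (hs : 0 ≤ s) (ht : 0 ≤ t) :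
    resol T ι s - resol T ι t = ((t : ℂ) - s) • (resol T ι t * resol T ι s) := by
  ext h
  have := congrArg ι (solve_sub_solve (ι := ι) hT hs ht h)
  rw [map_sub, map_smul] at this
  exact this

theorem resol_comm (hT : IsCoerciveOp T c) {s t : ℝ} (hs : 0 ≤ s) (ht : 0 ≤ t) :
    Commute (resol T ι s) (resol T ι t) := by
  rcases eq_or_ne s t with rfl | hst
  · exact Commute.refl _
  have h1 := resol_sub_resol (ι := ι) hT hs ht
  have h2 := resol_sub_resol (ι := ι) hT ht hs
  rw [← neg_sub, h1, ← neg_smul, neg_sub] at h2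
  have : (s : ℂ) - t ≠ 0 := sub_ne_zero.2 (by exact_mod_cast hst)
  exact (smul_right_injective _ this h2).symm

/-- Test the equation (s + A) u = h with its own solution u and use coercivity. Both the H-bound and
the V-bound of the resolvent come from here. -/
theorem energy_solve (hT : IsCoerciveOp T c) {s : ℝ} (hs : 0 ≤ s) (h : H) :
    c * ‖solve T ι s h‖ ^ 2 + s * ‖resol T ι s h‖ ^ 2 ≤ (inner ℂ (resol T ι s h) h).re := by
  have h1 := congrArg (fun x => inner ℂ (solve T ι s h) x) (shiftedOp_solve (ι := ι) hT hs h)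
  simp only [inner_shiftedOp, ContinuousLinearMap.adjoint_inner_right] at h1
  rw [resol_apply, ← h1, inner_self_eq_norm_sq_to_K]
  have : ((s : ℂ) * ((‖ι (solve T ι s h)‖ : ℂ)) ^ 2).re = s * ‖ι (solve T ι s h)‖ ^ 2 := by
    norm_cast
  simp only [Complex.add_re, Complex.coe_algebraMap, this]
  have := hT.le_re (solve T ι s h)
  linarith

/-- A lower bound for the spectrum of `A`. -/
noncomputable def gap (ι : V →L[ℂ] H) (c : ℝ) : ℝ := c / (‖ι‖ ^ 2 + 1)

theorem gap_pos (hT : IsCoerciveOp T c) : 0 < gap ι c := div_pos hT.pos (by positivity)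

theorem gap_mul_le (hT : IsCoerciveOp T c) (u : V) : gap ι c * ‖ι u‖ ^ 2 ≤ c * ‖u‖ ^ 2 := by
  rw [gap, div_mul_eq_mul_div, div_le_iff₀ (by positivity), mul_assoc]
  refine mul_le_mul_of_nonneg_left ?_ hT.pos.le
  have := ι.le_opNorm u
  have h2 : ‖ι u‖ ^ 2 ≤ (‖ι‖ * ‖u‖) ^ 2 := pow_le_pow_left₀ (norm_nonneg _) this 2
  nlinarith [sq_nonneg ‖u‖]

theorem norm_resol_apply_le (hT : IsCoerciveOp T c) {s : ℝ} (hs : 0 ≤ s) (h : H) :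
    ‖resol T ι s h‖ ≤ (s + gap ι c)⁻¹ * ‖h‖ := by
  have hp : 0 < s + gap ι c := add_pos_of_nonneg_of_pos hs (gap_pos hT)
  rw [inv_mul_eq_div, le_div_iff₀ hp]
  have h1 := energy_solve (ι := ι) hT hs h
  have h2 := gap_mul_le (ι := ι) hT (solve T ι s h)
  have h3 := (Complex.re_le_norm _).trans (norm_inner_le_norm (𝕜 := ℂ) (resol T ι s h) h)
  rw [← resol_apply] at h2
  rcases (norm_nonneg (resol T ι s h)).eq_or_lt with h0 | h0
  · rw [← h0]; simp
  · nlinarith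

theorem norm_resol_le (hT : IsCoerciveOp T c) {s : ℝ} (hs : 0 ≤ s) :
    ‖resol T ι s‖ ≤ (s + gap ι c)⁻¹ :=
  ContinuousLinearMap.opNorm_le_bound _
    (inv_nonneg.2 (add_pos_of_nonneg_of_pos hs (gap_pos hT)).le) (norm_resol_apply_le hT hs)

theorem norm_solve_sq_le (hT : IsCoerciveOp T c) {s : ℝ} (hs : 0 ≤ s) (h : H) :
    ‖solve T ι s h‖ ^ 2 ≤ c⁻¹ * (s + gap ι c)⁻¹ * ‖h‖ ^ 2 := by
  have h1 := energy_solve (ι := ι) hT hs h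
  have h3 := (Complex.re_le_norm _).trans (norm_inner_le_norm (𝕜 := ℂ) (resol T ι s h) h)
  have h4 := norm_resol_apply_le (ι := ι) hT hs h
  rw [mul_assoc, inv_mul_eq_div, le_div_iff₀ hT.pos]
  nlinarith [norm_nonneg h, mul_nonneg hs (sq_nonneg ‖resol T ι s h‖),
    mul_le_mul_of_nonneg_right h4 (norm_nonneg h)]

/-- The key estimate: the resolvents are sectorial on `V`. -/
theorem sq_norm_sub_add_le (hT : IsCoerciveOp T c) {s : ℝ} (hs : 0 ≤ s) (x : V) :
    ‖ι x - (s : ℂ) • resol T ι s (ι x)‖ ^ 2 + s * (c * ‖solve T ι s (ι x)‖ ^ 2) ≤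
      ‖T‖ * ‖solve T ι s (ι x)‖ * ‖x‖ := by
  set z := solve T ι s (ι x) with hz
  -- The resolvent equation reads T z = ι†ι(x - s z). Testing it with x - s z makes one side a
  -- square, and the term s (z, T z) on the other side has the good sign by coercivity.
  have h1 : T z = ι.adjoint (ι (x - (s : ℂ) • z)) := by
    rw [hz, op_solve hT hs, map_sub ι, map_smul ι, resol_apply]
  have h2 : inner ℂ (x - (s : ℂ) • z) (T z) = ((‖ι (x - (s : ℂ) • z)‖ ^ 2 : ℝ) : ℂ) := by
    rw [h1, ContinuousLinearMap.adjoint_inner_right, inner_self_eq_norm_sq_to_K]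
    norm_cast
  rw [inner_sub_left, inner_smul_left, Complex.conj_ofReal] at h2
  have h3 := congrArg Complex.re h2
  rw [Complex.sub_re, Complex.re_ofReal_mul, Complex.ofReal_re, map_sub, map_smul] at h3
  have h4 := hT.le_re z
  have h5 := (Complex.re_le_norm _).trans (norm_inner_le_norm (𝕜 := ℂ) x (T z))
  have h6 := mul_le_mul_of_nonneg_left (T.le_opNorm z) (norm_nonneg x)
  have h7 := mul_le_mul_of_nonneg_left h4 hs
  rw [resol_apply, ← hz]
  nlinarith

/-- Without the square, `sq_norm_sub_add_le` reads s c ‖z‖² ≤ ‖T‖ ‖z‖ ‖x‖, and one factor ‖z‖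
cancels. So the resolvent decays like 1/s from V to V, as it does on H. -/
theorem norm_solve_embed_le (hT : IsCoerciveOp T c) {s : ℝ} (hs : 0 < s) (x : V) :
    ‖solve T ι s (ι x)‖ ≤ ‖T‖ / c / s * ‖x‖ := by
  have h := sq_norm_sub_add_le (ι := ι) hT hs.le x
  have hc := hT.pos
  rw [div_div, div_mul_eq_mul_div, le_div_iff₀ (by positivity)]
  rcases (norm_nonneg (solve T ι s (ι x))).eq_or_lt with h0 | h0
  · rw [← h0]; simp; positivity
  · have : 0 ≤ ‖ι x - (s : ℂ) • resol T ι s (ι x)‖ ^ 2 := by positivity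
    nlinarith

/-- Insert the 1/s decay of z into the right-hand side of `sq_norm_sub_add_le`. Vectors of V thus
gain s^(-1/2) in the H-norm of x - s (s + A)^(-1) x = A (s + A)^(-1) x. -/
theorem norm_sub_resol_sq_le (hT : IsCoerciveOp T c) {s : ℝ} (hs : 0 < s) (x : V) :
    ‖ι x - (s : ℂ) • resol T ι s (ι x)‖ ^ 2 ≤ ‖T‖ ^ 2 / c / s * ‖x‖ ^ 2 := by
  have h := sq_norm_sub_add_le (ι := ι) hT hs.le x
  have h2 := mul_le_mul_of_nonneg_left (norm_solve_embed_le (ι := ι) hT hs x)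
    (mul_nonneg (norm_nonneg T) (norm_nonneg x))
  have hc := hT.pos
  have : 0 ≤ s * (c * ‖solve T ι s (ι x)‖ ^ 2) := by positivity
  calc _ ≤ ‖T‖ * ‖x‖ * (‖T‖ / c / s * ‖x‖) := by nlinarith
    _ = _ := by ring

theorem norm_sub_solve_le (hT : IsCoerciveOp T c) {s : ℝ} (hs : 0 < s) (x : V) :
    ‖x - (s : ℂ) • solve T ι s (ι x)‖ ≤ (1 + ‖T‖ / c) * ‖x‖ := by
  refine (norm_sub_le _ _).trans ?_
  rw [norm_smul, Complex.norm_real, Real.norm_of_nonneg hs.le, add_mul, one_mul]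
  refine add_le_add_right ?_ _
  have := mul_le_mul_of_nonneg_left (norm_solve_embed_le (ι := ι) hT hs x) hs.le
  refine this.trans (le_of_eq ?_)
  field_simp

theorem eq_zero_of_solve_eq_zero (hT : IsCoerciveOp T c) (hι : DenseRange ι) {s : ℝ} (hs : 0 ≤ s) {h : H}
    (h0 : solve T ι s h = 0) : h = 0 := by
  have h1 := shiftedOp_solve (ι := ι) hT hs h
  rw [h0, map_zero] at h1
  refine hι.eq_zero_of_inner_right ℂ fun v => ?_
  rw [← ContinuousLinearMap.adjoint_inner_right, ← h1, inner_zero_right]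

theorem norm_solve_le (hT : IsCoerciveOp T c) {s : ℝ} (hs : 0 ≤ s) :
    ‖solve T ι s‖ ≤ (√c)⁻¹ * (s + gap ι c) ^ (-(1 / 2) : ℝ) := by
  have hp : 0 < s + gap ι c := add_pos_of_nonneg_of_pos hs (gap_pos hT)
  refine ContinuousLinearMap.opNorm_le_bound _ (by positivity) fun h => ?_
  have h1 := norm_solve_sq_le (ι := ι) hT hs h
  have h2 := Real.sqrt_le_sqrt h1
  rw [Real.sqrt_sq (norm_nonneg _), Real.sqrt_mul (by have := hT.pos; positivity),
    Real.sqrt_sq (norm_nonneg _), Real.sqrt_mul (by have := hT.pos; positivity), Real.sqrt_inv,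
    Real.sqrt_inv, Real.sqrt_eq_rpow (s + gap ι c), ← Real.rpow_neg hp.le] at h2
  exact h2

theorem norm_solve_le_zero (hT : IsCoerciveOp T c) {s : ℝ} (hs : 0 ≤ s) :
    ‖solve T ι s‖ ≤ (√c)⁻¹ * (gap ι c) ^ (-(1 / 2) : ℝ) := by
  refine (norm_solve_le hT hs).trans ?_
  refine mul_le_mul_of_nonneg_left ?_ (by positivity)
  exact Real.rpow_le_rpow_of_nonpos (gap_pos hT) (by linarith) (by norm_num)

theorem continuousOn_solve (hT : IsCoerciveOp T c) : ContinuousOn (solve T ι) (Ici 0) := by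
  intro t ht
  refine tendsto_iff_norm_sub_tendsto_zero.2 ?_
  set C := (√c)⁻¹ * (gap ι c) ^ (-(1 / 2) : ℝ)
  have hb : ∀ s ∈ Ici (0 : ℝ), ‖solve T ι s - solve T ι t‖ ≤ |t - s| * (C * (gap ι c)⁻¹) := by
    intro s hs
    rw [solve_sub_solve' hT hs ht, norm_smul]
    have e : ‖(t : ℂ) - s‖ = |t - s| := by
      rw [← Complex.ofReal_sub, Complex.norm_real, Real.norm_eq_abs]
    rw [e]
    refine mul_le_mul_of_nonneg_left ?_ (abs_nonneg _)
    refine (ContinuousLinearMap.opNorm_comp_le _ _).trans ?_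
    have h2 : ‖resol T ι s‖ ≤ (gap ι c)⁻¹ :=
      (norm_resol_le hT hs).trans (inv_anti₀ (gap_pos hT) (by linarith [mem_Ici.1 hs]))
    exact mul_le_mul (norm_solve_le_zero hT ht) h2 (norm_nonneg _)
      ((norm_nonneg _).trans (norm_solve_le_zero hT ht))
  refine squeeze_zero' (Eventually.of_forall fun _ => norm_nonneg _)
    (eventually_mem_nhdsWithin.mono hb) ?_
  have : Tendsto (fun s : ℝ => |t - s| * (C * (gap ι c)⁻¹)) (𝓝 t) (𝓝 (|t - t| * (C * (gap ι c)⁻¹))) :=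
    Continuous.tendsto (by fun_prop) t
  rw [sub_self, abs_zero, zero_mul] at this
  exact this.mono_left nhdsWithin_le_nhds

theorem continuousOn_resol (hT : IsCoerciveOp T c) : ContinuousOn (resol T ι) (Ici 0) :=
  (ContinuousLinearMap.compL ℂ H V H ι).continuous.comp_continuousOn (continuousOn_solve hT)

theorem hasDerivAt_resol (hT : IsCoerciveOp T c) {t : ℝ} (ht : 0 < t) :
    HasDerivAt (resol T ι) (-(resol T ι t * resol T ι t)) t := by
  rw [hasDerivAt_iff_tendsto_slope]
  have h1 : Tendsto (fun s => -(resol T ι t * resol T ι s)) (𝓝[≠] t)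
      (𝓝 (-(resol T ι t * resol T ι t))) := by
    have : ContinuousAt (resol T ι) t := (continuousOn_resol hT).continuousAt (Ici_mem_nhds ht)
    exact ((this.tendsto.mono_left nhdsWithin_le_nhds).const_mul _).neg
  refine h1.congr' ?_
  filter_upwards [eventually_mem_nhdsWithin, mem_nhdsWithin_of_mem_nhds (Ioi_mem_nhds ht)]
    with s hs hs0
  have hst : (s : ℂ) - t ≠ 0 := sub_ne_zero.2 (by exact_mod_cast hs)
  rw [slope_def_module, resol_sub_resol hT (le_of_lt hs0) ht.le, ← Complex.coe_smul, smul_smul]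
  push_cast
  rw [show ((s : ℂ) - t)⁻¹ * (t - s) = -1 by rw [← neg_sub (s : ℂ), mul_neg, inv_mul_cancel₀ hst],
    neg_one_smul]

end Coercive

/-! ### Power integrals and Hilbert's inequality -/

theorem lintegral_Ioc_rpow {e a : ℝ} (he : -1 < e) (ha : 0 ≤ a) :
    ∫⁻ s in Ioc 0 a, ENNReal.ofReal (s ^ e) = ENNReal.ofReal (a ^ (e + 1) / (e + 1)) := by
  rw [← ofReal_integral_eq_lintegral_ofReal, ← intervalIntegral.integral_of_le ha,
    integral_rpow (Or.inl he), Real.zero_rpow (by linarith), sub_zero]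
  · exact (intervalIntegrable_iff_integrableOn_Ioc_of_le ha).1
      (intervalIntegral.intervalIntegrable_rpow' he)
  · exact (ae_restrict_mem measurableSet_Ioc).mono fun s hs => Real.rpow_nonneg hs.1.le _

theorem lintegral_Ioi_rpow {e a : ℝ} (he : e < -1) (ha : 0 < a) :
    ∫⁻ s in Ioi a, ENNReal.ofReal (s ^ e) = ENNReal.ofReal (-a ^ (e + 1) / (e + 1)) := by
  rw [← ofReal_integral_eq_lintegral_ofReal (integrableOn_Ioi_rpow_of_lt he ha),
    integral_Ioi_rpow_of_lt he ha]
  exact (ae_restrict_mem measurableSet_Ioi).mono fun s hs => Real.rpow_nonneg (ha.trans hs).le _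

/-- Schur's test for 1 / max s t with the weight t^(-1/2). The ranges t ≤ s and t > s contribute 2
each; this is the 4 of Hilbert's inequality. -/
theorem lintegral_max_kernel_le {s : ℝ} (hs : 0 < s) :
    ∫⁻ t in Ioi 0, ENNReal.ofReal ((s / t) ^ (1 / 2 : ℝ) / max s t) ≤ 4 := by
  rw [← Ioc_union_Ioi_eq_Ioi hs.le, lintegral_union measurableSet_Ioi Ioc_disjoint_Ioi_same]
  have h1 : ∫⁻ t in Ioc 0 s, ENNReal.ofReal ((s / t) ^ (1 / 2 : ℝ) / max s t) ≤ 2 := by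
    calc _ = ∫⁻ t in Ioc 0 s, ENNReal.ofReal (s ^ (-(1 / 2) : ℝ)) *
          ENNReal.ofReal (t ^ (-(1 / 2) : ℝ)) := by
          refine setLIntegral_congr_fun measurableSet_Ioc fun t ht => ?_
          rw [← ENNReal.ofReal_mul (by positivity), max_eq_left ht.2, Real.div_rpow hs.le ht.1.le,
            Real.rpow_neg ht.1.le, div_right_comm, ← Real.rpow_sub_one hs.ne']
          norm_num [div_eq_mul_inv]
      _ = 2 := by
          rw [lintegral_const_mul _ (by fun_prop), lintegral_Ioc_rpow (by norm_num) hs.le,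
            ← ENNReal.ofReal_mul (by positivity), ← mul_div_assoc, ← Real.rpow_add hs]
          norm_num
      _ ≤ 2 := le_rfl
  have h2 : ∫⁻ t in Ioi s, ENNReal.ofReal ((s / t) ^ (1 / 2 : ℝ) / max s t) ≤ 2 := by
    calc _ = ∫⁻ t in Ioi s, ENNReal.ofReal (s ^ (1 / 2 : ℝ)) *
          ENNReal.ofReal (t ^ (-(3 / 2) : ℝ)) := by
          refine setLIntegral_congr_fun measurableSet_Ioi fun t ht => ?_
          have ht0 : 0 < t := hs.trans ht
          rw [← ENNReal.ofReal_mul (by positivity), max_eq_right (le_of_lt ht),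
            Real.div_rpow hs.le ht0.le, div_div, ← Real.rpow_add_one ht0.ne', Real.rpow_neg ht0.le,
            div_eq_mul_inv]
          norm_num
      _ = 2 := by
          rw [lintegral_const_mul _ (by fun_prop), lintegral_Ioi_rpow (by norm_num) hs,
            ← ENNReal.ofReal_mul (by positivity), ← mul_div_assoc, mul_neg, ← Real.rpow_add hs]
          norm_num
      _ ≤ 2 := le_rfl
  calc _ ≤ (2 : ℝ≥0∞) + 2 := add_le_add h1 h2
    _ = 4 := by norm_num

/-- Hilbert's inequality for the kernel `1 / max s t`. -/
theorem lintegral_lintegral_max_le {f : ℝ → ℝ} {S : Set ℝ} (hS : S ⊆ Ioi 0)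
    (hSm : MeasurableSet S) (hf : AEMeasurable f (volume.restrict S)) :
    ∫⁻ s in S, ∫⁻ t in S, ENNReal.ofReal (f s * f t / max s t) ≤
      4 * ∫⁻ s in S, ENNReal.ofReal (f s ^ 2) := by
  -- By 2 f(s) f(t) ≤ (s/t)^(1/2) f(s)² + (t/s)^(1/2) f(t)², the integrand is at most G s t + G t s.
  -- The two terms have equal integrals by Tonelli.
  set G : ℝ → ℝ → ℝ≥0∞ := fun s t =>
    ENNReal.ofReal (f s ^ 2 / 2) * ENNReal.ofReal ((s / t) ^ (1 / 2 : ℝ) / max s t) with hG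
  have hGm : AEMeasurable (Function.uncurry G) ((volume.restrict S).prod (volume.restrict S)) := by
    have h1 : AEMeasurable (fun p : ℝ × ℝ => f p.1)
      ((volume.restrict S).prod (volume.restrict S)) := hf.comp_fst
    refine AEMeasurable.mul ((h1.pow_const 2).div_const 2).ennreal_ofReal ?_
    exact Measurable.aemeasurable (by fun_prop)
  have hle : ∀ s ∈ S, ∀ t ∈ S, ENNReal.ofReal (f s * f t / max s t) ≤ G s t + G t s := by
    intro s hs t ht
    have hs0 : 0 < s := hS hs
    have ht0 : 0 < t := hS ht
    rw [hG]
    dsimp only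
    rw [← ENNReal.ofReal_mul (by positivity), ← ENNReal.ofReal_mul (by positivity),
      ← ENNReal.ofReal_add (by positivity) (by positivity), max_comm t s]
    refine ENNReal.ofReal_le_ofReal ?_
    have hm : 0 < max s t := lt_max_of_lt_left hs0
    rw [← mul_div_assoc, ← mul_div_assoc, ← add_div]
    refine (div_le_div_iff_of_pos_right hm).2 ?_
    set x := (s / t) ^ (1 / 4 : ℝ)
    set y := (t / s) ^ (1 / 4 : ℝ)
    have hx : (s / t) ^ (1 / 2 : ℝ) = x ^ 2 := by
      rw [← Real.rpow_natCast, ← Real.rpow_mul (by positivity)]; norm_num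
    have hy : (t / s) ^ (1 / 2 : ℝ) = y ^ 2 := by
      rw [← Real.rpow_natCast, ← Real.rpow_mul (by positivity)]; norm_num
    have hxy : x * y = 1 := by
      rw [← Real.mul_rpow (by positivity) (by positivity), div_mul_div_comm, mul_comm s t,
        div_self (by positivity), Real.one_rpow]
    rw [hx, hy]
    have : f s * f t = (f s * x) * (f t * y) := by
      rw [mul_mul_mul_comm, hxy, mul_one]
    rw [this]
    nlinarith [sq_nonneg (f s * x - f t * y)]
  have hswap : ∫⁻ s in S, ∫⁻ t in S, G t s = ∫⁻ s in S, ∫⁻ t in S, G s t :=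
    (lintegral_lintegral_swap hGm).symm
  have hI : ∫⁻ s in S, ∫⁻ t in S, G s t ≤ ∫⁻ s in S, ENNReal.ofReal (f s ^ 2 / 2) * 4 := by
    refine setLIntegral_mono_ae' hSm (Eventually.of_forall fun s hs => ?_)
    rw [hG]
    dsimp only
    rw [lintegral_const_mul _ (by fun_prop)]
    gcongr
    exact (lintegral_mono_set hS).trans (lintegral_max_kernel_le (hS hs))
  calc _ ≤ ∫⁻ s in S, ∫⁻ t in S, (G s t + G t s) :=
        setLIntegral_mono_ae' hSm (Eventually.of_forall fun s hs =>
          setLIntegral_mono_ae' hSm (Eventually.of_forall fun t ht => hle s hs t ht))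
    _ = ∫⁻ s in S, ((∫⁻ t in S, G s t) + ∫⁻ t in S, G t s) := by
        refine lintegral_congr fun s => lintegral_add_left ?_ _
        exact (Measurable.const_mul (by fun_prop) _)
    _ = (∫⁻ s in S, ∫⁻ t in S, G s t) + ∫⁻ s in S, ∫⁻ t in S, G t s :=
        lintegral_add_left' hGm.lintegral_prod_right' _
    _ ≤ (∫⁻ s in S, ENNReal.ofReal (f s ^ 2 / 2) * 4) +
        ∫⁻ s in S, ENNReal.ofReal (f s ^ 2 / 2) * 4 := by
        rw [hswap]; exact add_le_add hI hI
    _ = 4 * ∫⁻ s in S, ENNReal.ofReal (f s ^ 2) := by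
        rw [← two_mul, lintegral_mul_const' _ _ (by norm_num), ← mul_assoc, mul_comm _ (4 : ℝ≥0∞),
          ← lintegral_const_mul' _ _ (by norm_num)]
        congr 1
        refine lintegral_congr fun s => ?_
        rw [show (2 : ℝ≥0∞) = ENNReal.ofReal 2 by norm_num, ← ENNReal.ofReal_mul (by norm_num)]
        congr 1; ring

/-! ### The quadratic estimate -/

section Quadratic

variable {H : Type*} [NormedAddCommGroup H] [InnerProductSpace ℂ H] [CompleteSpace H]
  {V : Type*} [NormedAddCommGroup V] [InnerProductSpace ℂ V] [CompleteSpace V]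
  {T : V →L[ℂ] V} {ι : V →L[ℂ] H} {c : ℝ}

/-- Almost orthogonality. The vector `(solve T ι s).adjoint (T x)` equals ι w with w bounded in V
uniformly in s. When the other adjoint is moved across, `solve T ι t` acts on ι w, and
`norm_solve_embed_le` yields the factor 1/t. -/
theorem norm_inner_adjoint_solve_le (hT : IsCoerciveOp T c) {s t : ℝ} (hs : 0 < s) (ht : 0 < t)
    (x y : V) : ‖inner ℂ ((solve T ι t).adjoint (T y)) ((solve T ι s).adjoint (T x))‖ ≤
      ‖T‖ ^ 3 / c ^ 2 * (‖x‖ * ‖y‖ / t) := by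
  set w := (Ring.inverse (shiftedOp T ι s)).adjoint (T x) with hw
  have h1 : (solve T ι s).adjoint (T x) = ι w := by
    rw [solve, ContinuousLinearMap.adjoint_comp, ContinuousLinearMap.adjoint_adjoint]; rfl
  have hc := hT.pos
  have h2 : ‖w‖ ≤ ‖T‖ * ‖x‖ / c := by
    have h3 := ((hT.shifted ι hs.le).adjoint).norm_le w
    rw [hw, inverse_adjoint (hT.shifted ι hs.le),
      (hT.shifted ι hs.le).adjoint.apply_inverse] at h3
    rw [le_div_iff₀ hc, hw, inverse_adjoint (hT.shifted ι hs.le), mul_comm]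
    exact h3.trans (T.le_opNorm x)
  rw [h1, ContinuousLinearMap.adjoint_inner_left]
  calc _ ≤ ‖T y‖ * ‖solve T ι t (ι w)‖ := norm_inner_le_norm _ _
    _ ≤ (‖T‖ * ‖y‖) * (‖T‖ / c / t * (‖T‖ * ‖x‖ / c)) := by
        refine mul_le_mul (T.le_opNorm y) ?_ (norm_nonneg _) (by positivity)
        exact (norm_solve_embed_le hT ht w).trans (mul_le_mul_of_nonneg_left h2 (by positivity))
    _ = _ := by ring

/-- The inner product is symmetric up to conjugation, so the 1/t decay may be used for the larger of
the two parameters. -/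
theorem norm_inner_adjoint_solve_le_max (hT : IsCoerciveOp T c) {s t : ℝ} (hs : 0 < s) (ht : 0 < t)
    (x y : V) : ‖inner ℂ ((solve T ι t).adjoint (T y)) ((solve T ι s).adjoint (T x))‖ ≤
      ‖T‖ ^ 3 / c ^ 2 * (‖x‖ * ‖y‖ / max s t) := by
  rcases le_total s t with h | h
  · rw [max_eq_right h]; exact norm_inner_adjoint_solve_le hT hs ht x y
  · rw [max_eq_left h, norm_inner_symm, mul_comm ‖x‖]; exact norm_inner_adjoint_solve_le hT ht hs y x

theorem continuousOn_solve_apply (hT : IsCoerciveOp T c) (h : H) :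
    ContinuousOn (fun s => solve T ι s h) (Ici 0) :=
  (continuousOn_solve hT).clm_apply continuousOn_const

/-- A TT*-argument. For u_s = `solve T ι s h` and g_s = `(solve T ι s).adjoint (T u_s)`, coercivity
gives c ∫ ‖u‖² ≤ Re (h, ∫ g). Expanding ‖∫ g‖² as a double integral, almost orthogonality and
Hilbert's inequality bound it by a multiple of ∫ ‖u‖², one factor of which cancels. The cancellation
needs a finite integral, hence the bounded range of s. -/
theorem quadratic_estimate_Ioc (hT : IsCoerciveOp T c) {N : ℝ} (hN : 0 ≤ N) (h : H) :
    ∫ s in (0 : ℝ)..N, ‖solve T ι s h‖ ^ 2 ≤ 4 * (‖T‖ ^ 3 / c ^ 2) / c ^ 2 * ‖h‖ ^ 2 := by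
  have hc := hT.pos
  set K := ‖T‖ ^ 3 / c ^ 2 with hK
  have hK0 : 0 ≤ K := by positivity
  set u : ℝ → V := fun s => solve T ι s h with hu
  set g : ℝ → H := fun s => (solve T ι s).adjoint (T (u s)) with hg
  have hsub : Icc 0 N ⊆ Ici (0 : ℝ) := Icc_subset_Ici_self
  have huc : ContinuousOn u (Icc 0 N) := (continuousOn_solve_apply hT h).mono hsub
  have hgc : ContinuousOn g (Icc 0 N) := by
    have h1 : ContinuousOn (fun s => (solve T ι s).adjoint) (Icc 0 N) :=
      ContinuousLinearMap.adjoint.continuous.comp_continuousOn ((continuousOn_solve hT).mono hsub)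
    exact h1.clm_apply (T.continuous.comp_continuousOn huc)
  have hgi : IntegrableOn g (Ioc 0 N) := (hgc.integrableOn_Icc).mono_set Ioc_subset_Icc_self
  have hui : IntegrableOn (fun s => ‖u s‖ ^ 2) (Ioc 0 N) :=
    ((huc.norm.pow 2).integrableOn_Icc).mono_set Ioc_subset_Icc_self
  rw [intervalIntegral.integral_of_le hN]
  set I := ∫ s in Ioc 0 N, ‖u s‖ ^ 2 with hI
  have hI0 : 0 ≤ I := integral_nonneg fun s => by positivity
  set Sg := ∫ s in Ioc 0 N, g s with hSg
  have h1 : c * I ≤ ‖h‖ * ‖Sg‖ := by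
    have e1 : inner ℂ h Sg = ∫ s in Ioc 0 N, inner ℂ h (g s) := (integral_inner hgi h).symm
    have e2 : (inner ℂ h Sg).re = ∫ s in Ioc 0 N, (inner ℂ h (g s)).re := by
      rw [e1]; exact (integral_re (hgi.const_inner (𝕜 := ℂ) h)).symm
    have e3 : c * I ≤ (inner ℂ h Sg).re := by
      rw [e2, hI, ← integral_const_mul]
      refine setIntegral_mono_on (hui.const_mul c) (hgi.const_inner (𝕜 := ℂ) h).re measurableSet_Ioc ?_
      intro s _
      rw [hg]
      dsimp only
      rw [ContinuousLinearMap.adjoint_inner_right]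
      exact hT.le_re (u s)
    exact e3.trans ((Complex.re_le_norm _).trans (norm_inner_le_norm _ _))
  have h2 : ‖Sg‖ ^ 2 ≤ 4 * K * I := by
    have e1 : inner ℂ Sg Sg = ∫ s in Ioc 0 N, ∫ t in Ioc 0 N, inner ℂ (g t) (g s) := by
      rw [hSg, ← integral_inner hgi]
      refine integral_congr_ae (Eventually.of_forall fun s => ?_)
      dsimp only
      rw [← inner_conj_symm, ← integral_inner hgi, ← integral_conj]
      simp only [inner_conj_symm]
    have e2 : ENNReal.ofReal (‖Sg‖ ^ 2) ≤ ENNReal.ofReal (4 * K * I) := by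
      calc ENNReal.ofReal (‖Sg‖ ^ 2) = ‖inner ℂ Sg Sg‖ₑ := by
            rw [inner_self_eq_norm_sq_to_K, ← ofReal_norm, norm_pow]
            simp
        _ ≤ ∫⁻ s in Ioc 0 N, ∫⁻ t in Ioc 0 N, ‖inner ℂ (g t) (g s)‖ₑ := by
            rw [e1]
            exact (enorm_integral_le_lintegral_enorm _).trans
              (lintegral_mono fun s => enorm_integral_le_lintegral_enorm _)
        _ ≤ ∫⁻ s in Ioc 0 N, ∫⁻ t in Ioc 0 N,
            ENNReal.ofReal K * ENNReal.ofReal (‖u s‖ * ‖u t‖ / max s t) := by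
            refine setLIntegral_mono_ae' measurableSet_Ioc (Eventually.of_forall fun s hs =>
              setLIntegral_mono_ae' measurableSet_Ioc (Eventually.of_forall fun t ht => ?_))
            rw [← ENNReal.ofReal_mul hK0, ← ofReal_norm]
            exact ENNReal.ofReal_le_ofReal
              (norm_inner_adjoint_solve_le_max hT hs.1 ht.1 (u s) (u t))
        _ = ENNReal.ofReal K * ∫⁻ s in Ioc 0 N, ∫⁻ t in Ioc 0 N,
            ENNReal.ofReal (‖u s‖ * ‖u t‖ / max s t) := by
            rw [← lintegral_const_mul' _ _ ENNReal.ofReal_ne_top]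
            exact lintegral_congr fun s => lintegral_const_mul' _ _ ENNReal.ofReal_ne_top
        _ ≤ ENNReal.ofReal K * (4 * ∫⁻ s in Ioc 0 N, ENNReal.ofReal (‖u s‖ ^ 2)) := by
            gcongr
            refine lintegral_lintegral_max_le Ioc_subset_Ioi_self measurableSet_Ioc ?_
            exact ((huc.mono Ioc_subset_Icc_self).norm.aemeasurable measurableSet_Ioc)
        _ = ENNReal.ofReal (4 * K * I) := by
            rw [← ofReal_integral_eq_lintegral_ofReal hui
              (Eventually.of_forall fun s => by positivity),
              show (4 : ℝ≥0∞) = ENNReal.ofReal 4 by norm_num, ← ENNReal.ofReal_mul (by norm_num),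
              ← ENNReal.ofReal_mul hK0]
            congr 1; ring
    exact (ENNReal.ofReal_le_ofReal_iff (by positivity)).1 e2
  have h3 : (c * I) ^ 2 ≤ ‖h‖ ^ 2 * (4 * K * I) := by
    calc (c * I) ^ 2 ≤ (‖h‖ * ‖Sg‖) ^ 2 := pow_le_pow_left₀ (by positivity) h1 2
      _ = ‖h‖ ^ 2 * ‖Sg‖ ^ 2 := by ring
      _ ≤ _ := by gcongr
  rcases hI0.eq_or_lt with h0 | h0
  · rw [← h0]; positivity
  · rw [div_mul_eq_mul_div, le_div_iff₀ (by positivity)]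
    have : I * (I * c ^ 2) ≤ I * (4 * K * ‖h‖ ^ 2) := by nlinarith
    exact le_of_mul_le_mul_left this h0

/-- The quadratic estimate for the resolvents of a coercive form. -/
theorem quadratic_estimate (hT : IsCoerciveOp T c) (h : H) :
    IntegrableOn (fun s => ‖solve T ι s h‖ ^ 2) (Ioi 0) ∧
      ∫ s in Ioi 0, ‖solve T ι s h‖ ^ 2 ≤ 4 * (‖T‖ ^ 3 / c ^ 2) / c ^ 2 * ‖h‖ ^ 2 := by
  have hint : ∀ N : ℝ, IntegrableOn (fun s => ‖solve T ι s h‖ ^ 2) (Ioc 0 N) := fun N =>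
    ((((continuousOn_solve_apply hT h).mono Icc_subset_Ici_self).norm.pow 2).integrableOn_Icc).mono_set
      Ioc_subset_Icc_self
  have h1 : IntegrableOn (fun s => ‖solve T ι s h‖ ^ 2) (Ioi 0) := by
    refine integrableOn_Ioi_of_intervalIntegral_norm_bounded
      (4 * (‖T‖ ^ 3 / c ^ 2) / c ^ 2 * ‖h‖ ^ 2) 0 hint tendsto_id
      ((eventually_ge_atTop 0).mono fun N hN => ?_)
    simp only [norm_pow, norm_norm]
    exact quadratic_estimate_Ioc (ι := ι) hT hN h
  exact ⟨h1, le_of_tendsto (intervalIntegral_tendsto_integral_Ioi 0 h1 tendsto_id)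
    ((eventually_ge_atTop 0).mono fun N hN => quadratic_estimate_Ioc hT hN h)⟩

end Quadratic

/-! ### Fractional powers as integrals of resolvents -/

theorem integrableOn_weight {θ a δ : ℝ} (hθ : θ < 1) (ha : 0 ≤ a) (hθa : 1 < θ + a)
    (hδ : 0 < δ) : IntegrableOn (fun s : ℝ => s ^ (-θ) * (s + δ) ^ (-a)) (Ioi 0) := by
  have hm : Measurable fun s : ℝ => s ^ (-θ) * (s + δ) ^ (-a) := by fun_prop
  rw [← Ioc_union_Ioi_eq_Ioi zero_le_one]
  refine IntegrableOn.union ?_ ?_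
  · have h1 : IntegrableOn (fun s : ℝ => s ^ (-θ) * δ ^ (-a)) (Ioc 0 1) :=
      ((intervalIntegrable_iff_integrableOn_Ioc_of_le zero_le_one).1
        (intervalIntegral.intervalIntegrable_rpow' (by linarith))).mul_const _
    refine h1.mono' hm.aestronglyMeasurable ?_
    refine (ae_restrict_mem measurableSet_Ioc).mono fun s hs => ?_
    have hs0 : 0 < s := hs.1
    rw [Real.norm_of_nonneg (by positivity)]
    gcongr ?_ * ?_
    exact Real.rpow_le_rpow_of_nonpos hδ (by linarith) (by linarith)
  · have h1 : IntegrableOn (fun s : ℝ => s ^ (-θ - a)) (Ioi 1) :=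
      integrableOn_Ioi_rpow_of_lt (by linarith) zero_lt_one
    refine h1.mono' hm.aestronglyMeasurable ?_
    refine (ae_restrict_mem measurableSet_Ioi).mono fun s hs => ?_
    have hs0 : 0 < s := zero_lt_one.trans hs
    rw [Real.norm_of_nonneg (by positivity), sub_eq_add_neg, Real.rpow_add hs0]
    gcongr ?_ * ?_
    exact Real.rpow_le_rpow_of_nonpos hs0 (by linarith) (by linarith)

/-- A continuous function dominated by an integrable weight is integrable against a power. -/
theorem integrableOn_smul_of_norm_le {E : Type*} [NormedAddCommGroup E] [NormedSpace ℂ E]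
    {F : ℝ → E} {C θ a δ : ℝ} (hF : ContinuousOn F (Ioi 0)) (hθ : θ < 1) (ha : 0 ≤ a)
    (hθa : 1 < θ + a) (hδ : 0 < δ) (hb : ∀ s, 0 < s → ‖F s‖ ≤ C * (s + δ) ^ (-a)) :
    IntegrableOn (fun s : ℝ => ((s ^ (-θ) : ℝ) : ℂ) • F s) (Ioi 0) := by
  refine ((integrableOn_weight hθ ha hθa hδ).const_mul C).mono' ?_ ?_
  · refine ContinuousOn.aestronglyMeasurable ?_ measurableSet_Ioi
    refine ContinuousOn.smul ?_ hF
    exact Complex.continuous_ofReal.comp_continuousOn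
      (continuousOn_id.rpow_const fun s hs => Or.inl (ne_of_gt hs))
  · refine (ae_restrict_mem measurableSet_Ioi).mono fun s hs => ?_
    have hs0 : 0 < s := hs
    rw [norm_smul, Complex.norm_real, Real.norm_of_nonneg (by positivity), mul_left_comm]
    gcongr
    exact hb s hs

section Fractional

variable {H : Type*} [NormedAddCommGroup H] [InnerProductSpace ℂ H] [CompleteSpace H]
  {V : Type*} [NormedAddCommGroup V] [InnerProductSpace ℂ V] [CompleteSpace V]
  {T : V →L[ℂ] V} {ι : V →L[ℂ] H} {c : ℝ}

/-- The fractional power `A ^ (-θ)`, `0 < θ < 1`. -/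
noncomputable def fracInt (T : V →L[ℂ] V) (ι : V →L[ℂ] H) (θ : ℝ) : H →L[ℂ] H :=
  ((Real.sin (Real.pi * θ) / Real.pi : ℝ) : ℂ) •
    ∫ s in Ioi (0 : ℝ), ((s ^ (-θ) : ℝ) : ℂ) • resol T ι s

theorem integrableOn_resol (hT : IsCoerciveOp T c) {θ : ℝ} (h0 : 0 < θ) (h1 : θ < 1) :
    IntegrableOn (fun s : ℝ => ((s ^ (-θ) : ℝ) : ℂ) • resol T ι s) (Ioi 0) := by
  refine integrableOn_smul_of_norm_le (C := 1) (a := 1) (δ := gap ι c)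
    ((continuousOn_resol hT).mono Ioi_subset_Ici_self) h1 zero_le_one (by linarith) (gap_pos hT) ?_
  intro s hs
  rw [one_mul, Real.rpow_neg_one]
  exact norm_resol_le hT hs.le

theorem integrableOn_resol_apply (hT : IsCoerciveOp T c) {θ : ℝ} (h0 : 0 < θ) (h1 : θ < 1) (h : H) :
    IntegrableOn (fun s : ℝ => ((s ^ (-θ) : ℝ) : ℂ) • resol T ι s h) (Ioi 0) :=
  (integrableOn_resol hT h0 h1).apply_continuousLinearMap h

theorem sin_div_pi_pos {θ : ℝ} (h0 : 0 < θ) (h1 : θ < 1) : 0 < Real.sin (Real.pi * θ) / Real.pi := by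
  have := Real.pi_pos
  exact div_pos (Real.sin_pos_of_pos_of_lt_pi (by positivity) (by nlinarith)) this

theorem fracInt_apply (hT : IsCoerciveOp T c) {θ : ℝ} (h0 : 0 < θ) (h1 : θ < 1) (h : H) :
    fracInt T ι θ h = ((Real.sin (Real.pi * θ) / Real.pi : ℝ) : ℂ) •
      ∫ s in Ioi (0 : ℝ), ((s ^ (-θ) : ℝ) : ℂ) • resol T ι s h := by
  rw [fracInt, smul_apply, ContinuousLinearMap.integral_apply (integrableOn_resol hT h0 h1)]
  rfl

theorem inner_fracInt (hT : IsCoerciveOp T c) {θ : ℝ} (h0 : 0 < θ) (h1 : θ < 1) (g h : H) :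
    inner ℂ g (fracInt T ι θ h) = ((Real.sin (Real.pi * θ) / Real.pi : ℝ) : ℂ) *
      ∫ s in Ioi (0 : ℝ), ((s ^ (-θ) : ℝ) : ℂ) * inner ℂ g (resol T ι s h) := by
  rw [fracInt_apply hT h0 h1, inner_smul_right,
    ← integral_inner (integrableOn_resol_apply hT h0 h1 h)]
  simp only [inner_smul_right]

theorem fracInt_adjoint (hT : IsCoerciveOp T c) {θ : ℝ} (h0 : 0 < θ) (h1 : θ < 1) :
    (fracInt T ι θ).adjoint = fracInt T.adjoint ι θ := by
  refine ContinuousLinearMap.ext fun h => ext_inner_left ℂ fun g => ?_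
  rw [ContinuousLinearMap.adjoint_inner_right, ← inner_conj_symm, inner_fracInt hT h0 h1,
    inner_fracInt hT.adjoint h0 h1, map_mul, Complex.conj_ofReal, ← integral_conj]
  congr 1
  refine setIntegral_congr_fun measurableSet_Ioi fun s hs => ?_
  rw [map_mul, Complex.conj_ofReal, inner_conj_symm, ← resol_adjoint hT (le_of_lt hs),
    ContinuousLinearMap.adjoint_inner_right]

/-- By `energy_solve` the integrand of Re (h, A^(-θ) h) dominates a positive multiple of the squared
V-norm of (s + A)^(-1) h. If the integral vanishes, so does (s + A)^(-1) h for some s, and then h,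
as V is dense. Injectivity and dense range of A^(-θ) both follow. -/
theorem eq_zero_of_inner_fracInt (hT : IsCoerciveOp T c) (hι : DenseRange ι) {θ : ℝ} (h0 : 0 < θ)
    (h1 : θ < 1) {h : H} (hh : inner ℂ h (fracInt T ι θ h) = 0) : h = 0 := by
  rw [inner_fracInt hT h0 h1, mul_eq_zero] at hh
  have hc := hT.pos
  have hi := (integrableOn_resol_apply (ι := ι) hT h0 h1 h).const_inner (𝕜 := ℂ) h
  simp only [inner_smul_right] at hi
  have h2 : ∫ s in Ioi (0 : ℝ), (((s ^ (-θ) : ℝ) : ℂ) * inner ℂ h (resol T ι s h)).re = 0 := by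
    have h3 := integral_re hi
    rw [hh.resolve_left (by exact_mod_cast (sin_div_pi_pos h0 h1).ne')] at h3
    simpa using h3
  have hnn : ∀ s ∈ Ioi (0 : ℝ), s ^ (-θ) * (c * ‖solve T ι s h‖ ^ 2) ≤
      (((s ^ (-θ) : ℝ) : ℂ) * inner ℂ h (resol T ι s h)).re := by
    intro s hs
    have hs0 : 0 < s := hs
    rw [Complex.re_ofReal_mul]
    refine mul_le_mul_of_nonneg_left ?_ (by positivity)
    rw [re_inner_comm]
    have := energy_solve (ι := ι) hT hs0.le h
    have h5 : 0 ≤ s * ‖resol T ι s h‖ ^ 2 := by positivity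
    linarith
  have hae := (setIntegral_eq_zero_iff_of_nonneg_ae ((ae_restrict_mem measurableSet_Ioi).mono
    fun s hs => le_trans (by have : 0 < s := hs; positivity) (hnn s hs)) hi.re).1 h2
  have : ∃ s : ℝ, s ∈ Ioi (0 : ℝ) ∧
      (((s ^ (-θ) : ℝ) : ℂ) * inner ℂ h (resol T ι s h)).re = 0 := by
    have h4 := hae.and (ae_restrict_mem measurableSet_Ioi)
    have : (ae (volume.restrict (Ioi (0 : ℝ)))).NeBot := by
      rw [ae_neBot, Ne, Measure.restrict_eq_zero]; simp
    obtain ⟨s, hs, hs'⟩ := h4.exists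
    exact ⟨s, hs', hs⟩
  obtain ⟨s, hs, hs0⟩ := this
  have h5 := hnn s hs
  rw [hs0] at h5
  have hsp : 0 < s := hs
  have h6 : 0 < s ^ (-θ) := by positivity
  have h7 : ‖solve T ι s h‖ ^ 2 ≤ 0 := by
    by_contra h8
    push Not at h8
    have : 0 < s ^ (-θ) * (c * ‖solve T ι s h‖ ^ 2) := by positivity
    linarith
  exact eq_zero_of_solve_eq_zero hT hι hsp.le (by
    rw [← norm_eq_zero]; nlinarith [norm_nonneg (solve T ι s h)])

theorem fracInt_injective (hT : IsCoerciveOp T c) (hι : DenseRange ι) {θ : ℝ} (h0 : 0 < θ)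
    (h1 : θ < 1) : Function.Injective (fracInt T ι θ) := by
  rw [injective_iff_map_eq_zero]
  intro h hh
  exact eq_zero_of_inner_fracInt hT hι h0 h1 (by rw [hh, inner_zero_right])

theorem fracInt_denseRange (hT : IsCoerciveOp T c) (hι : DenseRange ι) {θ : ℝ} (h0 : 0 < θ)
    (h1 : θ < 1) : DenseRange (fracInt T ι θ) := by
  have h2 : (LinearMap.range (fracInt T ι θ : H →ₗ[ℂ] H)).topologicalClosure = ⊤ := by
    rw [Submodule.topologicalClosure_eq_top_iff, Submodule.eq_bot_iff]
    intro h hh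
    have := hh (fracInt T ι θ h) ⟨h, rfl⟩
    exact eq_zero_of_inner_fracInt hT hι h0 h1 (by rw [← inner_conj_symm, this, map_zero])
  intro x
  have h3 : x ∈ ((LinearMap.range (fracInt T ι θ : H →ₗ[ℂ] H)).topologicalClosure : Set H) := by
    rw [h2]; trivial
  rwa [Submodule.topologicalClosure_coe] at h3

set_option maxHeartbeats 1000000 in
/-- Integration by parts in the formula for the fractional power. -/
theorem integral_resol_sq (hT : IsCoerciveOp T c) {θ : ℝ} (h0 : 0 < θ) (h1 : θ < 1) :
    IntegrableOn (fun s : ℝ => ((s ^ (1 - θ) : ℝ) : ℂ) • (resol T ι s * resol T ι s)) (Ioi 0) ∧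
    ∫ s in Ioi (0 : ℝ), ((s ^ (1 - θ) : ℝ) : ℂ) • (resol T ι s * resol T ι s) =
      ((1 - θ : ℝ) : ℂ) • ∫ s in Ioi (0 : ℝ), ((s ^ (-θ) : ℝ) : ℂ) • resol T ι s := by
  have hδ := gap_pos (ι := ι) hT
  have hcont : ContinuousOn (resol T ι) (Ioi 0) := (continuousOn_resol hT).mono Ioi_subset_Ici_self
  have hi := integrableOn_resol (ι := ι) hT h0 h1
  have hi2 : IntegrableOn (fun s : ℝ => ((s ^ (1 - θ) : ℝ) : ℂ) • (resol T ι s * resol T ι s))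
      (Ioi 0) := by
    have h2 : IntegrableOn (fun s : ℝ => ((s ^ (-θ) : ℝ) : ℂ) •
        ((s : ℂ) • (resol T ι s * resol T ι s))) (Ioi 0) := by
      refine integrableOn_smul_of_norm_le (C := 1) (a := 1) (δ := gap ι c) ?_ h1 zero_le_one
        (by linarith) hδ ?_
      · exact Complex.continuous_ofReal.continuousOn.smul (hcont.mul hcont)
      · intro s hs
        have h3 := norm_resol_le (ι := ι) hT hs.le
        rw [one_mul, Real.rpow_neg_one, norm_smul, Complex.norm_real, Real.norm_of_nonneg hs.le]
        calc s * ‖resol T ι s * resol T ι s‖ ≤ s * ((s + gap ι c)⁻¹ * (s + gap ι c)⁻¹) := by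
              gcongr
              exact (norm_mul_le _ _).trans (mul_le_mul h3 h3 (norm_nonneg _) (by positivity))
          _ ≤ (s + gap ι c) * ((s + gap ι c)⁻¹ * (s + gap ι c)⁻¹) := by
              gcongr; linarith
          _ = (s + gap ι c)⁻¹ := by field_simp
    refine h2.congr_fun (fun s hs => ?_) measurableSet_Ioi
    have hs0 : 0 < s := hs
    dsimp only
    rw [smul_smul, ← Complex.ofReal_mul, ← Real.rpow_add_one hs0.ne', neg_add_eq_sub]
  refine ⟨hi2, ?_⟩
  -- The derivative of (s + A)^(-1) is -(s + A)^(-2). The boundary term s^(1-θ) (s + A)^(-1)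
  -- vanishes at 0 because θ < 1, and at ∞ because it is at most s^(-θ).
  have hd : ∀ s ∈ Ioi (0 : ℝ), HasDerivAt (fun s : ℝ => ((s ^ (1 - θ) : ℝ) : ℂ) • resol T ι s)
      (((1 - θ : ℝ) : ℂ) • (((s ^ (-θ) : ℝ) : ℂ) • resol T ι s) -
        ((s ^ (1 - θ) : ℝ) : ℂ) • (resol T ι s * resol T ι s)) s := by
    intro s hs
    have hs0 : 0 < s := hs
    have h2 := (Real.hasDerivAt_rpow_const (p := 1 - θ) (Or.inl hs0.ne')).ofReal_comp
    refine (h2.smul (hasDerivAt_resol (ι := ι) hT hs0)).congr_deriv ?_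
    rw [smul_neg, smul_smul, ← Complex.ofReal_mul, show 1 - θ - 1 = -θ by ring, neg_add_eq_sub]
  have hb : ∀ s : ℝ, 0 < s → ‖((s ^ (1 - θ) : ℝ) : ℂ) • resol T ι s‖ ≤
      s ^ (1 - θ) * (s + gap ι c)⁻¹ := by
    intro s hs
    rw [norm_smul, Complex.norm_real, Real.norm_of_nonneg (by positivity)]
    gcongr
    exact norm_resol_le hT hs.le
  have hz : ContinuousWithinAt (fun s : ℝ => ((s ^ (1 - θ) : ℝ) : ℂ) • resol T ι s) (Ici 0) 0 := by
    have h2 : Tendsto (fun s : ℝ => ((s ^ (1 - θ) : ℝ) : ℂ)) (𝓝[≥] 0)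
        (𝓝 (((0 : ℝ) ^ (1 - θ) : ℝ) : ℂ)) :=
      (Complex.continuous_ofReal.continuousAt.comp
        (Real.continuousAt_rpow_const 0 (1 - θ) (Or.inr (by linarith)))).tendsto.mono_left
          nhdsWithin_le_nhds
    exact h2.smul ((continuousOn_resol hT) 0 self_mem_Ici)
  have hinf : Tendsto (fun s : ℝ => ((s ^ (1 - θ) : ℝ) : ℂ) • resol T ι s) atTop (𝓝 0) := by
    refine squeeze_zero_norm' (a := fun s => s ^ (-θ)) ?_ (tendsto_rpow_neg_atTop h0)
    filter_upwards [eventually_gt_atTop 0] with s hs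
    refine (hb s hs).trans ?_
    rw [show -θ = (1 - θ) - 1 by ring, Real.rpow_sub_one hs.ne', div_eq_mul_inv]
    gcongr
    linarith
  have hi3 : IntegrableOn (fun s : ℝ => ((1 - θ : ℝ) : ℂ) • (((s ^ (-θ) : ℝ) : ℂ) • resol T ι s))
      (Ioi 0) := hi.smul ((1 - θ : ℝ) : ℂ)
  have := integral_Ioi_of_hasDerivAt_of_tendsto hz hd (hi3.sub hi2) hinf
  rw [integral_sub hi3 hi2, integral_smul, Real.zero_rpow (by linarith),
    Complex.ofReal_zero, zero_smul, sub_zero, sub_eq_zero] at this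
  exact this.symm

end Fractional

/-! ### The square root of the inverse, and the form domain -/

section Fractional

variable {H : Type*} [NormedAddCommGroup H] [InnerProductSpace ℂ H] [CompleteSpace H]
  {V : Type*} [NormedAddCommGroup V] [InnerProductSpace ℂ V] [CompleteSpace V]
  {T : V →L[ℂ] V} {ι : V →L[ℂ] H} {c : ℝ}

/-- For `θ > 1/2` the range of `A ^ (-θ)` is continuously embedded into the form domain. -/
theorem exists_fracInt_eq_of_half_lt (hT : IsCoerciveOp T c) (ι : V →L[ℂ] H) {θ : ℝ} (h0 : 1 / 2 < θ) (h1 : θ < 1) :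
    ∃ W : H →L[ℂ] V, ∀ h, ι (W h) = fracInt T ι θ h := by
  have hi : IntegrableOn (fun s : ℝ => ((s ^ (-θ) : ℝ) : ℂ) • solve T ι s) (Ioi 0) :=
    integrableOn_smul_of_norm_le (a := 1 / 2) (δ := gap ι c)
      ((continuousOn_solve hT).mono Ioi_subset_Ici_self) h1 (by norm_num) (by linarith)
      (gap_pos hT) fun s hs => norm_solve_le hT hs.le
  refine ⟨((Real.sin (Real.pi * θ) / Real.pi : ℝ) : ℂ) •
    ∫ s in Ioi (0 : ℝ), ((s ^ (-θ) : ℝ) : ℂ) • solve T ι s, fun h => ?_⟩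
  rw [fracInt_apply hT (by linarith) h1, smul_apply, map_smul,
    ContinuousLinearMap.integral_apply hi,
    ← ContinuousLinearMap.integral_comp_comm ι (hi.apply_continuousLinearMap h)]
  congr 1
  refine setIntegral_congr_fun measurableSet_Ioi fun s hs => ?_
  simp only [smul_apply, map_smul, resol_apply]

/-- The form a + t (·,·) belongs to t + A, so facts about A apply to t + A without a new proof. -/
theorem resol_shiftedOp (s t : ℝ) : resol (shiftedOp T ι t) ι s = resol T ι (s + t) := by
  rw [resol, resol, solve, solve]
  congr 3
  simp only [shiftedOp]
  push_cast
  module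

/-- `∫ s ^ (-1/2) (s + t + A)⁻¹ ds`. -/
noncomputable def halfInt (T : V →L[ℂ] V) (ι : V →L[ℂ] H) (t : ℝ) : H →L[ℂ] H :=
  ∫ s in Ioi (0 : ℝ), ((s ^ (-(1 / 2) : ℝ) : ℝ) : ℂ) • resol T ι (s + t)

/-- The relation s (s + A)^(-1) = 1 - A (s + A)^(-1), multiplied by A^(-1) so that only bounded
operators occur. -/
theorem resol_zero_mul (hT : IsCoerciveOp T c) {s : ℝ} (hs : 0 ≤ s) :
    (s : ℂ) • (resol T ι 0 * resol T ι s) = resol T ι 0 - resol T ι s := by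
  rw [resol_sub_resol hT le_rfl hs, (resol_comm hT hs le_rfl).eq, Complex.ofReal_zero, sub_zero]

/-- From R_s = A^(-1)(1 - s R_s) one gets s^(-θ) R_s² = A^(-1)(s^(-θ) R_s - s^(1-θ) R_s²).
Integration by parts replaces the last integral by 1 - θ times the preceding one, leaving the factor
θ. -/
theorem integral_smul_resol_sq (hT : IsCoerciveOp T c) {θ : ℝ} (h0 : 0 < θ) (h1 : θ < 1) :
    ∫ s in Ioi (0 : ℝ), ((s ^ (-θ) : ℝ) : ℂ) • (resol T ι s * resol T ι s) =
      (θ : ℂ) • (resol T ι 0 * ∫ s in Ioi (0 : ℝ), ((s ^ (-θ) : ℝ) : ℂ) • resol T ι s) := by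
  obtain ⟨hi2, h2⟩ := integral_resol_sq (ι := ι) hT h0 h1
  have hi := integrableOn_resol (ι := ι) hT h0 h1
  calc _ = ∫ s in Ioi (0 : ℝ), resol T ι 0 * (((s ^ (-θ) : ℝ) : ℂ) • resol T ι s -
        ((s ^ (1 - θ) : ℝ) : ℂ) • (resol T ι s * resol T ι s)) := by
        refine setIntegral_congr_fun measurableSet_Ioi fun s hs => ?_
        have hs0 : 0 < s := hs
        have e : s ^ (1 - θ) = s ^ (-θ) * s := by
          rw [← Real.rpow_add_one hs0.ne', neg_add_eq_sub]
        have e2 := resol_zero_mul (ι := ι) hT hs0.le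
        have e3 : resol T ι s = resol T ι 0 - (s : ℂ) • (resol T ι 0 * resol T ι s) := by
          rw [e2]; abel
        have e4 : resol T ι s * resol T ι s =
            resol T ι 0 * resol T ι s - (s : ℂ) • (resol T ι 0 * (resol T ι s * resol T ι s)) := by
          nth_rewrite 1 [e3]
          rw [sub_mul, smul_mul_assoc, mul_assoc]
        nth_rewrite 1 [e4]
        rw [e, mul_sub, mul_smul_comm, mul_smul_comm, smul_sub, Complex.ofReal_mul, smul_smul]
    _ = _ := by
        have hi3 : Integrable (fun s : ℝ => ((s ^ (-θ) : ℝ) : ℂ) • resol T ι s -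
          ((s ^ (1 - θ) : ℝ) : ℂ) • (resol T ι s * resol T ι s)) (volume.restrict (Ioi 0)) :=
          hi.sub hi2
        rw [integral_const_mul_of_integrable hi3, integral_sub hi hi2, h2, mul_sub,
          mul_smul_comm, Complex.ofReal_sub, Complex.ofReal_one, sub_smul, one_smul,
          sub_sub_cancel]

theorem IsCoerciveOp.gap_shifted (hT : IsCoerciveOp T c) {t : ℝ} (ht : 0 ≤ t) {s : ℝ} (hs : 0 < s) :
    ‖resol T ι (s + t)‖ ≤ 1 * (s + gap ι c) ^ (-1 : ℝ) := by
  rw [one_mul, Real.rpow_neg_one]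
  have := gap_pos (ι := ι) hT
  refine (norm_resol_le hT (by positivity)).trans (inv_anti₀ (by positivity) (by linarith))

theorem continuousOn_resol_add (hT : IsCoerciveOp T c) {t : ℝ} (ht : 0 ≤ t) :
    ContinuousOn (fun s => resol T ι (s + t)) (Ioi 0) :=
  (continuousOn_resol hT).comp (by fun_prop) fun s hs => by
    have : 0 < s := hs
    rw [mem_Ici]; positivity

theorem integrableOn_halfInt (hT : IsCoerciveOp T c) {t : ℝ} (ht : 0 ≤ t) :
    IntegrableOn (fun s : ℝ => ((s ^ (-(1 / 2) : ℝ) : ℝ) : ℂ) • resol T ι (s + t)) (Ioi 0) :=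
  integrableOn_smul_of_norm_le (continuousOn_resol_add hT ht) (by norm_num) zero_le_one
    (by norm_num) (gap_pos hT) fun s hs => hT.gap_shifted ht hs

theorem commute_halfInt (hT : IsCoerciveOp T c) {s t : ℝ} (hs : 0 ≤ s) (ht : 0 ≤ t) :
    Commute (resol T ι s) (halfInt T ι t) := by
  have hi : Integrable (fun s : ℝ => ((s ^ (-(1 / 2) : ℝ) : ℝ) : ℂ) • resol T ι (s + t))
    (volume.restrict (Ioi 0)) := integrableOn_halfInt hT ht
  rw [Commute, SemiconjBy, halfInt, ← integral_const_mul_of_integrable hi,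
    ← integral_mul_const_of_integrable hi]
  refine setIntegral_congr_fun measurableSet_Ioi fun τ hτ => ?_
  have : 0 < τ := hτ
  rw [mul_smul_comm, smul_mul_assoc, (resol_comm hT hs (by positivity)).eq]

theorem continuousOn_halfInt (hT : IsCoerciveOp T c) : ContinuousOn (halfInt T ι) (Ici 0) := by
  refine continuousOn_of_dominated
    (bound := fun s => s ^ (-(1 / 2) : ℝ) * (s + gap ι c) ^ (-1 : ℝ)) ?_ ?_ ?_ ?_
  · exact fun t ht => (integrableOn_halfInt hT ht).aestronglyMeasurable
  · intro t ht
    refine (ae_restrict_mem measurableSet_Ioi).mono fun s hs => ?_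
    have hs0 : 0 < s := hs
    rw [norm_smul, Complex.norm_real, Real.norm_of_nonneg (by positivity)]
    gcongr
    simpa using hT.gap_shifted (ι := ι) ht hs
  · exact integrableOn_weight (by norm_num) zero_le_one (by norm_num) (gap_pos hT)
  · refine (ae_restrict_mem measurableSet_Ioi).mono fun s hs => ?_
    have hs0 : 0 < s := hs
    have h1 : ContinuousOn (fun t => resol T ι (s + t)) (Ici 0) :=
      (continuousOn_resol hT).comp (by fun_prop) fun t ht => by
        have : 0 ≤ t := ht
        rw [mem_Ici]; positivity
    exact h1.const_smul ((s ^ (-(1 / 2) : ℝ) : ℝ) : ℂ)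

/-- Differentiation under the integral produces ∫ s^(-1/2) (s + t + A)^(-2) ds, which
`integral_smul_resol_sq` evaluates for the shifted form with θ = 1/2. -/
theorem hasDerivAt_halfInt (hT : IsCoerciveOp T c) {t : ℝ} (ht : 0 < t) :
    HasDerivAt (halfInt T ι) (-((1 / 2 : ℂ) • (resol T ι t * halfInt T ι t))) t := by
  have hδ := gap_pos (ι := ι) hT
  have key := hasDerivAt_integral_of_dominated_loc_of_deriv_le
    (μ := volume.restrict (Ioi (0 : ℝ))) (x₀ := t) (s := Ioi 0)
    (F := fun t s => ((s ^ (-(1 / 2) : ℝ) : ℝ) : ℂ) • resol T ι (s + t))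
    (F' := fun t s => ((s ^ (-(1 / 2) : ℝ) : ℝ) : ℂ) • -(resol T ι (s + t) * resol T ι (s + t)))
    (bound := fun s => (gap ι c)⁻¹ * (s ^ (-(1 / 2) : ℝ) * (s + gap ι c) ^ (-1 : ℝ)))
    (Ioi_mem_nhds ht)
    ((eventually_gt_nhds ht).mono fun t ht => (integrableOn_halfInt hT (le_of_lt ht)).aestronglyMeasurable)
    (integrableOn_halfInt hT ht.le) ?_ ?_ ?_ ?_
  · refine key.2.congr_deriv ?_
    simp only [smul_neg]
    rw [integral_neg]
    have := integral_smul_resol_sq (ι := ι) (hT.shifted ι ht.le) (θ := 1 / 2) (by norm_num) (by norm_num)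
    simp only [resol_shiftedOp, zero_add] at this
    rw [this, halfInt]
    norm_num
  · have hc := continuousOn_resol_add (ι := ι) hT ht.le
    refine ContinuousOn.aestronglyMeasurable ?_ measurableSet_Ioi
    have h1 : ContinuousOn (fun s : ℝ => ((s ^ (-(1 / 2) : ℝ) : ℝ) : ℂ)) (Ioi 0) := ?_
    · exact h1.smul (hc.mul hc).neg
    exact Complex.continuous_ofReal.comp_continuousOn
      (continuousOn_id.rpow_const fun s hs => Or.inl (ne_of_gt hs))
  · refine (ae_restrict_mem measurableSet_Ioi).mono fun s hs τ hτ => ?_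
    have hs0 : 0 < s := hs
    have hτ0 : 0 < τ := hτ
    rw [norm_smul, Complex.norm_real, Real.norm_of_nonneg (by positivity), norm_neg, mul_left_comm]
    gcongr
    have h1 := hT.gap_shifted (ι := ι) hτ0.le hs
    rw [one_mul] at h1
    have h2 : ‖resol T ι (s + τ)‖ ≤ (gap ι c)⁻¹ :=
      (norm_resol_le hT (by positivity)).trans (inv_anti₀ hδ (by linarith))
    exact (norm_mul_le _ _).trans (mul_le_mul h2 h1 (norm_nonneg _) (by positivity))
  · exact (integrableOn_weight (by norm_num) zero_le_one (by norm_num) hδ).const_mul _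
  · refine (ae_restrict_mem measurableSet_Ioi).mono fun s hs τ hτ => ?_
    have hs0 : 0 < s := hs
    have hτ0 : 0 < τ := hτ
    have h1 : HasDerivAt (fun τ => resol T ι (s + τ)) (-(resol T ι (s + τ) * resol T ι (s + τ))) τ := by
      have := (hasDerivAt_resol (ι := ι) hT (show 0 < s + τ by positivity)).comp_const_add s τ
      exact this
    exact h1.const_smul ((s ^ (-(1 / 2) : ℝ) : ℝ) : ℂ)

theorem integral_half_kernel {t : ℝ} (ht : 0 < t) :
    IntegrableOn (fun s : ℝ => s ^ (-(1 / 2) : ℝ) * (s + t)⁻¹) (Ioi 0) ∧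
    ∫ s in Ioi (0 : ℝ), s ^ (-(1 / 2) : ℝ) * (s + t)⁻¹ = Real.pi / √t := by
  have hi : IntegrableOn (fun s : ℝ => s ^ (-(1 / 2) : ℝ) * (s + t)⁻¹) (Ioi 0) := by
    have := integrableOn_weight (θ := 1 / 2) (a := 1) (by norm_num) zero_le_one (by norm_num) ht
    simpa only [Real.rpow_neg_one] using this
  refine ⟨hi, ?_⟩
  have hst : 0 < √t := Real.sqrt_pos.2 ht
  have h1 := integral_Ioi_of_hasDerivAt_of_tendsto (a := 0) (m := 2 / √t * (Real.pi / 2))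
    (f := fun s => 2 / √t * Real.arctan (√s / √t))
    (f' := fun s : ℝ => s ^ (-(1 / 2) : ℝ) * (s + t)⁻¹) ?_ ?_ hi ?_
  · rw [h1]
    simp
  · exact Continuous.continuousWithinAt (by fun_prop)
  · intro s hs
    have hs0 : 0 < s := hs
    refine ((((Real.hasDerivAt_sqrt hs0.ne').div_const (√t)).arctan).const_mul (2 / √t)).congr_deriv ?_
    have e1 : √s ^ 2 = s := Real.sq_sqrt hs0.le
    have e2 : √t ^ 2 = t := Real.sq_sqrt ht.le
    rw [Real.rpow_neg hs0.le, ← Real.sqrt_eq_rpow, div_pow, e1, e2]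
    have : 0 < √s := Real.sqrt_pos.2 hs0
    field_simp
    rw [e2]
    ring
  · refine Tendsto.const_mul _ ?_
    refine (Real.tendsto_arctan_atTop.mono_right nhdsWithin_le_nhds).comp ?_
    exact Real.tendsto_sqrt_atTop.atTop_div_const hst

theorem norm_smul_resol_add_le (hT : IsCoerciveOp T c) {s t : ℝ} (hs : 0 < s) (ht : 0 < t) :
    ‖resol T ι (s + t)‖ ≤ (s + t)⁻¹ :=
  (norm_resol_le hT (by positivity)).trans
    (inv_anti₀ (by positivity) (by linarith [gap_pos (ι := ι) hT]))

theorem norm_halfInt_le (hT : IsCoerciveOp T c) {t : ℝ} (ht : 0 < t) :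
    ‖halfInt T ι t‖ ≤ Real.pi / √t := by
  obtain ⟨hi, h1⟩ := integral_half_kernel ht
  rw [← h1]
  refine norm_integral_le_of_norm_le hi ((ae_restrict_mem measurableSet_Ioi).mono fun s hs => ?_)
  have hs0 : 0 < s := hs
  rw [norm_smul, Complex.norm_real, Real.norm_of_nonneg (by positivity)]
  gcongr
  exact norm_smul_resol_add_le hT hs ht

/-- Leading asymptotics as t → ∞. The factor A^(-1) provides decay in operator norm: A^(-1)(s + t +
A)^(-1) differs from (s + t)^(-1) A^(-1) by (s + t)^(-1)(s + t + A)^(-1), whose norm carries an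
additional 1/t. -/
theorem norm_resol_mul_halfInt_sub_le (hT : IsCoerciveOp T c) {t : ℝ} (ht : 0 < t) :
    ‖resol T ι 0 * halfInt T ι t - ((Real.pi / √t : ℝ) : ℂ) • resol T ι 0‖ ≤
      Real.pi / √t * t⁻¹ := by
  obtain ⟨hi, h1⟩ := integral_half_kernel ht
  have hQ : Integrable (fun s : ℝ => ((s ^ (-(1 / 2) : ℝ) : ℝ) : ℂ) • resol T ι (s + t))
    (volume.restrict (Ioi 0)) := integrableOn_halfInt hT ht.le
  have e1 : resol T ι 0 * halfInt T ι t - ((Real.pi / √t : ℝ) : ℂ) • resol T ι 0 =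
      ∫ s in Ioi (0 : ℝ), (resol T ι 0 * (((s ^ (-(1 / 2) : ℝ) : ℝ) : ℂ) • resol T ι (s + t)) -
        ((s ^ (-(1 / 2) : ℝ) * (s + t)⁻¹ : ℝ) : ℂ) • resol T ι 0) := by
    have hi1 : Integrable (fun s : ℝ => resol T ι 0 *
        (((s ^ (-(1 / 2) : ℝ) : ℝ) : ℂ) • resol T ι (s + t))) (volume.restrict (Ioi 0)) :=
      hQ.const_mul _
    have hi2 : Integrable (fun s : ℝ => ((s ^ (-(1 / 2) : ℝ) * (s + t)⁻¹ : ℝ) : ℂ) • resol T ι 0)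
        (volume.restrict (Ioi 0)) := Integrable.smul_const hi.ofReal _
    rw [integral_sub hi1 hi2,
      integral_const_mul_of_integrable hQ, integral_smul_const, integral_complex_ofReal, h1, halfInt]
  rw [e1, ← h1, ← integral_mul_const]
  refine norm_integral_le_of_norm_le (hi.mul_const _)
    ((ae_restrict_mem measurableSet_Ioi).mono fun s hs => ?_)
  have hs0 : 0 < s := hs
  have hst : 0 < s + t := by positivity
  have e2 : resol T ι 0 * (((s ^ (-(1 / 2) : ℝ) : ℝ) : ℂ) • resol T ι (s + t)) -
      ((s ^ (-(1 / 2) : ℝ) * (s + t)⁻¹ : ℝ) : ℂ) • resol T ι 0 =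
      -(((s ^ (-(1 / 2) : ℝ) * (s + t)⁻¹ : ℝ) : ℂ) • resol T ι (s + t)) := by
    have h2 := resol_zero_mul (ι := ι) hT hst.le
    have h3 : resol T ι 0 * resol T ι (s + t) =
        (((s + t)⁻¹ : ℝ) : ℂ) • (resol T ι 0 - resol T ι (s + t)) := by
      rw [← h2, smul_smul, ← Complex.ofReal_mul, inv_mul_cancel₀ hst.ne', Complex.ofReal_one,
        one_smul]
    rw [mul_smul_comm, h3, Complex.ofReal_mul]
    module
  rw [e2, norm_neg, norm_smul, Complex.norm_real, Real.norm_of_nonneg (by positivity)]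
  gcongr
  exact (norm_smul_resol_add_le hT hs ht).trans (inv_anti₀ ht (by linarith))

/-- Formally Q(t) = `halfInt T ι t` is π (t + A)^(-1/2), so A^(-1)(t + A) Q(t)² ought not to depend
on t. The two terms of the derivative cancel because (t A^(-1) + 1)(t + A)^(-1) = A^(-1). -/
theorem hasDerivAt_halfInt_energy (hT : IsCoerciveOp T c) {t : ℝ} (ht : 0 < t) :
    HasDerivAt (fun t : ℝ => ((t : ℂ) • resol T ι 0 + 1) * (halfInt T ι t * halfInt T ι t)) 0 t := by
  have hQ := hasDerivAt_halfInt (ι := ι) hT ht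
  have h1 : HasDerivAt (fun t : ℝ => (t : ℂ) • resol T ι 0 + 1) (resol T ι 0) t := by
    have := ((Complex.ofRealCLM.hasDerivAt (x := t)).smul_const (resol T ι 0)).add_const 1
    simpa using this
  refine (h1.mul (hQ.mul hQ)).congr_deriv ?_
  have hc := (commute_halfInt (ι := ι) hT ht.le ht.le).eq
  have h2 := resol_zero_mul (ι := ι) hT ht.le
  set R := resol T ι t
  set Q := halfInt T ι t
  have h3 : ((t : ℂ) • resol T ι 0 + 1) * R = resol T ι 0 := by
    rw [add_mul, one_mul, smul_mul_assoc, h2, sub_add_cancel]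
  have h4 : -((1 / 2 : ℂ) • (R * Q)) * Q + Q * -((1 / 2 : ℂ) • (R * Q)) = -(R * (Q * Q)) := by
    rw [mul_neg, neg_mul, smul_mul_assoc, mul_smul_comm, ← mul_assoc Q R Q, ← hc, mul_assoc]
    module
  rw [h4, mul_neg, ← mul_assoc _ R, h3]
  exact add_neg_cancel _

/-- The conserved quantity is identified by its limit at t → ∞. Letting t → 0 afterwards gives Q(0)²
= π² A^(-1) without any double integral of resolvents. -/
theorem halfInt_energy_eq (hT : IsCoerciveOp T c) {t : ℝ} (ht : 0 < t) :
    ((t : ℂ) • resol T ι 0 + 1) * (halfInt T ι t * halfInt T ι t) =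
      ((Real.pi ^ 2 : ℝ) : ℂ) • resol T ι 0 := by
  set E : ℝ → H →L[ℂ] H :=
    fun t => ((t : ℂ) • resol T ι 0 + 1) * (halfInt T ι t * halfInt T ι t) with hE
  have hd : ∀ x, 0 < x → HasDerivAt E 0 x := fun x hx => hasDerivAt_halfInt_energy hT hx
  have hconst : ∀ τ, 0 < τ → E τ = E t := fun τ hτ =>
    isOpen_Ioi.is_const_of_deriv_eq_zero (f := E) (s := Ioi (0 : ℝ)) isPreconnected_Ioi
      (fun x hx => (hd x hx).differentiableAt.differentiableWithinAt)
      (fun x hx => (hd x hx).deriv) hτ ht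
  have hb : ∀ τ, 0 < τ → ‖E t - ((Real.pi ^ 2 : ℝ) : ℂ) • resol T ι 0‖ ≤ 3 * Real.pi ^ 2 * τ⁻¹ := by
    intro τ hτ
    rw [← hconst τ hτ]
    have hQ := norm_halfInt_le (ι := ι) hT hτ
    have hD := norm_resol_mul_halfInt_sub_le (ι := ι) hT hτ
    set Q := halfInt T ι τ
    set D := resol T ι 0 * Q - ((Real.pi / √τ : ℝ) : ℂ) • resol T ι 0 with hDdef
    have hs : 0 < √τ := Real.sqrt_pos.2 hτ
    have hsq : √τ * √τ = τ := Real.mul_self_sqrt hτ.le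
    have hpi := Real.pi_pos
    have e0 : resol T ι 0 * Q = D + ((Real.pi / √τ : ℝ) : ℂ) • resol T ι 0 := by
      rw [hDdef]; abel
    -- With A^(-1) Q = D + (π/√τ) A^(-1) substituted twice, the main term is π² A^(-1), and each of
    -- the three remaining terms is at most π²/τ.
    have e1 : E τ - ((Real.pi ^ 2 : ℝ) : ℂ) • resol T ι 0 =
        (τ : ℂ) • (D * Q) + ((√τ * Real.pi : ℝ) : ℂ) • D + Q * Q := by
      have e2 : E τ = (τ : ℂ) • ((resol T ι 0 * Q) * Q) + Q * Q := by
        rw [hE]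
        dsimp only
        rw [add_mul, one_mul, smul_mul_assoc, mul_assoc]
      rw [e2, e0, add_mul, smul_mul_assoc, e0]
      have e3 : (τ : ℂ) * ((Real.pi / √τ : ℝ) : ℂ) = ((√τ * Real.pi : ℝ) : ℂ) := by
        rw [← Complex.ofReal_mul]
        congr 1
        nth_rewrite 1 [← hsq]
        field_simp
      have e4 : ((√τ * Real.pi : ℝ) : ℂ) * ((Real.pi / √τ : ℝ) : ℂ) = ((Real.pi ^ 2 : ℝ) : ℂ) := by
        rw [← Complex.ofReal_mul]
        congr 1
        field_simp
      rw [smul_add, smul_smul, e3, smul_add, smul_smul, e4]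
      abel
    rw [e1]
    have hQ0 := norm_nonneg Q
    have hD0 := norm_nonneg D
    calc _ ≤ τ * (Real.pi / √τ * τ⁻¹ * (Real.pi / √τ)) + √τ * Real.pi * (Real.pi / √τ * τ⁻¹) +
          Real.pi / √τ * (Real.pi / √τ) := by
          refine (norm_add₃_le).trans ?_
          rw [norm_smul, norm_smul, Complex.norm_real, Complex.norm_real,
            Real.norm_of_nonneg hτ.le, Real.norm_of_nonneg (by positivity)]
          gcongr
          · exact (norm_mul_le _ _).trans (mul_le_mul hD hQ hQ0 (by positivity))
          · exact (norm_mul_le _ _).trans (mul_le_mul hQ hQ hQ0 (by positivity))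
      _ = 3 * Real.pi ^ 2 * τ⁻¹ := by
          have e5 : √τ ^ 2 = τ := Real.sq_sqrt hτ.le
          field_simp
          rw [e5]
          ring
  have hlim : Tendsto (fun τ : ℝ => 3 * Real.pi ^ 2 * τ⁻¹) atTop (𝓝 0) := by
    have := (tendsto_inv_atTop_zero (𝕜 := ℝ)).const_mul (3 * Real.pi ^ 2)
    rwa [mul_zero] at this
  have := ge_of_tendsto hlim ((eventually_gt_atTop 0).mono hb)
  exact sub_eq_zero.1 (norm_le_zero_iff.1 this)

theorem halfInt_zero_sq (hT : IsCoerciveOp T c) :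
    halfInt T ι 0 * halfInt T ι 0 = ((Real.pi ^ 2 : ℝ) : ℂ) • resol T ι 0 := by
  have hQ := (continuousOn_halfInt (ι := ι) hT) 0 self_mem_Ici
  have h1 : Tendsto (fun t : ℝ => ((t : ℂ) • resol T ι 0 + 1) * (halfInt T ι t * halfInt T ι t))
      (𝓝[>] 0) (𝓝 ((((0 : ℝ) : ℂ) • resol T ι 0 + 1) * (halfInt T ι 0 * halfInt T ι 0))) := by
    have h2 : Tendsto (halfInt T ι) (𝓝[>] 0) (𝓝 (halfInt T ι 0)) :=
      hQ.tendsto.mono_left (nhdsWithin_mono _ Ioi_subset_Ici_self)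
    have h3 : Tendsto (fun t : ℝ => (t : ℂ) • resol T ι 0 + 1) (𝓝[>] 0)
        (𝓝 (((0 : ℝ) : ℂ) • resol T ι 0 + 1)) :=
      (Continuous.tendsto (by fun_prop) 0).mono_left nhdsWithin_le_nhds
    exact h3.mul (h2.mul h2)
  have h4 := tendsto_nhds_unique h1 (tendsto_const_nhds.congr' (by
    filter_upwards [self_mem_nhdsWithin] with t ht
    exact (halfInt_energy_eq hT ht).symm))
  simpa using h4

/-- `A ^ (-1/2)` is a square root of `A ^ (-1)`. -/
theorem fracInt_half_sq (hT : IsCoerciveOp T c) :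
    fracInt T ι (1 / 2) * fracInt T ι (1 / 2) = resol T ι 0 := by
  have e : fracInt T ι (1 / 2) = ((Real.pi⁻¹ : ℝ) : ℂ) • halfInt T ι 0 := by
    rw [fracInt, halfInt, mul_one_div, Real.sin_pi_div_two, one_div]
    simp only [add_zero]
  rw [e, smul_mul_smul_comm, halfInt_zero_sq hT, smul_smul, ← Complex.ofReal_mul,
    ← Complex.ofReal_mul]
  have : Real.pi⁻¹ * Real.pi⁻¹ * Real.pi ^ 2 = 1 := by
    have := Real.pi_ne_zero
    field_simp
  rw [this, Complex.ofReal_one, one_smul]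

/-- If the form domain is contained in `D(A ^ (1/2))`, then `D((A*) ^ (1/2))` is contained in the
form domain. -/
theorem exists_fracInt_half_adjoint (hT : IsCoerciveOp T c) (hι : DenseRange ι)
    {J : V →L[ℂ] H} (hJ : ∀ v, fracInt T ι (1 / 2) (J v) = ι v) :
    ∃ W : H →L[ℂ] V, ∀ z, ι (W z) = fracInt T.adjoint ι (1 / 2) z := by
  -- Here J is A^(1/2) on V, so J T⁻¹ ι† = A^(1/2) A^(-1) = A^(-1/2). Taking adjoints displays
  -- (A*)^(-1/2) as ι after a bounded map into V.
  refine ⟨(Ring.inverse T).adjoint ∘L J.adjoint, fun z => ext_inner_right ℂ fun h => ?_⟩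
  have hinj := fracInt_injective (ι := ι) hT hι (θ := 1 / 2) (by norm_num) (by norm_num)
  have h1 : resol T ι 0 h = ι (Ring.inverse T (ι.adjoint h)) := by
    simp [resol, solve, shiftedOp]
  have h2 : J (Ring.inverse T (ι.adjoint h)) = fracInt T ι (1 / 2) h := by
    apply hinj
    rw [hJ, ← h1, ← fracInt_half_sq hT]
    rfl
  rw [← ContinuousLinearMap.adjoint_inner_right, ContinuousLinearMap.comp_apply,
    ContinuousLinearMap.adjoint_inner_left, ContinuousLinearMap.adjoint_inner_left, h2,
    ← fracInt_adjoint hT (by norm_num) (by norm_num), ContinuousLinearMap.adjoint_inner_left]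

end Fractional

/-! ### Real interpolation: the weighted integrals -/

section Interpolation

variable {X : Type*} [MeasurableSpace X] {μ : Measure X}

theorem lintegral_ofReal_mul_indicator_le {a : X → ℝ} (ha : Measurable a) [SFinite μ] {S : Set (ℝ × X)}
    (hS : MeasurableSet S) {e ρ Q K : ℝ} (hK : 0 ≤ K)
    (h : ∀ x, ENNReal.ofReal (a x ^ ρ) * ∫⁻ s in Ioi (0 : ℝ),
      {s | (s, x) ∈ S}.indicator (fun s => ENNReal.ofReal (s ^ e)) s ≤
        ENNReal.ofReal K * ENNReal.ofReal (a x ^ Q)) :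
    ∫⁻ s in Ioi (0 : ℝ), ENNReal.ofReal (s ^ e) *
      ∫⁻ x, {x | (s, x) ∈ S}.indicator (fun x => ENNReal.ofReal (a x ^ ρ)) x ∂μ ≤
        ENNReal.ofReal K * ∫⁻ x, ENNReal.ofReal (a x ^ Q) ∂μ := by
  have hm1 : Measurable fun p : ℝ × X => S.indicator
      (fun p => ENNReal.ofReal (p.1 ^ e) * ENNReal.ofReal (a p.2 ^ ρ)) p :=
    Measurable.indicator (by fun_prop) hS
  calc _ = ∫⁻ s in Ioi (0 : ℝ), ∫⁻ x, S.indicator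
        (fun p => ENNReal.ofReal (p.1 ^ e) * ENNReal.ofReal (a p.2 ^ ρ)) (s, x) ∂μ := by
        refine lintegral_congr fun s => ?_
        rw [← lintegral_const_mul' _ _ ENNReal.ofReal_ne_top]
        refine lintegral_congr fun x => ?_
        by_cases hx : (s, x) ∈ S <;> simp [indicator, hx]
    _ = ∫⁻ x, (∫⁻ s in Ioi (0 : ℝ), S.indicator
        (fun p => ENNReal.ofReal (p.1 ^ e) * ENNReal.ofReal (a p.2 ^ ρ)) (s, x)) ∂μ :=
        lintegral_lintegral_swap hm1.aemeasurable
    _ ≤ ∫⁻ x, ENNReal.ofReal K * ENNReal.ofReal (a x ^ Q) ∂μ := by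
        refine lintegral_mono fun x => le_trans (le_of_eq ?_) (h x)
        rw [← lintegral_const_mul' _ _ ENNReal.ofReal_ne_top]
        refine lintegral_congr fun s => ?_
        by_cases hx : (s, x) ∈ S <;> simp [indicator, hx, mul_comm]
    _ = _ := lintegral_const_mul' _ _ ENNReal.ofReal_ne_top

/-- Of the power Y^(2/ρ) all but one factor Y is replaced by the crude bound, which is possible
because ρ ≤ 2. What remains is linear in Y, so that Tonelli's theorem applies to it. -/
theorem weighted_rpow_le {Y M : ℝ≥0∞} {s w d ρ e : ℝ} (hs : 0 < s) (hρ : 0 < ρ) (hρ2 : ρ ≤ 2)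
    (hY : Y ≤ ENNReal.ofReal (s ^ d) * M) (he : w + d * (2 / ρ - 1) = e) :
    ENNReal.ofReal (s ^ w) * Y ^ (2 / ρ) ≤ M ^ (2 / ρ - 1) * (ENNReal.ofReal (s ^ e) * Y) := by
  have h1 : 0 ≤ 2 / ρ - 1 := by rw [sub_nonneg, le_div_iff₀ hρ]; linarith
  have h2 : Y ^ (2 / ρ) = Y ^ (2 / ρ - 1) * Y := by
    nth_rewrite 3 [← ENNReal.rpow_one Y]
    rw [← ENNReal.rpow_add_of_nonneg _ _ h1 zero_le_one, sub_add_cancel]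
  calc _ ≤ ENNReal.ofReal (s ^ w) * ((ENNReal.ofReal (s ^ d) * M) ^ (2 / ρ - 1) * Y) := by
        rw [h2]; gcongr
    _ = _ := by
        rw [ENNReal.mul_rpow_of_nonneg _ _ h1, ENNReal.ofReal_rpow_of_pos (by positivity),
          ← Real.rpow_mul hs.le, ← he, Real.rpow_add hs, ENNReal.ofReal_mul (by positivity)]
        ring

/-- The estimate of the large values in the real interpolation argument. -/
theorem lintegral_large_le [SFinite μ] {a : X → ℝ} (ha : Measurable a) (ha0 : ∀ x, 0 ≤ a x)
    {ρ Q k w : ℝ} (hρ : 0 < ρ) (hρ2 : ρ ≤ 2) (hQ : ρ < Q) (hk : 0 < k)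
    (hw : (1 + w) * ρ * k = 2 * (Q - ρ)) :
    ∫⁻ s in Ioi (0 : ℝ), ENNReal.ofReal (s ^ w) *
      (∫⁻ x, {x | s < a x ^ k}.indicator (fun x => ENNReal.ofReal (a x ^ ρ)) x ∂μ) ^ (2 / ρ) ≤
      ENNReal.ofReal (k / (Q - ρ)) * (∫⁻ x, ENNReal.ofReal (a x ^ Q) ∂μ) ^ (2 / ρ) := by
  set M := ∫⁻ x, ENNReal.ofReal (a x ^ Q) ∂μ with hM
  -- On {s < a^k} one has a^ρ ≤ s^((ρ-Q)/k) a^Q. Spending this on all but one factor changes the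
  -- weight s^w into s^e; `hw` is the matching of exponents.
  set e := (Q - ρ) / k - 1 with he
  have hQρ : 0 < Q - ρ := sub_pos.2 hQ
  have he1 : 0 < e + 1 := by rw [he]; simp only [sub_add_cancel]; positivity
  have hS : MeasurableSet {p : ℝ × X | p.1 < a p.2 ^ k} :=
    measurableSet_lt (by fun_prop) (by fun_prop)
  calc _ ≤ ∫⁻ s in Ioi (0 : ℝ), M ^ (2 / ρ - 1) * (ENNReal.ofReal (s ^ e) *
        ∫⁻ x, {x | s < a x ^ k}.indicator (fun x => ENNReal.ofReal (a x ^ ρ)) x ∂μ) := by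
        refine setLIntegral_mono_ae' measurableSet_Ioi (Eventually.of_forall fun s hs => ?_)
        have hs0 : 0 < s := hs
        refine weighted_rpow_le (d := (ρ - Q) / k) hs0 hρ hρ2 ?_ ?_
        · rw [hM, ← lintegral_const_mul' _ _ ENNReal.ofReal_ne_top]
          refine lintegral_mono fun x => indicator_apply_le' (fun hx => ?_) fun _ => zero_le
          have hx' : s < a x ^ k := hx
          have hax : 0 < a x := by
            rcases (ha0 x).eq_or_lt with h | h
            · rw [← h, Real.zero_rpow hk.ne'] at hx'; linarith
            · exact h
          rw [← ENNReal.ofReal_mul (by positivity)]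
          refine ENNReal.ofReal_le_ofReal ?_
          calc a x ^ ρ = (a x ^ k) ^ ((ρ - Q) / k) * a x ^ Q := by
                rw [← Real.rpow_mul hax.le, ← Real.rpow_add hax]
                congr 1; field_simp; ring
            _ ≤ s ^ ((ρ - Q) / k) * a x ^ Q := by
                refine mul_le_mul_of_nonneg_right ?_ (by positivity)
                exact Real.rpow_le_rpow_of_nonpos hs0 hx'.le
                  (div_nonpos_of_nonpos_of_nonneg (by linarith) hk.le)
        · rw [he]
          field_simp
          linarith
    _ = M ^ (2 / ρ - 1) * ∫⁻ s in Ioi (0 : ℝ), (ENNReal.ofReal (s ^ e) *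
        ∫⁻ x, {x | s < a x ^ k}.indicator (fun x => ENNReal.ofReal (a x ^ ρ)) x ∂μ) := by
        refine lintegral_const_mul _ ?_
        refine Measurable.mul (by fun_prop) ?_
        exact Measurable.lintegral_prod_right' (f := fun p : ℝ × X =>
          {p : ℝ × X | p.1 < a p.2 ^ k}.indicator (fun p => ENNReal.ofReal (a p.2 ^ ρ)) p)
          (Measurable.indicator (by fun_prop) hS)
    _ ≤ M ^ (2 / ρ - 1) * (ENNReal.ofReal (k / (Q - ρ)) * M) := by
        gcongr
        refine lintegral_ofReal_mul_indicator_le (S := {p : ℝ × X | p.1 < a p.2 ^ k}) ha hS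
          (by positivity) fun x => ?_
        have hax := ha0 x
        calc _ ≤ ENNReal.ofReal (a x ^ ρ) * ∫⁻ s in Ioc 0 (a x ^ k), ENNReal.ofReal (s ^ e) := by
              refine mul_le_mul' le_rfl ?_
              have hSx : MeasurableSet {s : ℝ | (s, x) ∈ {p : ℝ × X | p.1 < a p.2 ^ k}} :=
                measurable_prodMk_right hS
              rw [lintegral_indicator hSx, Measure.restrict_restrict hSx]
              refine lintegral_mono_set ?_
              rintro s ⟨h1, h2⟩
              exact ⟨h2, le_of_lt h1⟩
          _ = ENNReal.ofReal (k / (Q - ρ)) * ENNReal.ofReal (a x ^ Q) := by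
              rw [lintegral_Ioc_rpow (by linarith) (by positivity),
                ← ENNReal.ofReal_mul (by positivity), ← ENNReal.ofReal_mul (by positivity),
                ← Real.rpow_mul hax, mul_div_assoc', ← Real.rpow_add_of_nonneg hax hρ.le (by positivity)]
              congr 1
              have e1 : ρ + k * (e + 1) = Q := by rw [he]; field_simp; ring
              rw [e1, he, sub_add_cancel]
              field_simp
    _ = _ := by
        have h1 : 0 ≤ 2 / ρ - 1 := by rw [sub_nonneg, le_div_iff₀ hρ]; linarith
        have h2 : M ^ (2 / ρ) = M ^ (2 / ρ - 1) * M := by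
          nth_rewrite 3 [← ENNReal.rpow_one M]
          rw [← ENNReal.rpow_add_of_nonneg _ _ h1 zero_le_one, sub_add_cancel]
        rw [h2]; ring

/-- The estimate of the small values in the real interpolation argument. -/
theorem lintegral_small_le [SFinite μ] {a : X → ℝ} (ha : Measurable a) (ha0 : ∀ x, 0 ≤ a x)
    {ρ Q k w : ℝ} (hQ0 : 0 < Q) (hρ2 : ρ ≤ 2) (hQ : Q < ρ) (hk : 0 < k)
    (hw : (-1 - w) * ρ * k = 2 * (ρ - Q)) :
    ∫⁻ s in Ioi (0 : ℝ), ENNReal.ofReal (s ^ w) *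
      (∫⁻ x, {x | a x ^ k ≤ s}.indicator (fun x => ENNReal.ofReal (a x ^ ρ)) x ∂μ) ^ (2 / ρ) ≤
      ENNReal.ofReal (k / (ρ - Q)) * (∫⁻ x, ENNReal.ofReal (a x ^ Q) ∂μ) ^ (2 / ρ) := by
  set M := ∫⁻ x, ENNReal.ofReal (a x ^ Q) ∂μ with hM
  set e := -1 - (ρ - Q) / k with he
  have hρ : 0 < ρ := hQ0.trans hQ
  have hQρ : 0 < ρ - Q := sub_pos.2 hQ
  have he1 : e + 1 < 0 := by
    have : 0 < (ρ - Q) / k := by positivity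
    rw [he]; linarith
  have hS : MeasurableSet {p : ℝ × X | a p.2 ^ k ≤ p.1} :=
    measurableSet_le (by fun_prop) (by fun_prop)
  calc _ ≤ ∫⁻ s in Ioi (0 : ℝ), M ^ (2 / ρ - 1) * (ENNReal.ofReal (s ^ e) *
        ∫⁻ x, {x | a x ^ k ≤ s}.indicator (fun x => ENNReal.ofReal (a x ^ ρ)) x ∂μ) := by
        refine setLIntegral_mono_ae' measurableSet_Ioi (Eventually.of_forall fun s hs => ?_)
        have hs0 : 0 < s := hs
        refine weighted_rpow_le (d := (ρ - Q) / k) hs0 hρ hρ2 ?_ ?_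
        · rw [hM, ← lintegral_const_mul' _ _ ENNReal.ofReal_ne_top]
          refine lintegral_mono fun x => indicator_apply_le' (fun hx => ?_) fun _ => zero_le
          have hx' : a x ^ k ≤ s := hx
          have hax := ha0 x
          rw [← ENNReal.ofReal_mul (by positivity)]
          refine ENNReal.ofReal_le_ofReal ?_
          calc a x ^ ρ = (a x ^ k) ^ ((ρ - Q) / k) * a x ^ Q := by
                rw [← Real.rpow_mul hax, mul_div_cancel₀ _ hk.ne',
                  ← Real.rpow_add_of_nonneg hax hQρ.le hQ0.le, sub_add_cancel]
            _ ≤ s ^ ((ρ - Q) / k) * a x ^ Q := by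
                refine mul_le_mul_of_nonneg_right ?_ (by positivity)
                exact Real.rpow_le_rpow (by positivity) hx' (by positivity)
        · rw [he]
          field_simp
          linarith
    _ = M ^ (2 / ρ - 1) * ∫⁻ s in Ioi (0 : ℝ), (ENNReal.ofReal (s ^ e) *
        ∫⁻ x, {x | a x ^ k ≤ s}.indicator (fun x => ENNReal.ofReal (a x ^ ρ)) x ∂μ) := by
        refine lintegral_const_mul _ ?_
        refine Measurable.mul (by fun_prop) ?_
        exact Measurable.lintegral_prod_right' (f := fun p : ℝ × X =>
          {p : ℝ × X | a p.2 ^ k ≤ p.1}.indicator (fun p => ENNReal.ofReal (a p.2 ^ ρ)) p)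
          (Measurable.indicator (by fun_prop) hS)
    _ ≤ M ^ (2 / ρ - 1) * (ENNReal.ofReal (k / (ρ - Q)) * M) := by
        gcongr
        refine lintegral_ofReal_mul_indicator_le (S := {p : ℝ × X | a p.2 ^ k ≤ p.1}) ha hS
          (by positivity) fun x => ?_
        rcases (ha0 x).eq_or_lt with h | hax
        · rw [← h, Real.zero_rpow hρ.ne']; simp
        calc _ ≤ ENNReal.ofReal (a x ^ ρ) * ∫⁻ s in Ici (a x ^ k), ENNReal.ofReal (s ^ e) := by
              refine mul_le_mul' le_rfl ?_
              have hSx : MeasurableSet {s : ℝ | (s, x) ∈ {p : ℝ × X | a p.2 ^ k ≤ p.1}} :=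
                measurable_prodMk_right hS
              rw [lintegral_indicator hSx, Measure.restrict_restrict hSx]
              refine lintegral_mono_set ?_
              rintro s ⟨h1, h2⟩
              exact h1
          _ = ENNReal.ofReal (a x ^ ρ) * ∫⁻ s in Ioi (a x ^ k), ENNReal.ofReal (s ^ e) := by
              rw [setLIntegral_congr Ioi_ae_eq_Ici]
          _ = ENNReal.ofReal (k / (ρ - Q)) * ENNReal.ofReal (a x ^ Q) := by
              rw [lintegral_Ioi_rpow (by linarith) (by positivity),
                ← ENNReal.ofReal_mul (by positivity), ← ENNReal.ofReal_mul (by positivity),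
                ← Real.rpow_mul hax.le, mul_div_assoc', mul_neg, ← Real.rpow_add hax]
              congr 1
              have e1 : ρ + k * (e + 1) = Q := by rw [he]; field_simp; ring
              have e2 : e + 1 = -((ρ - Q) / k) := by rw [he]; ring
              rw [e1, e2]
              field_simp
    _ = _ := by
        have h1 : 0 ≤ 2 / ρ - 1 := by rw [sub_nonneg, le_div_iff₀ hρ]; linarith
        have h2 : M ^ (2 / ρ) = M ^ (2 / ρ - 1) * M := by
          nth_rewrite 3 [← ENNReal.rpow_one M]
          rw [← ENNReal.rpow_add_of_nonneg _ _ h1 zero_le_one, sub_add_cancel]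
        rw [h2]; ring

end Interpolation

/-! ### Real interpolation: duality and absorption -/

section Interpolation

variable {X : Type*} [MeasurableSpace X] {μ : Measure X}
  {E : Type*} [NormedAddCommGroup E] [InnerProductSpace ℂ E]

theorem lintegral_indicator_mul_le {v F : X → E} (hv : AEStronglyMeasurable v μ)
    (hF : AEStronglyMeasurable F μ) {S : Set X} (hS : MeasurableSet S) {p ρ : ℝ}
    (hp : p.HolderConjugate ρ) :
    ∫⁻ x in S, ‖v x‖ₑ * ‖F x‖ₑ ∂μ ≤ eLpNorm F (ENNReal.ofReal p) μ *
      (∫⁻ x, S.indicator (fun x => ENNReal.ofReal (‖v x‖ ^ ρ)) x ∂μ) ^ (1 / ρ) := by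
  have h1 := ENNReal.lintegral_mul_le_Lp_mul_Lq μ hp hF.enorm (hv.enorm.indicator hS)
  have h2 : eLpNorm F (ENNReal.ofReal p) μ = (∫⁻ x, ‖F x‖ₑ ^ p ∂μ) ^ (1 / p) := by
    rw [eLpNorm_eq_lintegral_rpow_enorm_toReal (by simpa using hp.pos) ENNReal.ofReal_ne_top,
      ENNReal.toReal_ofReal hp.nonneg]
  rw [h2, ← lintegral_indicator hS]
  calc _ = ∫⁻ x, ((fun x => ‖F x‖ₑ) * S.indicator fun x => ‖v x‖ₑ) x ∂μ := by
        refine lintegral_congr fun x => ?_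
        by_cases hx : x ∈ S <;> simp [hx, mul_comm]
    _ ≤ _ := h1
    _ = _ := by
        congr 2
        refine lintegral_congr fun x => ?_
        by_cases hx : x ∈ S
        · simp only [hx, indicator_of_mem]
          rw [← ofReal_norm, ENNReal.ofReal_rpow_of_nonneg (norm_nonneg _) hp.symm.nonneg]
        · simp only [hx, not_false_eq_true, indicator_of_notMem]
          exact ENNReal.zero_rpow_of_pos hp.symm.pos

theorem enorm_integral_inner_le {v F : X → E} (hv : AEStronglyMeasurable v μ)
    (hF : AEStronglyMeasurable F μ) {S : Set X} (hS : MeasurableSet S) {p₀ ρ₀ p₁ ρ₁ : ℝ}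
    (hp₀ : p₀.HolderConjugate ρ₀) (hp₁ : p₁.HolderConjugate ρ₁) :
    ‖∫ x, inner ℂ (v x) (F x) ∂μ‖ₑ ≤
      eLpNorm F (ENNReal.ofReal p₁) μ *
        (∫⁻ x, S.indicator (fun x => ENNReal.ofReal (‖v x‖ ^ ρ₁)) x ∂μ) ^ (1 / ρ₁) +
      eLpNorm F (ENNReal.ofReal p₀) μ *
        (∫⁻ x, Sᶜ.indicator (fun x => ENNReal.ofReal (‖v x‖ ^ ρ₀)) x ∂μ) ^ (1 / ρ₀) := by
  calc _ ≤ ∫⁻ x, ‖inner ℂ (v x) (F x)‖ₑ ∂μ := enorm_integral_le_lintegral_enorm _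
    _ ≤ ∫⁻ x, ‖v x‖ₑ * ‖F x‖ₑ ∂μ := by
        refine lintegral_mono fun x => ?_
        rw [← ofReal_norm, ← ofReal_norm, ← ofReal_norm, ← ENNReal.ofReal_mul (norm_nonneg _)]
        exact ENNReal.ofReal_le_ofReal (norm_inner_le_norm _ _)
    _ = _ := (lintegral_add_compl _ hS).symm
    _ ≤ _ := add_le_add (lintegral_indicator_mul_le hv hF hS hp₁)
        (lintegral_indicator_mul_le hv hF hS.compl hp₀)

/-- Cauchy–Schwarz in s: the place where the square integrability of b is spent. -/
theorem lintegral_mul_le_of_sq {b : ℝ → ℝ≥0∞} {S : Set ℝ} {w : ℝ} {Y : ℝ → ℝ≥0∞} {ρ : ℝ} {D : ℝ≥0∞}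
    (hS : MeasurableSet S) (hS0 : S ⊆ Ioi 0)
    (hb : AEMeasurable b (volume.restrict S)) (hY : Measurable Y)
    (hb1 : ∫⁻ s in S, b s ^ 2 ≤ 1)
    (hD : ∫⁻ s in S, ENNReal.ofReal (s ^ (2 * w)) * Y s ^ (2 / ρ) ≤ D) :
    ∫⁻ s in S, ENNReal.ofReal (s ^ w) * b s * Y s ^ (1 / ρ) ≤ D ^ (1 / 2 : ℝ) := by
  have h1 := ENNReal.lintegral_mul_le_Lp_mul_Lq (volume.restrict S) Real.HolderConjugate.two_two hb
    (g := fun s => ENNReal.ofReal (s ^ w) * Y s ^ (1 / ρ)) (by fun_prop)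
  calc _ = ∫⁻ s in S, (b * fun s => ENNReal.ofReal (s ^ w) * Y s ^ (1 / ρ)) s := by
        refine lintegral_congr fun s => ?_
        simp only [Pi.mul_apply]; ring
    _ ≤ _ := h1
    _ ≤ 1 * D ^ (1 / 2 : ℝ) := by
        refine mul_le_mul' ?_ ?_
        · refine ENNReal.rpow_le_one ?_ (by norm_num)
          simpa using hb1
        · refine ENNReal.rpow_le_rpow (le_trans (le_of_eq ?_) hD) (by norm_num)
          refine setLIntegral_congr_fun hS fun s hs => ?_
          have hs0 : 0 < s := hS0 hs
          rw [ENNReal.mul_rpow_of_nonneg _ _ (by norm_num), ENNReal.ofReal_rpow_of_pos (by positivity),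
            ← Real.rpow_mul hs0.le, ← ENNReal.rpow_mul, mul_comm w 2, one_div_mul_eq_div]
    _ = _ := one_mul _

/-- A quantity bounded by its own powers of exponents below 1 cannot be large. -/
theorem le_of_le_rpow_add_rpow {m C x₀ x₁ : ℝ} (hm : 0 ≤ m) (hC : 0 ≤ C) (hx : x₀ ≤ x₁) (hx1 : x₁ < 1)
    (h : m ≤ C * (m ^ x₁ + m ^ x₀)) : m ≤ max 1 ((2 * C) ^ (1 / (1 - x₁))) := by
  rcases le_or_gt m 1 with h1 | h1
  · exact le_max_of_le_left h1
  · refine le_max_of_le_right ?_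
    have h2 : m ^ x₀ ≤ m ^ x₁ := Real.rpow_le_rpow_of_exponent_le h1.le hx
    have h3 : m ^ (1 - x₁) ≤ 2 * C := by
      rw [Real.rpow_sub (by linarith), Real.rpow_one, div_le_iff₀ (by positivity)]
      nlinarith
    calc m = (m ^ (1 - x₁)) ^ (1 / (1 - x₁)) := by
          rw [← Real.rpow_mul hm, mul_one_div_cancel (by linarith), Real.rpow_one]
      _ ≤ _ := Real.rpow_le_rpow (by positivity) h3 (by rw [one_div, inv_nonneg]; linarith)

/-- The function `φ |φ| ^ (q - 2)`, cut off where `|φ| > N`. -/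
noncomputable def truncPow (q N : ℝ) (φ : X → E) (x : X) : E :=
  {x | ‖φ x‖ ≤ N}.indicator (fun x => ((‖φ x‖ ^ (q - 2) : ℝ) : ℂ) • φ x) x

theorem norm_truncPow {q : ℝ} (hq : 2 < q) (N : ℝ) (φ : X → E) (x : X) :
    ‖truncPow q N φ x‖ = {x | ‖φ x‖ ≤ N}.indicator (fun x => ‖φ x‖ ^ (q - 1)) x := by
  by_cases hx : ‖φ x‖ ≤ N
  · simp only [truncPow, mem_ofPred_eq, hx, indicator_of_mem]
    rw [norm_smul, Complex.norm_real, Real.norm_of_nonneg (by positivity),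
      show q - 1 = q - 2 + 1 by ring, Real.rpow_add_one' (norm_nonneg _) (by linarith)]
  · simp [truncPow, hx]

theorem norm_truncPow_rpow {q : ℝ} (hq : 2 < q) (N : ℝ) (φ : X → E) (x : X) :
    ‖truncPow q N φ x‖ ^ (q / (q - 1)) = {x | ‖φ x‖ ≤ N}.indicator (fun x => ‖φ x‖ ^ q) x := by
  rw [norm_truncPow hq]
  by_cases hx : ‖φ x‖ ≤ N
  · simp only [mem_ofPred_eq, hx, indicator_of_mem]
    rw [← Real.rpow_mul (norm_nonneg _), mul_div_cancel₀ _ (by linarith)]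
  · simp only [mem_ofPred_eq, hx, not_false_eq_true, indicator_of_notMem]
    exact Real.zero_rpow (div_pos (by linarith) (by linarith)).ne'

/-- The duality function: testing φ with v = `truncPow q N φ` returns |v|^(q/(q-1)), a power of v
alone. The argument thus closes on v, whose norms are finite by truncation. -/
theorem inner_truncPow {q : ℝ} (hq : 2 < q) (N : ℝ) (φ : X → E) (x : X) :
    inner ℂ (truncPow q N φ x) (φ x) = ((‖truncPow q N φ x‖ ^ (q / (q - 1)) : ℝ) : ℂ) := by
  rw [norm_truncPow_rpow hq]
  by_cases hx : ‖φ x‖ ≤ N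
  · simp only [truncPow, mem_ofPred_eq, hx, indicator_of_mem]
    rw [inner_smul_left, Complex.conj_ofReal, inner_self_eq_norm_sq_to_K]
    change ((‖φ x‖ ^ (q - 2) : ℝ) : ℂ) * ((‖φ x‖ : ℝ) : ℂ) ^ 2 = _
    rw [← Complex.ofReal_pow, ← Complex.ofReal_mul, ← Real.rpow_natCast, Nat.cast_ofNat,
      ← Real.rpow_add' (norm_nonneg _) (by linarith), sub_add_cancel]
  · simp [truncPow, hx]

theorem measurable_truncPow {q N : ℝ} {φ : X → E} (hφ : StronglyMeasurable φ) :
    StronglyMeasurable (truncPow q N φ) := by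
  refine StronglyMeasurable.indicator ?_ (measurableSet_le hφ.norm.measurable measurable_const)
  exact StronglyMeasurable.smul
    (Complex.continuous_ofReal.comp_stronglyMeasurable
      (hφ.norm.measurable.pow_const _).stronglyMeasurable) hφ

theorem norm_truncPow_le {q : ℝ} (hq : 2 < q) {N : ℝ} (hN : 0 ≤ N) (φ : X → E) (x : X) :
    ‖truncPow q N φ x‖ ≤ N ^ (q - 1) := by
  rw [norm_truncPow hq]
  refine indicator_apply_le' (fun hx => ?_) fun _ => by positivity
  exact Real.rpow_le_rpow (norm_nonneg _) hx (by linarith)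

/-- If truncated powers are bounded uniformly, then so is the norm. -/
theorem eLpNorm_le_of_truncPow {q K : ℝ} (hq : 2 < q) {φ : X → E} (hφ : StronglyMeasurable φ)
    (h : ∀ N : ℕ, ∫⁻ x, ENNReal.ofReal (‖truncPow q N φ x‖ ^ (q / (q - 1))) ∂μ ≤ ENNReal.ofReal K) :
    eLpNorm φ (ENNReal.ofReal q) μ ≤ ENNReal.ofReal K ^ (1 / q) := by
  rw [eLpNorm_eq_lintegral_rpow_enorm_toReal (by simpa using (by linarith : 0 < q))
    ENNReal.ofReal_ne_top, ENNReal.toReal_ofReal (by linarith)]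
  refine ENNReal.rpow_le_rpow ?_ (by rw [one_div, inv_nonneg]; linarith)
  have hlim : Tendsto (fun N : ℕ => ∫⁻ x, ENNReal.ofReal (‖truncPow q N φ x‖ ^ (q / (q - 1))) ∂μ)
      atTop (𝓝 (∫⁻ x, ‖φ x‖ₑ ^ q ∂μ)) := by
    refine lintegral_tendsto_of_tendsto_of_monotone (fun N => ?_) ?_ ?_
    · exact ((measurable_truncPow hφ).norm.measurable.pow_const _).ennreal_ofReal.aemeasurable
    · refine Eventually.of_forall fun x N M hNM => ENNReal.ofReal_le_ofReal ?_
      rw [norm_truncPow_rpow hq, norm_truncPow_rpow hq]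
      refine indicator_le_indicator_of_subset (fun y hy => ?_) (fun y => by positivity) x
      have hy' : ‖φ y‖ ≤ N := hy
      exact hy'.trans (by exact_mod_cast hNM)
    · refine Eventually.of_forall fun x => tendsto_const_nhds.congr' ?_
      obtain ⟨n, hn⟩ := exists_nat_ge ‖φ x‖
      filter_upwards [eventually_ge_atTop n] with N hN
      have hx : ‖φ x‖ ≤ N := hn.trans (by exact_mod_cast hN)
      rw [norm_truncPow_rpow hq, indicator_of_mem (by exact hx), ← ofReal_norm,
        ENNReal.ofReal_rpow_of_nonneg (norm_nonneg _) (by linarith)]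
  exact le_of_tendsto' hlim h

theorem integrable_truncPow_rpow [IsFiniteMeasure μ] {q : ℝ} (hq : 2 < q) {N : ℝ} (hN : 0 ≤ N) {φ : X → E}
    (hφ : StronglyMeasurable φ) :
    Integrable (fun x => ‖truncPow q N φ x‖ ^ (q / (q - 1))) μ := by
  refine Integrable.of_bound
    ((measurable_truncPow hφ).norm.measurable.pow_const _).aestronglyMeasurable
    ((N ^ (q - 1)) ^ (q / (q - 1))) (Eventually.of_forall fun x => ?_)
  have : 0 ≤ q / (q - 1) := div_nonneg (by linarith) (by linarith)
  rw [Real.norm_of_nonneg (by positivity)]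
  exact Real.rpow_le_rpow (norm_nonneg _) (norm_truncPow_le hq hN φ x) this

/-- On a finite measure space the truncated function is bounded, hence in L_2, so pairing with it
commutes with the Bochner integral ∫ Φ in L_2. -/
theorem lintegral_truncPow_le [IsFiniteMeasure μ] [CompleteSpace E] {q : ℝ} (hq : 2 < q) {N : ℝ}
    (hN : 0 ≤ N) {φ : Lp E 2 μ} {Φ : ℝ → Lp E 2 μ} (hΦ : IntegrableOn Φ (Ioi 0))
    (hφ : φ = ∫ s in Ioi 0, Φ s) :
    ∫⁻ x, ENNReal.ofReal (‖truncPow q N φ x‖ ^ (q / (q - 1))) ∂μ ≤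
      ∫⁻ s in Ioi (0 : ℝ), ‖∫ x, inner ℂ (truncPow q N φ x) (Φ s x) ∂μ‖ₑ := by
  have hm := measurable_truncPow (q := q) (N := N) (Lp.stronglyMeasurable φ)
  have hv : MemLp (truncPow q N φ) 2 μ := MemLp.of_bound hm.aestronglyMeasurable (N ^ (q - 1))
    (Eventually.of_forall fun x => norm_truncPow_le hq hN φ x)
  have hinner : ∀ g : Lp E 2 μ, inner ℂ (hv.toLp _) g = ∫ x, inner ℂ (truncPow q N φ x) (g x) ∂μ := by
    intro g
    rw [L2.inner_def]
    refine integral_congr_ae (hv.coeFn_toLp.mono fun x hx => ?_)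
    dsimp only
    rw [hx]
  have h1 : inner ℂ (hv.toLp _) φ = ∫ s in Ioi (0 : ℝ), inner ℂ (hv.toLp _) (Φ s) := by
    rw [integral_inner hΦ, ← hφ]
  simp only [hinner] at h1
  rw [← ofReal_integral_eq_lintegral_ofReal
    (integrable_truncPow_rpow hq hN (Lp.stronglyMeasurable φ))
    (Eventually.of_forall fun x => by positivity)]
  calc _ = ‖∫ x, inner ℂ (truncPow q N φ x) (φ x) ∂μ‖ₑ := by
        simp only [inner_truncPow hq]
        rw [integral_complex_ofReal, ← ofReal_norm, Complex.norm_real, Real.norm_of_nonneg]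
        exact integral_nonneg fun x => by positivity
    _ ≤ _ := by
        rw [h1]
        exact enorm_integral_le_lintegral_enorm _

theorem measurable_lintegral_indicator [SFinite μ] {S : Set (ℝ × X)} (hS : MeasurableSet S) {a : X → ℝ}
    (ha : Measurable a) (ρ : ℝ) : Measurable fun s : ℝ =>
      ∫⁻ x, {x | (s, x) ∈ S}.indicator (fun x => ENNReal.ofReal (a x ^ ρ)) x ∂μ :=
  Measurable.lintegral_prod_right' (f := fun p : ℝ × X =>
    S.indicator (fun p => ENNReal.ofReal (a p.2 ^ ρ)) p) (Measurable.indicator (by fun_prop) hS)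

/-- Real interpolation: if `φ = ∫ Φ s ds` in `L_2` with bounds of `Φ s` in `L_{p₀}` and `L_{p₁}` by
`s ^ (-β - 1/2) b s` and `s ^ (-β) b s`, where `b` is in the unit ball of `L_2(0, ∞)`, then `φ`
is bounded in `L_q` for the intermediate exponent `q`. -/
theorem exists_eLpNorm_le_of_integral [IsFiniteMeasure μ] [CompleteSpace E] {p₀ p₁ q β : ℝ}
    (hp₀ : 2 ≤ p₀) (hp : p₀ < p₁) (hβ0 : 0 < β) (hβ1 : β < 1 / 2)
    (hq : 1 / q = (1 - 2 * β) / p₀ + 2 * β / p₁) :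
    ∃ K : ℝ, 0 ≤ K ∧ ∀ (φ : Lp E 2 μ) (Φ : ℝ → Lp E 2 μ) (b : ℝ → ℝ≥0∞), IntegrableOn Φ (Ioi 0) →
      φ = ∫ s in Ioi 0, Φ s → AEMeasurable b (volume.restrict (Ioi 0)) →
      ∫⁻ s in Ioi 0, b s ^ 2 ≤ 1 →
      (∀ s, 0 < s → eLpNorm (Φ s) (ENNReal.ofReal p₀) μ ≤
        ENNReal.ofReal (s ^ (-β - 1 / 2)) * b s) →
      (∀ s, 0 < s → eLpNorm (Φ s) (ENNReal.ofReal p₁) μ ≤ ENNReal.ofReal (s ^ (-β)) * b s) →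
      eLpNorm φ (ENNReal.ofReal q) μ ≤ ENNReal.ofReal K := by
  have hp0 : 0 < p₀ := by linarith
  have hp1 : 0 < p₁ := by linarith
  have hinv : 1 / p₁ < 1 / p₀ := one_div_lt_one_div_of_lt hp0 hp
  have hp₀i : 1 / p₀ ≤ 1 / 2 := one_div_le_one_div_of_le (by norm_num) hp₀
  have hp₁i : 0 < 1 / p₁ := by positivity
  have hq' : 1 / q = 1 / p₀ - 2 * β * (1 / p₀ - 1 / p₁) := by rw [hq]; ring
  have hqi0 : 0 < 1 / q := by rw [hq']; nlinarith
  have hqi1 : 1 / q < 1 / p₀ := by rw [hq']; nlinarith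
  have hqi2 : 1 / p₁ < 1 / q := by rw [hq']; nlinarith
  have hq0 : 0 < q := one_div_pos.1 hqi0
  have hq2 : 2 < q := by
    by_contra hcon
    have := one_div_le_one_div_of_le hq0 (not_lt.1 hcon)
    linarith
  set Q := q / (q - 1) with hQ
  set ρ₀ := p₀ / (p₀ - 1) with hρ₀
  set ρ₁ := p₁ / (p₁ - 1) with hρ₁
  have hc₀ : p₀.HolderConjugate ρ₀ := .conjExponent (by linarith)
  have hc₁ : p₁.HolderConjugate ρ₁ := .conjExponent (by linarith)
  have hcq : q.HolderConjugate Q := .conjExponent (by linarith)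
  have hρ₀0 := hc₀.symm.pos
  have hρ₁0 := hc₁.symm.pos
  have hQ0 := hcq.symm.pos
  have e0 : 1 / ρ₀ = 1 - 1 / p₀ := by have := hc₀.inv_add_inv_eq_one; simp only [one_div]; linarith
  have e1 : 1 / ρ₁ = 1 - 1 / p₁ := by have := hc₁.inv_add_inv_eq_one; simp only [one_div]; linarith
  have eq : 1 / Q = 1 - 1 / q := by have := hcq.inv_add_inv_eq_one; simp only [one_div]; linarith
  have hρ₀2 : ρ₀ ≤ 2 := by
    rw [← one_div_le_one_div (by norm_num) hρ₀0, e0]; linarith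
  have hQρ₀ : Q < ρ₀ := (one_div_lt_one_div hρ₀0 hQ0).1 (by rw [e0, eq]; linarith)
  have hρ₁Q : ρ₁ < Q := (one_div_lt_one_div hQ0 hρ₁0).1 (by rw [e1, eq]; linarith)
  -- The level |v|^k = s at which v is split. This k satisfies the homogeneity conditions `hw₁` for
  -- the large values and `hw₀` for the small ones simultaneously.
  set k := 2 * Q * (1 / ρ₁ - 1 / ρ₀) with hk
  have hk0 : 0 < k := by
    have : 0 < 1 / ρ₁ - 1 / ρ₀ := by rw [e0, e1]; linarith
    positivity
  have hrel : 1 / Q = 1 / ρ₀ + 2 * β * (1 / ρ₁ - 1 / ρ₀) := by rw [eq, e0, e1, hq']; ring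
  have hw₁ : (1 + -(2 * β)) * ρ₁ * k = 2 * (Q - ρ₁) := by
    have h1 : Q - ρ₁ = Q * ρ₁ * (1 / ρ₁ - 1 / Q) := by field_simp
    rw [h1, hrel, hk]; ring
  have hw₀ : (-1 - (-(2 * β) - 1)) * ρ₀ * k = 2 * (ρ₀ - Q) := by
    have h1 : ρ₀ - Q = Q * ρ₀ * (1 / Q - 1 / ρ₀) := by field_simp
    rw [h1, hrel, hk]; ring
  set D₁ := ENNReal.ofReal (k / (Q - ρ₁)) with hD₁
  set D₀ := ENNReal.ofReal (k / (ρ₀ - Q)) with hD₀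
  set C := max (√(k / (Q - ρ₁))) (√(k / (ρ₀ - Q))) with hC
  set m₀ := max 1 ((2 * C) ^ (1 / (1 - 1 / ρ₁))) with hm₀
  refine ⟨m₀ ^ (1 / q), by positivity, fun φ Φ b hΦ hφ hb hb1 h₀ h₁ => ?_⟩
  rw [← ENNReal.ofReal_rpow_of_nonneg (by positivity) (by positivity)]
  refine eLpNorm_le_of_truncPow hq2 (Lp.stronglyMeasurable φ) fun N => ?_
  have hN : (0 : ℝ) ≤ N := Nat.cast_nonneg N
  set v := truncPow q N φ with hv
  have hvm : StronglyMeasurable v := measurable_truncPow (Lp.stronglyMeasurable φ)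
  have ha : Measurable fun x => ‖v x‖ := hvm.norm.measurable
  set M := ∫⁻ x, ENNReal.ofReal (‖v x‖ ^ Q) ∂μ with hM
  have hint := integrable_truncPow_rpow (μ := μ) hq2 hN (Lp.stronglyMeasurable φ)
  -- Finiteness of M, due to the truncation at N, makes the absorption at the end legitimate. The
  -- bound m₀ obtained there does not depend on N.
  have hMtop : M ≠ ⊤ := by
    rw [hM, ← ofReal_integral_eq_lintegral_ofReal hint (Eventually.of_forall fun x => by positivity)]
    exact ENNReal.ofReal_ne_top
  have hpow : Measurable fun p : ℝ × X => ‖v p.2‖ ^ k := (ha.comp measurable_snd).pow_const k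
  have hS : MeasurableSet {p : ℝ × X | p.1 < ‖v p.2‖ ^ k} := measurableSet_lt measurable_fst hpow
  set Y₁ : ℝ → ℝ≥0∞ := fun s =>
    ∫⁻ x, {x | s < ‖v x‖ ^ k}.indicator (fun x => ENNReal.ofReal (‖v x‖ ^ ρ₁)) x ∂μ with hY₁
  set Y₀ : ℝ → ℝ≥0∞ := fun s =>
    ∫⁻ x, {x | ‖v x‖ ^ k ≤ s}.indicator (fun x => ENNReal.ofReal (‖v x‖ ^ ρ₀)) x ∂μ with hY₀
  have hY₁m : Measurable Y₁ := measurable_lintegral_indicator hS ha ρ₁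
  have hY₀m : Measurable Y₀ := measurable_lintegral_indicator (S := {p : ℝ × X | ‖v p.2‖ ^ k ≤ p.1})
    (measurableSet_le hpow measurable_fst) ha ρ₀
  have hL₁ := lintegral_large_le (μ := μ) ha (fun x => norm_nonneg _) hρ₁0
    (by linarith : ρ₁ ≤ 2) hρ₁Q hk0 hw₁
  have hL₀ := lintegral_small_le (μ := μ) ha (fun x => norm_nonneg _) hQ0 hρ₀2 hQρ₀ hk0 hw₀
  have hI₁ : ∫⁻ s in Ioi (0 : ℝ), ENNReal.ofReal (s ^ (-β)) * b s * Y₁ s ^ (1 / ρ₁) ≤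
      (D₁ * M ^ (2 / ρ₁)) ^ (1 / 2 : ℝ) := lintegral_mul_le_of_sq measurableSet_Ioi subset_rfl hb hY₁m hb1
    (by simpa only [mul_neg] using hL₁)
  have hI₀ : ∫⁻ s in Ioi (0 : ℝ), ENNReal.ofReal (s ^ (-β - 1 / 2)) * b s * Y₀ s ^ (1 / ρ₀) ≤
      (D₀ * M ^ (2 / ρ₀)) ^ (1 / 2 : ℝ) := lintegral_mul_le_of_sq measurableSet_Ioi subset_rfl hb hY₀m hb1
    (by simpa only [show 2 * (-β - 1 / 2) = -(2 * β) - 1 by ring] using hL₀)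
  have hroot : ∀ {x ρ : ℝ}, 0 < ρ → (ENNReal.ofReal x * M ^ (2 / ρ)) ^ (1 / 2 : ℝ) =
      ENNReal.ofReal (√x) * M ^ (1 / ρ) := by
    intro x ρ hρ
    rw [ENNReal.mul_rpow_of_nonneg _ _ (by norm_num), ← ENNReal.rpow_mul]
    congr 1
    · rcases le_total 0 x with hx | hx
      · rw [ENNReal.ofReal_rpow_of_nonneg hx (by norm_num), Real.sqrt_eq_rpow]
      · rw [ENNReal.ofReal_of_nonpos hx, Real.sqrt_eq_zero_of_nonpos hx]; simp
    · congr 1; field_simp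
  have hC0 : 0 ≤ C := le_max_of_le_left (Real.sqrt_nonneg _)
  -- Large values of v are paired with Φ s in L_{p₁}, small values in L_{p₀}. Both exponents 1/ρ₁
  -- and 1/ρ₀ on the right are below 1.
  have hfin : M ≤ ENNReal.ofReal C * (M ^ (1 / ρ₁) + M ^ (1 / ρ₀)) := by
    calc M ≤ ∫⁻ s in Ioi (0 : ℝ), ‖∫ x, inner ℂ (v x) (Φ s x) ∂μ‖ₑ :=
          lintegral_truncPow_le hq2 hN hΦ hφ
      _ ≤ ∫⁻ s in Ioi (0 : ℝ), (ENNReal.ofReal (s ^ (-β)) * b s * Y₁ s ^ (1 / ρ₁) +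
            ENNReal.ofReal (s ^ (-β - 1 / 2)) * b s * Y₀ s ^ (1 / ρ₀)) := by
          refine setLIntegral_mono_ae' measurableSet_Ioi (Eventually.of_forall fun s hs => ?_)
          refine (enorm_integral_inner_le hvm.aestronglyMeasurable
            (Lp.stronglyMeasurable (Φ s)).aestronglyMeasurable
            (S := {x | s < ‖v x‖ ^ k}) (measurableSet_lt measurable_const (ha.pow_const k)) hc₀ hc₁).trans ?_
          have hcompl : {x | s < ‖v x‖ ^ k}ᶜ = {x | ‖v x‖ ^ k ≤ s} := by
            ext x; simp
          rw [hcompl]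
          exact add_le_add (mul_le_mul' (h₁ s hs) le_rfl) (mul_le_mul' (h₀ s hs) le_rfl)
      _ = (∫⁻ s in Ioi (0 : ℝ), ENNReal.ofReal (s ^ (-β)) * b s * Y₁ s ^ (1 / ρ₁)) +
            ∫⁻ s in Ioi (0 : ℝ), ENNReal.ofReal (s ^ (-β - 1 / 2)) * b s * Y₀ s ^ (1 / ρ₀) := by
          refine lintegral_add_left' ?_ _
          fun_prop
      _ ≤ ENNReal.ofReal (√(k / (Q - ρ₁))) * M ^ (1 / ρ₁) +
            ENNReal.ofReal (√(k / (ρ₀ - Q))) * M ^ (1 / ρ₀) := by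
          rw [← hroot hρ₁0, ← hroot hρ₀0]
          exact add_le_add hI₁ hI₀
      _ ≤ _ := by
          rw [mul_add]
          exact add_le_add
            (mul_le_mul' (ENNReal.ofReal_le_ofReal (le_max_left _ _)) le_rfl)
            (mul_le_mul' (ENNReal.ofReal_le_ofReal (le_max_right _ _)) le_rfl)
  obtain ⟨m, hm, hMm⟩ : ∃ m : ℝ, 0 ≤ m ∧ M = ENNReal.ofReal m :=
    ⟨M.toReal, ENNReal.toReal_nonneg, (ENNReal.ofReal_toReal hMtop).symm⟩
  rw [hMm] at hfin ⊢
  refine ENNReal.ofReal_le_ofReal ?_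
  rw [ENNReal.ofReal_rpow_of_nonneg hm (by positivity), ENNReal.ofReal_rpow_of_nonneg hm (by positivity),
    ← ENNReal.ofReal_add (by positivity) (by positivity), ← ENNReal.ofReal_mul hC0,
    ENNReal.ofReal_le_ofReal_iff (by positivity)] at hfin
  exact le_of_le_rpow_add_rpow hm hC0 (by rw [e0, e1]; linarith) (by rw [e1]; linarith) hfin

end Interpolation

/-! ### Identification of A with the inverse of a bounded operator -/

section Identification

variable {H : Type*} [NormedAddCommGroup H] [InnerProductSpace ℂ H] [CompleteSpace H]
  {V : Type*} [NormedAddCommGroup V] [InnerProductSpace ℂ V] [CompleteSpace V]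
  {T : V →L[ℂ] V} {ι : V →L[ℂ] H} {c : ℝ} {A : H →ₗ.[ℂ] H}

theorem exists_isCoerciveOp {a : V →ₗ[ℂ] V →ₗ⋆[ℂ] ℂ} {C : ℝ}
    (hC : ∀ u v : V, ‖a u v‖ ≤ C * ‖u‖ * ‖v‖) (hc : 0 < c)
    (ha : ∀ u : V, c * ‖u‖ ^ 2 ≤ (a u u).re) :
    ∃ T : V →L[ℂ] V, IsCoerciveOp T c ∧ ∀ u φ, a u φ = inner ℂ φ (T u) := by
  -- The Riesz representation used here wants conjugate linearity in the first argument, hence the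
  -- conjugate of a.
  let b : V →ₗ⋆[ℂ] V →ₗ[ℂ] ℂ := LinearMap.mk₂'ₛₗ (starRingEnd ℂ) (RingHom.id ℂ)
    (fun u φ => starRingEnd ℂ (a u φ)) (by simp) (by simp) (by simp) (by simp)
  have hb : ∀ u v, ‖b u v‖ ≤ C * ‖u‖ * ‖v‖ := fun u v => by
    simpa [b] using hC u v
  let B : V →L⋆[ℂ] V →L[ℂ] ℂ := LinearMap.mkContinuous₂ b C hb
  have hT : ∀ u φ, a u φ = inner ℂ φ (InnerProductSpace.continuousLinearMapOfBilin B u) := by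
    intro u φ
    rw [← inner_conj_symm, InnerProductSpace.continuousLinearMapOfBilin_apply]
    simp [B, b]
  exact ⟨_, ⟨hc, fun u => by rw [← hT]; exact ha u⟩, hT⟩

/-- The operator `A` is the inverse of `resol T ι 0`. -/
def IsInverseResol (A : H →ₗ.[ℂ] H) (T : V →L[ℂ] V) (ι : V →L[ℂ] H) : Prop :=
  ∀ u w : H, (u, w) ∈ A.graph ↔ u = resol T ι 0 w

theorem resol_eq_zero (hT : IsCoerciveOp T c) (hι : DenseRange ι) {s : ℝ} (hs : 0 ≤ s) {h : H}
    (h0 : resol T ι s h = 0) : h = 0 := by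
  refine eq_zero_of_solve_eq_zero hT hι hs ?_
  have h1 := energy_solve (ι := ι) hT hs h
  rw [h0] at h1
  simp only [norm_zero, inner_zero_left, Complex.zero_re] at h1
  have h2 : ‖solve T ι s h‖ ^ 2 ≤ 0 := by
    have := hT.pos
    nlinarith
  exact norm_eq_zero.1 (pow_eq_zero_iff two_ne_zero |>.1 (le_antisymm h2 (sq_nonneg _)))

theorem shiftedOp_zero : shiftedOp T ι 0 = T := by simp [shiftedOp]

/-- The form graph is {(ι T⁻¹ ι† w, w)}. It is the graph of an operator because ι T⁻¹ ι† is
injective, by energy and the density of V. -/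
theorem isInverseResol_formOperator {a : V →ₗ[ℂ] V →ₗ⋆[ℂ] ℂ} (hT : IsCoerciveOp T c)
    (hι : DenseRange ι) (ha : ∀ u φ, a u φ = inner ℂ φ (T u)) :
    IsInverseResol (formOperator ι a) T ι := by
  have key : ∀ u w : H, (u, w) ∈ formGraph ι a ↔ u = resol T ι 0 w := by
    intro u w
    have h1 : ∀ x : V, (∀ φ, a x φ = inner ℂ (ι φ) w) ↔ x = solve T ι 0 w := by
      intro x
      constructor
      · intro hx
        refine (solve_eq hT le_rfl ?_).symm
        rw [shiftedOp_zero]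
        refine ext_inner_left ℂ fun φ => ?_
        rw [← ha, hx, ContinuousLinearMap.adjoint_inner_right]
      · rintro rfl φ
        have := shiftedOp_solve (ι := ι) hT le_rfl w
        rw [shiftedOp_zero] at this
        rw [ha, this, ContinuousLinearMap.adjoint_inner_right]
    constructor
    · rintro ⟨x, hx, hx'⟩
      rw [(h1 x).1 hx'] at hx
      exact hx.symm
    · rintro rfl
      exact ⟨_, rfl, (h1 _).2 rfl⟩
  intro u w
  rw [formOperator, Submodule.toLinearPMap_graph_eq, key]
  rintro ⟨x, y⟩ hx rfl
  exact resol_eq_zero hT hι le_rfl ((key _ _).1 hx).symm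

/-- D(A) is the range of A^(-1), and it is dense since (A^(-1) x, x) = 0 forces x = 0. The adjoint
may then be computed on graphs, where it becomes the adjoint of the bounded operator A^(-1). -/
theorem IsInverseResol.adjoint (h : IsInverseResol A T ι) (hT : IsCoerciveOp T c)
    (hι : DenseRange ι) :
    IsInverseResol A.adjoint T.adjoint ι := by
  have hd : Dense (A.domain : Set H) := by
    refine Submodule.dense_iff_topologicalClosure_eq_top.2 ?_
    rw [Submodule.topologicalClosure_eq_top_iff, Submodule.eq_bot_iff]
    intro x hx
    have h2 : inner ℂ (resol T ι 0 x) x = (0 : ℂ) :=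
      hx _ (LinearPMap.mem_domain_of_mem_graph ((h _ _).2 rfl))
    have h1 := energy_solve (ι := ι) hT le_rfl x
    rw [h2] at h1
    have h3 : ‖solve T ι 0 x‖ ^ 2 ≤ 0 := by
      have := hT.pos
      simp only [zero_mul, add_zero, Complex.zero_re] at h1
      nlinarith
    have h4 : solve T ι 0 x = 0 :=
      norm_eq_zero.1 (pow_eq_zero_iff two_ne_zero |>.1 (le_antisymm h3 (sq_nonneg _)))
    exact eq_zero_of_solve_eq_zero hT hι le_rfl h4
  intro y z
  rw [LinearPMap.adjoint_graph_eq_graph_adjoint hd, Submodule.mem_adjoint_iff,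
    ← resol_adjoint hT le_rfl]
  constructor
  · intro hy
    refine ext_inner_left ℂ fun b => ?_
    rw [ContinuousLinearMap.adjoint_inner_right]
    exact sub_eq_zero.1 (hy _ b ((h _ _).2 rfl))
  · rintro rfl a b hab
    rw [(h _ _).1 hab, ContinuousLinearMap.adjoint_inner_right, sub_self]

theorem IsInverseResol.isResolvent (h : IsInverseResol A T ι) (hT : IsCoerciveOp T c) {s : ℝ}
    (hs : 0 ≤ s) : IsResolvent A s (resol T ι s) := by
  have h0 : ∀ x, (s : ℂ) • resol T ι 0 (resol T ι s x) = resol T ι 0 x - resol T ι s x :=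
    fun x => congrArg (fun S : H →L[ℂ] H => S x) (resol_zero_mul (ι := ι) hT hs)
  constructor
  · intro x
    have h1 : (resol T ι s x, x - (s : ℂ) • resol T ι s x) ∈ A.graph := by
      rw [h, map_sub, map_smul, h0, sub_sub_cancel]
    obtain ⟨y, hy, hy'⟩ := A.mem_graph_iff.1 h1
    dsimp only at hy hy'
    have hd : resol T ι s x ∈ A.domain := hy ▸ y.2
    refine ⟨hd, ?_⟩
    have : y = ⟨_, hd⟩ := Subtype.ext hy
    rw [← this, hy', add_sub_cancel]
  · intro u
    have h1 := (h _ _).1 (A.mem_graph u)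
    have h2 : resol T ι s (resol T ι 0 (A u)) = resol T ι 0 (resol T ι s (A u)) :=
      congrArg (fun S : H →L[ℂ] H => S (A u)) (resol_comm hT hs le_rfl).eq
    rw [map_add, map_smul, h1, h2, h0, sub_add_cancel]

theorem IsResolvent.unique {s : ℝ} {R R' : H →L[ℂ] H} (h : IsResolvent A s R)
    (h' : IsResolvent A s R') : R = R' := by
  ext x
  obtain ⟨hd, hx⟩ := h.1 x
  have := h'.2 ⟨R x, hd⟩
  rw [hx] at this
  exact this.symm

theorem IsInverseResol.res_eq (h : IsInverseResol A T ι) (hT : IsCoerciveOp T c) {s : ℝ}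
    (hs : 0 ≤ s) : res A s = resol T ι s := by
  have hex : ∃ R, IsResolvent A s R := ⟨_, h.isResolvent hT hs⟩
  rw [res, dif_pos hex]
  exact hex.choose_spec.unique (h.isResolvent hT hs)

theorem negPow_zero (A : H →ₗ.[ℂ] H) : negPow A 0 = 1 := by simp [negPow]

theorem IsInverseResol.negPow_eq (h : IsInverseResol A T ι) (hT : IsCoerciveOp T c) {θ : ℝ}
    (h0 : 0 < θ) (h1 : θ < 1) : negPow A θ = fracInt T ι θ := by
  have hf : Int.fract θ = θ := Int.fract_eq_self.2 ⟨h0.le, h1⟩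
  rw [negPow, Nat.floor_eq_zero.2 h1, pow_zero, one_mul, hf, if_neg h0.ne', fracInt]
  congr 1
  exact setIntegral_congr_fun measurableSet_Ioi fun s hs => by
    simp only [h.res_eq hT (le_of_lt (mem_Ioi.1 hs))]

theorem IsInverseResol.negPow_injective (h : IsInverseResol A T ι) (hT : IsCoerciveOp T c)
    (hι : DenseRange ι) {θ : ℝ} (h0 : 0 ≤ θ) (h1 : θ < 1) : Function.Injective (negPow A θ) := by
  rcases h0.eq_or_lt with rfl | h0
  · rw [negPow_zero]; exact Function.injective_id
  · rw [h.negPow_eq hT h0 h1]; exact fracInt_injective hT hι h0 h1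

theorem IsInverseResol.negPow_denseRange (h : IsInverseResol A T ι) (hT : IsCoerciveOp T c)
    (hι : DenseRange ι) {θ : ℝ} (h0 : 0 ≤ θ) (h1 : θ < 1) : DenseRange (negPow A θ) := by
  rcases h0.eq_or_lt with rfl | h0
  · rw [negPow_zero]; exact denseRange_id
  · rw [h.negPow_eq hT h0 h1]; exact fracInt_denseRange hT hι h0 h1

theorem IsInverseResol.negPow_adjoint (h : IsInverseResol A T ι) (hT : IsCoerciveOp T c)
    (hι : DenseRange ι) {θ : ℝ} (h0 : 0 ≤ θ) (h1 : θ < 1) :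
    (negPow A θ).adjoint = negPow A.adjoint θ := by
  rcases h0.eq_or_lt with rfl | h0
  · rw [negPow_zero, negPow_zero]; exact ContinuousLinearMap.adjoint_id
  · rw [h.negPow_eq hT h0 h1, (h.adjoint hT hι).negPow_eq hT.adjoint h0 h1, fracInt_adjoint hT h0 h1]

/-- `A ^ (-γ)` is an injective operator with dense range and injective adjoint `(A*) ^ (-γ)`. -/
structure HasNegPow (A : H →ₗ.[ℂ] H) (γ : ℝ) : Prop where
  nonneg : 0 ≤ γ
  injective : Function.Injective (negPow A γ)
  dense : DenseRange (negPow A γ)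
  injective_adjoint : Function.Injective (negPow A.adjoint γ)
  adjoint_eq : (negPow A γ).adjoint = negPow A.adjoint γ

theorem IsInverseResol.hasNegPow (h : IsInverseResol A T ι) (hT : IsCoerciveOp T c)
    (hι : DenseRange ι) {θ : ℝ} (h0 : 0 ≤ θ) (h1 : θ < 1) : HasNegPow A θ :=
  ⟨h0, h.negPow_injective hT hι h0 h1, h.negPow_denseRange hT hι h0 h1,
    (h.adjoint hT hι).negPow_injective hT.adjoint hι h0 h1, h.negPow_adjoint hT hι h0 h1⟩

end Identification

/-! ### The spaces H_α and H_{-γ} -/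

section PowerSpaces

variable {H : Type*} [NormedAddCommGroup H] [InnerProductSpace ℂ H] [CompleteSpace H]
  {A : H →ₗ.[ℂ] H} {α γ : ℝ}

theorem mem_graph_fracPow_neg (h0 : 0 ≤ γ) {x y : H} :
    (x, y) ∈ (fracPow A (-γ)).graph ↔ negPow A γ x = y := by
  rw [fracPow, if_pos (by linarith), neg_neg, LinearPMap.mem_graph_iff]
  constructor
  · rintro ⟨z, rfl, rfl⟩
    rfl
  · rintro rfl
    exact ⟨⟨x, trivial⟩, rfl, rfl⟩

theorem mem_graph_fracPow (h0 : 0 ≤ α) (hinj : Function.Injective (negPow A α)) {x y : H} :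
    (x, y) ∈ (fracPow A α).graph ↔ negPow A α y = x := by
  -- At α = 0 the definition of `fracPow` takes its branch α ≤ 0, where it is the identity on H and
  -- not an inverse.
  rcases h0.eq_or_lt with rfl | h0
  · have := mem_graph_fracPow_neg (A := A) (le_refl (0 : ℝ)) (x := x) (y := y)
    rw [neg_zero] at this
    rw [this, negPow_zero]
    exact eq_comm
  · rw [fracPow, if_neg (not_le.2 h0), LinearPMap.inverse_graph]
    · simp only [Submodule.mem_map, LinearPMap.mem_graph_iff, Prod.exists]
      constructor
      · rintro ⟨a, b, ⟨z, hz, hz'⟩, hab⟩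
        have h1 : b = x := congrArg Prod.fst hab
        have h2 : a = y := congrArg Prod.snd hab
        rw [← h1, ← h2, ← hz', ← hz]
        rfl
      · rintro rfl
        exact ⟨y, _, ⟨⟨y, trivial⟩, rfl, rfl⟩, rfl⟩
    · rw [LinearMap.ker_eq_bot]
      intro a b hab
      exact Subtype.ext (hinj hab)

theorem PowDom.mem_graph (u : PowDom A α) :
    (PowDom.val A α u, PowDom.pow A α u) ∈ (fracPow A α).graph :=
  LinearPMap.mem_graph _ _

theorem PowDom.exists_of_mem_graph {x y : H} (h : (x, y) ∈ (fracPow A α).graph) :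
    ∃ u : PowDom A α, PowDom.val A α u = x ∧ PowDom.pow A α u = y := by
  obtain ⟨u, hu, hu'⟩ := (LinearPMap.mem_graph_iff _).1 h
  exact ⟨u, hu, hu'⟩

theorem PowDom.norm_eq (u : PowDom A α) : ‖u‖ = ‖PowDom.pow A α u‖ := rfl

theorem negPow_pow (h0 : 0 ≤ α) (hinj : Function.Injective (negPow A α)) (u : PowDom A α) :
    negPow A α (PowDom.pow A α u) = PowDom.val A α u :=
  (mem_graph_fracPow h0 hinj).1 u.mem_graph

theorem pow_neg_apply (h0 : 0 ≤ γ) (u : PowDom A (-γ)) :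
    PowDom.pow A (-γ) u = negPow A γ (PowDom.val A (-γ) u) :=
  ((mem_graph_fracPow_neg h0).1 u.mem_graph).symm

/-- The continuous map `A ^ α : D(A ^ α) → H`. -/
noncomputable def PowDom.powL (A : H →ₗ.[ℂ] H) (α : ℝ) : PowDom A α →L[ℂ] H :=
  (PowDom.pow A α).mkContinuous 1 fun u => by rw [one_mul]; exact le_rfl

/-- The isometry `A ^ (-γ) : H_{-γ} → H`. -/
noncomputable def extrapPow (A : H →ₗ.[ℂ] H) (γ : ℝ) : Extrap A γ →L[ℂ] H :=
  (PowDom.powL A (-γ)).extend UniformSpace.Completion.toComplL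

theorem extrapPow_coe (h : PowDom A (-γ)) :
    extrapPow A γ (h : Extrap A γ) = PowDom.pow A (-γ) h :=
  ContinuousLinearMap.extend_eq _ UniformSpace.Completion.denseRange_coe
    (UniformSpace.Completion.isUniformInducing_coe _) h

theorem norm_extrapPow (F : Extrap A γ) : ‖extrapPow A γ F‖ = ‖F‖ := by
  induction F using UniformSpace.Completion.induction_on with
  | hp => exact isClosed_eq (by fun_prop) (by fun_prop)
  | ih h => rw [extrapPow_coe, UniformSpace.Completion.norm_coe, PowDom.norm_eq]

theorem extrapPow_injective : Function.Injective (extrapPow A γ) := by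
  rw [injective_iff_map_eq_zero]
  intro F hF
  rw [← norm_eq_zero, ← norm_extrapPow, hF, norm_zero]

/-- The isometric image of a complete space is closed, and it contains the dense range of A^(-γ).
Hence H_{-γ} is H, seen through A^(-γ). -/
theorem extrapPow_surjective (hN : HasNegPow A γ) : Function.Surjective (extrapPow A γ) := by
  have hiso : Isometry (extrapPow A γ) := AddMonoidHomClass.isometry_of_norm _ norm_extrapPow
  have hd : DenseRange (extrapPow A γ) := by
    refine hN.dense.mono ?_
    rintro _ ⟨x, rfl⟩
    obtain ⟨u, hu, hu'⟩ := PowDom.exists_of_mem_graph ((mem_graph_fracPow_neg hN.nonneg).2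
      (rfl : negPow A γ x = negPow A γ x))
    exact ⟨(u : Extrap A γ), by rw [extrapPow_coe, hu']⟩
  rw [← range_eq_univ, ← hiso.isClosedEmbedding.isClosed_range.closure_eq, hd.closure_eq]

/-- For h in H, (h, (A*)^(-γ) ψ) = (A^(-γ) h, ψ), and the right side is continuous in the norm of
H_{-γ}. The limit is unique because H is dense in its completion. -/
theorem pairsTo_iff (hN : HasNegPow A γ) (F : Extrap A γ) (ψ : H) (z : ℂ) :
    PairsTo γ F (negPow A.adjoint γ ψ) z ↔ z = inner ℂ ψ (extrapPow A γ F) := by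
  have h1 : PairsTo γ F (negPow A.adjoint γ ψ) (inner ℂ ψ (extrapPow A γ F)) := by
    have h2 : Tendsto (fun F : Extrap A γ => inner ℂ ψ (extrapPow A γ F)) (𝓝 F)
        (𝓝 (inner ℂ ψ (extrapPow A γ F))) := by
      have : Continuous fun F : Extrap A γ => inner ℂ ψ (extrapPow A γ F) := by fun_prop
      exact this.tendsto F
    refine (h2.comp tendsto_comap).congr fun h => ?_
    simp only [Function.comp_apply]
    rw [extrapPow_coe, pow_neg_apply hN.nonneg, ← hN.adjoint_eq,
      ContinuousLinearMap.adjoint_inner_left]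
  constructor
  · intro h
    have : (comap (fun h : PowDom A (-γ) => (h : Extrap A γ)) (𝓝 F)).NeBot :=
      UniformSpace.Completion.isDenseInducing_coe.comap_nhds_neBot F
    exact tendsto_nhds_unique h h1
  · rintro rfl
    exact h1

end PowerSpaces

/-! ### Functions as elements of H_{-γ} -/

section Representation

variable {d n : ℕ} {Ω : Set (EuclideanSpace ℝ (Fin d))} {A : L2 Ω n →ₗ.[ℂ] L2 Ω n} {γ : ℝ}

theorem represents_iff (hN : HasNegPow A γ) {v : EuclideanSpace ℝ (Fin d) → Cn n}
    {F : Extrap A γ} : Represents γ v F ↔ ∀ ψ : L2 Ω n,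
      Integrable (fun x => inner ℂ (negPow A.adjoint γ ψ x) (v x)) (volume.restrict Ω) ∧
        ∫ x in Ω, inner ℂ (negPow A.adjoint γ ψ x) (v x) = inner ℂ ψ (extrapPow A γ F) := by
  have hd : ∀ φ : L2 Ω n, φ ∈ (fracPow A.adjoint γ).domain ↔ ∃ ψ, negPow A.adjoint γ ψ = φ := by
    intro φ
    rw [LinearPMap.mem_domain_iff]
    exact exists_congr fun ψ => mem_graph_fracPow hN.nonneg hN.injective_adjoint
  constructor
  · intro h ψ
    obtain ⟨h1, h2⟩ := h _ ((hd _).2 ⟨ψ, rfl⟩)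
    exact ⟨h1, (pairsTo_iff hN F ψ _).1 h2⟩
  · rintro h φ hφ
    obtain ⟨ψ, rfl⟩ := (hd _).1 hφ
    exact ⟨(h ψ).1, (pairsTo_iff hN F ψ _).2 (h ψ).2⟩

theorem Represents.unique (hN : HasNegPow A γ) {v : EuclideanSpace ℝ (Fin d) → Cn n}
    {F G : Extrap A γ} (hF : Represents γ v F) (hG : Represents γ v G) : F = G :=
  extrapPow_injective <| ext_inner_left ℂ fun ψ => by
    rw [← ((represents_iff hN).1 hF ψ).2, ((represents_iff hN).1 hG ψ).2]

theorem Represents.sub (hN : HasNegPow A γ) {v w : EuclideanSpace ℝ (Fin d) → Cn n}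
    {F G : Extrap A γ} (hF : Represents γ v F) (hG : Represents γ w G) :
    Represents γ (fun x => v x - w x) (F - G) := by
  rw [represents_iff hN] at *
  intro ψ
  simp only [inner_sub_right, map_sub]
  exact ⟨(hF ψ).1.sub (hG ψ).1, by rw [integral_sub (hF ψ).1 (hG ψ).1, (hF ψ).2, (hG ψ).2]⟩

theorem Represents.add (hN : HasNegPow A γ) {v w : EuclideanSpace ℝ (Fin d) → Cn n}
    {F G : Extrap A γ} (hF : Represents γ v F) (hG : Represents γ w G) :
    Represents γ (fun x => v x + w x) (F + G) := by
  rw [represents_iff hN] at *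
  intro ψ
  simp only [inner_add_right, map_add]
  exact ⟨(hF ψ).1.add (hG ψ).1, by rw [integral_add (hF ψ).1 (hG ψ).1, (hF ψ).2, (hG ψ).2]⟩

theorem Represents.smul (hN : HasNegPow A γ) {v : EuclideanSpace ℝ (Fin d) → Cn n}
    {F : Extrap A γ} (z : ℂ) (hF : Represents γ v F) :
    Represents γ (fun x => z • v x) (z • F) := by
  rw [represents_iff hN] at *
  intro ψ
  simp only [inner_smul_right, map_smul]
  exact ⟨(hF ψ).1.const_mul z, by rw [integral_const_mul, (hF ψ).2]⟩

theorem Represents.congr {v w : EuclideanSpace ℝ (Fin d) → Cn n} {F : Extrap A γ}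
    (hF : Represents γ v F) (hvw : v =ᵐ[volume.restrict Ω] w) : Represents γ w F := by
  intro φ hφ
  have h : (fun x => inner ℂ (φ x) (v x)) =ᵐ[volume.restrict Ω] fun x => inner ℂ (φ x) (w x) := by
    filter_upwards [hvw] with x hx
    rw [hx]
  rw [← integral_congr_ae h]
  exact ⟨(hF φ hφ).1.congr h, (hF φ hφ).2⟩

/-- Riesz: the conjugated pairing is linear and bounded in ψ, so it is given by a vector of L_2, and
this vector is A^(-γ) F for some F by surjectivity of `extrapPow`. -/
theorem exists_represents (hN : HasNegPow A γ) {v : EuclideanSpace ℝ (Fin d) → Cn n} {K : ℝ}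
    (hi : ∀ ψ : L2 Ω n,
      Integrable (fun x => inner ℂ (negPow A.adjoint γ ψ x) (v x)) (volume.restrict Ω))
    (hK : ∀ ψ : L2 Ω n, ‖∫ x in Ω, inner ℂ (negPow A.adjoint γ ψ x) (v x)‖ ≤ K * ‖ψ‖) :
    ∃ F : Extrap A γ, Represents γ v F := by
  have hc : ∀ ψ : L2 Ω n, ∫ x in Ω, inner ℂ (v x) (negPow A.adjoint γ ψ x) =
      starRingEnd ℂ (∫ x in Ω, inner ℂ (negPow A.adjoint γ ψ x) (v x)) := fun ψ => by
    rw [← integral_conj]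
    simp only [inner_conj_symm]
  have hi' : ∀ ψ : L2 Ω n,
      Integrable (fun x => inner ℂ (v x) (negPow A.adjoint γ ψ x)) (volume.restrict Ω) := by
    intro ψ
    have h1 : Integrable (fun x => starRingEnd ℂ (inner ℂ (negPow A.adjoint γ ψ x) (v x)))
      (volume.restrict Ω) := Complex.conjCLE.toContinuousLinearMap.integrable_comp (hi ψ)
    simpa only [inner_conj_symm] using h1
  let ℓ : L2 Ω n →ₗ[ℂ] ℂ :=
    { toFun := fun ψ => ∫ x in Ω, inner ℂ (v x) (negPow A.adjoint γ ψ x)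
      map_add' := fun ψ χ => by
        rw [← integral_add (hi' ψ) (hi' χ)]
        refine integral_congr_ae ?_
        rw [map_add]
        filter_upwards [Lp.coeFn_add (negPow A.adjoint γ ψ) (negPow A.adjoint γ χ)] with x hx
        rw [hx, Pi.add_apply, inner_add_right]
      map_smul' := fun z ψ => by
        rw [RingHom.id_apply, smul_eq_mul, ← integral_const_mul]
        refine integral_congr_ae ?_
        rw [map_smul]
        filter_upwards [Lp.coeFn_smul z (negPow A.adjoint γ ψ)] with x hx
        rw [hx, Pi.smul_apply, inner_smul_right] }
  let L : L2 Ω n →L[ℂ] ℂ := ℓ.mkContinuous K fun ψ => by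
    change ‖∫ x in Ω, inner ℂ (v x) (negPow A.adjoint γ ψ x)‖ ≤ _
    rw [hc, RCLike.norm_conj]
    exact hK ψ
  obtain ⟨F, hF⟩ := extrapPow_surjective hN ((InnerProductSpace.toDual ℂ (L2 Ω n)).symm L)
  refine ⟨F, (represents_iff hN).2 fun ψ => ⟨hi ψ, ?_⟩⟩
  rw [hF, ← inner_conj_symm, InnerProductSpace.toDual_symm_apply]
  change _ = starRingEnd ℂ (∫ x in Ω, inner ℂ (v x) (negPow A.adjoint γ ψ x))
  rw [hc, Complex.conj_conj]

theorem Represents.norm_le (hN : HasNegPow A γ) {v : EuclideanSpace ℝ (Fin d) → Cn n} {K : ℝ}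
    (hK0 : 0 ≤ K) {F : Extrap A γ} (hF : Represents γ v F)
    (hK : ∀ ψ : L2 Ω n, ‖∫ x in Ω, inner ℂ (negPow A.adjoint γ ψ x) (v x)‖ ≤ K * ‖ψ‖) :
    ‖F‖ ≤ K := by
  rw [← norm_extrapPow]
  -- Testing with ψ = A^(-γ) F makes the pairing equal to ‖F‖².
  have h1 := hK (extrapPow A γ F)
  rw [((represents_iff hN).1 hF _).2] at h1
  rcases (norm_nonneg (extrapPow A γ F)).eq_or_lt with h0 | h0
  · rwa [← h0]
  · rw [inner_self_eq_norm_sq_to_K] at h1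
    have h2 : ‖(((‖extrapPow A γ F‖ : ℝ) : ℂ)) ^ 2‖ = ‖extrapPow A γ F‖ * ‖extrapPow A γ F‖ := by
      rw [norm_pow, Complex.norm_real, norm_norm, sq]
    exact le_of_mul_le_mul_right (h2 ▸ h1) h0

end Representation

/-! ### Integral formulas for A^(-γ) suited to interpolation -/

section Representations

variable {H : Type*} [NormedAddCommGroup H] [InnerProductSpace ℂ H] [CompleteSpace H]
  {V : Type*} [NormedAddCommGroup V] [InnerProductSpace ℂ V] [CompleteSpace V]
  {T : V →L[ℂ] V} {ι : V →L[ℂ] H} {c : ℝ}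

theorem integral_resol_sq_apply (hT : IsCoerciveOp T c) {γ : ℝ} (h0 : 0 < γ) (h1 : γ < 1)
    (ψ : H) :
    ∫ s in Ioi (0 : ℝ), ((s ^ (1 - γ) : ℝ) : ℂ) • resol T ι s (resol T ι s ψ) =
      ((1 - γ : ℝ) : ℂ) • ∫ s in Ioi (0 : ℝ), ((s ^ (-γ) : ℝ) : ℂ) • resol T ι s ψ := by
  obtain ⟨hi2, h2⟩ := integral_resol_sq (ι := ι) hT h0 h1
  have h3 : (∫ s in Ioi (0 : ℝ), ((s ^ (1 - γ) : ℝ) : ℂ) • (resol T ι s * resol T ι s)) ψ =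
      ((1 - γ : ℝ) : ℂ) • (∫ s in Ioi (0 : ℝ), ((s ^ (-γ) : ℝ) : ℂ) • resol T ι s) ψ := by
    rw [h2]; rfl
  rw [ContinuousLinearMap.integral_apply (integrableOn_resol hT h0 h1)] at h3
  exact (ContinuousLinearMap.integral_apply hi2 ψ).symm.trans h3

/-- The integrand R_s ψ is exchanged for A R_s² ψ = R_s ψ - s R_s² ψ. By parts, this multiplies the
integral by 1 - (1 - γ) = γ, whence the division by γ. The second resolvent now acts on a vector of
V, where it gains powers of s. -/
theorem fracInt_eq_integral_sub (hT : IsCoerciveOp T c) {γ : ℝ} (h0 : 0 < γ) (h1 : γ < 1)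
    (ψ : H) :
    IntegrableOn (fun s : ℝ => ((s ^ (-γ) : ℝ) : ℂ) •
      (resol T ι s ψ - (s : ℂ) • resol T ι s (resol T ι s ψ))) (Ioi 0) ∧
    fracInt T ι γ ψ = ((Real.sin (Real.pi * γ) / Real.pi / γ : ℝ) : ℂ) • ∫ s in Ioi (0 : ℝ),
      ((s ^ (-γ) : ℝ) : ℂ) • (resol T ι s ψ - (s : ℂ) • resol T ι s (resol T ι s ψ)) := by
  obtain ⟨hi2, h2⟩ := integral_resol_sq (ι := ι) hT h0 h1
  have hi : Integrable (fun s : ℝ => ((s ^ (-γ) : ℝ) : ℂ) • resol T ι s ψ)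
    (volume.restrict (Ioi 0)) := integrableOn_resol_apply hT h0 h1 ψ
  have hi2' : Integrable (fun s : ℝ => ((s ^ (1 - γ) : ℝ) : ℂ) • resol T ι s (resol T ι s ψ))
    (volume.restrict (Ioi 0)) := hi2.apply_continuousLinearMap ψ
  have e : ∀ s ∈ Ioi (0 : ℝ), ((s ^ (-γ) : ℝ) : ℂ) • resol T ι s ψ -
      ((s ^ (1 - γ) : ℝ) : ℂ) • resol T ι s (resol T ι s ψ) = ((s ^ (-γ) : ℝ) : ℂ) •
        (resol T ι s ψ - (s : ℂ) • resol T ι s (resol T ι s ψ)) := by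
    intro s hs
    rw [smul_sub, smul_smul, ← Complex.ofReal_mul, ← Real.rpow_add_one (ne_of_gt hs)]
    ring_nf
  refine ⟨(IntegrableOn.congr_fun (hi.sub hi2') e measurableSet_Ioi), ?_⟩
  rw [← setIntegral_congr_fun measurableSet_Ioi e, integral_sub hi hi2', fracInt_apply hT h0 h1]
  rw [integral_resol_sq_apply hT h0 h1]
  set I := ∫ s in Ioi (0 : ℝ), ((s ^ (-γ) : ℝ) : ℂ) • resol T ι s ψ
  have h5 : I - ((1 - γ : ℝ) : ℂ) • I = (γ : ℂ) • I := by
    push_cast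
    module
  rw [h5, smul_smul, ← Complex.ofReal_mul, div_mul_cancel₀ _ h0.ne']

/-- The companion formula with R_s² ψ, for γ > 1/2: here the gain sought is one into D(A), obtained
again by letting the second resolvent act on V. -/
theorem fracInt_eq_integral_sq (hT : IsCoerciveOp T c) {γ : ℝ} (h0 : 0 < γ) (h1 : γ < 1)
    (ψ : H) :
    IntegrableOn (fun s : ℝ => ((s ^ (1 - γ) : ℝ) : ℂ) • resol T ι s (resol T ι s ψ)) (Ioi 0) ∧
    fracInt T ι γ ψ = ((Real.sin (Real.pi * γ) / Real.pi / (1 - γ) : ℝ) : ℂ) •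
      ∫ s in Ioi (0 : ℝ), ((s ^ (1 - γ) : ℝ) : ℂ) • resol T ι s (resol T ι s ψ) := by
  obtain ⟨hi2, h2⟩ := integral_resol_sq (ι := ι) hT h0 h1
  refine ⟨hi2.apply_continuousLinearMap ψ, ?_⟩
  have h5 : (1 - γ) ≠ 0 := by linarith
  rw [fracInt_apply hT h0 h1, integral_resol_sq_apply hT h0 h1, smul_smul, ← Complex.ofReal_mul, div_mul_cancel₀ _ h5]

end Representations

/-! ### Sharp embeddings of the ranges of fractional powers -/

section Embeddings

variable {X : Type*} [MeasurableSpace X] {μ : Measure X} {E : Type*} [NormedAddCommGroup E]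
  [InnerProductSpace ℂ E] [CompleteSpace E]

theorem eLpNorm_coe_smul (z : ℂ) (f : Lp E 2 μ) (p : ℝ≥0∞) :
    eLpNorm (z • f : Lp E 2 μ) p μ = ‖z‖ₑ * eLpNorm f p μ := by
  rw [eLpNorm_congr_ae (Lp.coeFn_smul z f), eLpNorm_const_smul]

theorem exists_eLpNorm_le_of_integral_scaled [IsFiniteMeasure μ] {p₀ p₁ q β : ℝ}
    (hp₀ : 2 ≤ p₀) (hp : p₀ < p₁) (hβ0 : 0 < β) (hβ1 : β < 1 / 2)
    (hq : 1 / q = (1 - 2 * β) / p₀ + 2 * β / p₁) :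
    ∃ K : ℝ, 0 ≤ K ∧ ∀ (φ : Lp E 2 μ) (Φ : ℝ → Lp E 2 μ) (b : ℝ → ℝ) (D : ℝ), 0 < D →
      IntegrableOn Φ (Ioi 0) → φ = ∫ s in Ioi 0, Φ s → (∀ s, 0 ≤ b s) →
      IntegrableOn (fun s => b s ^ 2) (Ioi 0) → ∫ s in Ioi 0, b s ^ 2 ≤ D ^ 2 →
      (∀ s, 0 < s → eLpNorm (Φ s) (ENNReal.ofReal p₀) μ ≤
        ENNReal.ofReal (s ^ (-β - 1 / 2) * b s)) →
      (∀ s, 0 < s → eLpNorm (Φ s) (ENNReal.ofReal p₁) μ ≤ ENNReal.ofReal (s ^ (-β) * b s)) →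
      eLpNorm φ (ENNReal.ofReal q) μ ≤ ENNReal.ofReal (K * D) := by
  obtain ⟨K, hK, h⟩ := exists_eLpNorm_le_of_integral (μ := μ) (E := E) hp₀ hp hβ0 hβ1 hq
  refine ⟨K, hK, fun φ Φ b D hD hΦ hφ hb hbi hbD h0 h1 => ?_⟩
  have hDe : ‖((D⁻¹ : ℝ) : ℂ)‖ₑ = ENNReal.ofReal D⁻¹ := by
    rw [← ofReal_norm, Complex.norm_real, Real.norm_of_nonneg (by positivity)]
  have key := h (((D⁻¹ : ℝ) : ℂ) • φ) (fun s => ((D⁻¹ : ℝ) : ℂ) • Φ s)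
    (fun s => ENNReal.ofReal (D⁻¹ * b s)) (hΦ.smul ((D⁻¹ : ℝ) : ℂ))
    (by rw [integral_smul, hφ]) ?_ ?_ ?_ ?_
  · rw [eLpNorm_coe_smul, hDe, ENNReal.ofReal_inv_of_pos hD, ← ENNReal.div_eq_inv_mul] at key
    rw [ENNReal.ofReal_mul hK]
    exact (ENNReal.div_le_iff_le_mul (Or.inl (by simpa using hD)) (Or.inl ENNReal.ofReal_ne_top)).1 key
  · have h2 : AEMeasurable (fun s => √(b s ^ 2)) (volume.restrict (Ioi 0)) :=
      hbi.aestronglyMeasurable.aemeasurable.sqrt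
    simp only [Real.sqrt_sq (hb _)] at h2
    exact (h2.const_mul _).ennreal_ofReal
  · calc ∫⁻ s in Ioi 0, ENNReal.ofReal (D⁻¹ * b s) ^ 2
        = ∫⁻ s in Ioi 0, ENNReal.ofReal (D⁻¹ ^ 2 * b s ^ 2) := by
          refine lintegral_congr fun s => ?_
          rw [← ENNReal.ofReal_pow (by have := hb s; positivity), mul_pow]
      _ = ENNReal.ofReal (∫ s in Ioi 0, D⁻¹ ^ 2 * b s ^ 2) :=
          (ofReal_integral_eq_lintegral_ofReal (hbi.const_mul _)
            (ae_of_all _ fun s => by positivity)).symm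
      _ ≤ ENNReal.ofReal 1 := by
          refine ENNReal.ofReal_le_ofReal ?_
          rw [integral_const_mul, inv_pow, inv_mul_eq_div, div_le_one (by positivity)]
          exact hbD
      _ = 1 := ENNReal.ofReal_one
  · intro s hs
    rw [eLpNorm_coe_smul, hDe, ENNReal.ofReal_mul (by positivity), mul_left_comm]
    refine mul_le_mul_right ?_ _
    rw [← ENNReal.ofReal_mul (by positivity)]
    exact h0 s hs
  · intro s hs
    rw [eLpNorm_coe_smul, hDe, ENNReal.ofReal_mul (by positivity), mul_left_comm]
    refine mul_le_mul_right ?_ _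
    rw [← ENNReal.ofReal_mul (by positivity)]
    exact h1 s hs

/-- The bounded operator `N` on `L_2` is bounded from `L_2` into `L_q`. -/
def MapsIntoLp (N : Lp E 2 μ →L[ℂ] Lp E 2 μ) (q : ℝ≥0∞) : Prop :=
  ∃ C : ℝ, 0 ≤ C ∧ ∀ ψ, eLpNorm (N ψ) q μ ≤ ENNReal.ofReal (C * ‖ψ‖)

variable {V : Type*} [NormedAddCommGroup V] [InnerProductSpace ℂ V] [CompleteSpace V]
  {T : V →L[ℂ] V} {ι : V →L[ℂ] Lp E 2 μ} {c : ℝ}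

theorem mapsIntoLp_of_factor {N : Lp E 2 μ →L[ℂ] Lp E 2 μ} {q : ℝ≥0∞} {C : ℝ}
    (hC : ∀ v, eLpNorm (ι v) q μ ≤ ENNReal.ofReal (C * ‖v‖)) (W : Lp E 2 μ →L[ℂ] V)
    (hW : ∀ ψ, ι (W ψ) = N ψ) : MapsIntoLp N q := by
  refine ⟨|C| * ‖W‖, by positivity, fun ψ => ?_⟩
  rw [← hW, mul_assoc]
  refine (hC _).trans (ENNReal.ofReal_le_ofReal ?_)
  exact mul_le_mul (le_abs_self C) (W.le_opNorm ψ) (norm_nonneg _) (abs_nonneg _)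

theorem mapsIntoLp_one : MapsIntoLp (1 : Lp E 2 μ →L[ℂ] Lp E 2 μ) 2 := by
  refine ⟨1, zero_le_one, fun ψ => ?_⟩
  rw [one_mul, Lp.norm_def, ENNReal.ofReal_toReal (Lp.eLpNorm_ne_top ψ)]
  exact le_rfl

/-- The reduction of an interpolated embedding of the range of `A ^ (-γ)` to a representation of
`A ^ (-γ) ψ` as an integral controlled by the quadratic estimate. -/
theorem mapsIntoLp_of_integral [IsFiniteMeasure μ] (hT : IsCoerciveOp T c) {p₀ p₁ q β M : ℝ}
    (hp₀ : 2 ≤ p₀) (hp : p₀ < p₁) (hβ0 : 0 < β) (hβ1 : β < 1 / 2)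
    (hq : 1 / q = (1 - 2 * β) / p₀ + 2 * β / p₁) (hM : 0 < M) {N : Lp E 2 μ →L[ℂ] Lp E 2 μ}
    {Φ : Lp E 2 μ → ℝ → Lp E 2 μ} (hi : ∀ ψ, IntegrableOn (Φ ψ) (Ioi 0))
    (hN : ∀ ψ, N ψ = ∫ s in Ioi 0, Φ ψ s)
    (h0 : ∀ ψ s, 0 < s → eLpNorm (Φ ψ s) (ENNReal.ofReal p₀) μ ≤
        ENNReal.ofReal (s ^ (-β - 1 / 2) * (M * ‖solve T ι s ψ‖)))
    (h1 : ∀ ψ s, 0 < s → eLpNorm (Φ ψ s) (ENNReal.ofReal p₁) μ ≤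
        ENNReal.ofReal (s ^ (-β) * (M * ‖solve T ι s ψ‖))) :
    MapsIntoLp N (ENNReal.ofReal q) := by
  obtain ⟨K, hK, h⟩ := exists_eLpNorm_le_of_integral_scaled (μ := μ) (E := E) hp₀ hp hβ0 hβ1 hq
  have hc := hT.pos
  -- The summand 1 keeps Q positive even if T = 0, so that the scale D of the interpolation lemma is
  -- positive.
  set Q := 4 * (‖T‖ ^ 3 / c ^ 2) / c ^ 2 + 1 with hQ
  have hQ0 : 0 < Q := by positivity
  refine ⟨K * (M * √Q), by positivity, fun ψ => ?_⟩
  rcases eq_or_ne ψ 0 with rfl | hψ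
  · rw [map_zero, eLpNorm_congr_ae (Lp.coeFn_zero E 2 μ), eLpNorm_zero]
    exact zero_le
  have hψ0 : 0 < ‖ψ‖ := norm_pos_iff.2 hψ
  obtain ⟨hqi, hqe⟩ := quadratic_estimate (ι := ι) hT ψ
  have := h (N ψ) (Φ ψ) (fun s => M * ‖solve T ι s ψ‖) (M * √Q * ‖ψ‖) (by positivity) (hi ψ) (hN ψ)
    (fun s => by positivity) ?_ ?_ (h0 ψ) (h1 ψ)
  · rwa [← mul_assoc] at this
  · simp only [mul_pow]
    exact hqi.const_mul _
  · simp only [mul_pow]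
    rw [integral_const_mul, Real.sq_sqrt hQ0.le, mul_assoc]
    refine mul_le_mul_of_nonneg_left (hqe.trans ?_) (by positivity)
    refine mul_le_mul_of_nonneg_right ?_ (by positivity)
    rw [hQ]; linarith

theorem norm_sub_resol_le (hT : IsCoerciveOp T c) {s : ℝ} (hs : 0 < s) (x : V) :
    ‖ι x - (s : ℂ) • resol T ι s (ι x)‖ ≤ ‖T‖ / √c * (s ^ (-(1 / 2) : ℝ) * ‖x‖) := by
  have hc := hT.pos
  have h := Real.sqrt_le_sqrt (norm_sub_resol_sq_le (ι := ι) hT hs x)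
  rw [Real.sqrt_sq (norm_nonneg _), Real.sqrt_mul (by positivity), Real.sqrt_sq (norm_nonneg _),
    Real.sqrt_div (by positivity), Real.sqrt_div (by positivity), Real.sqrt_sq (norm_nonneg _)] at h
  rwa [Real.rpow_neg hs.le, ← Real.sqrt_eq_rpow, ← mul_assoc, ← div_eq_mul_inv]

theorem eLpNorm_weight_smul {p : ℝ≥0∞} {f : Lp E 2 μ} {B κ w : ℝ} (hκ : 0 ≤ κ) (hw : 0 ≤ w)
    (hf : eLpNorm f p μ ≤ ENNReal.ofReal B) :
    eLpNorm ((κ : ℂ) • ((w : ℂ) • f) : Lp E 2 μ) p μ ≤ ENNReal.ofReal (κ * (w * B)) := by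
  rw [eLpNorm_coe_smul, eLpNorm_coe_smul, ENNReal.ofReal_mul hκ, ENNReal.ofReal_mul hw,
    ← ofReal_norm, ← ofReal_norm, Complex.norm_real, Complex.norm_real,
    Real.norm_of_nonneg hκ, Real.norm_of_nonneg hw]
  gcongr

/-- With x = (s + A)^(-1) ψ in V, the integrand A (s + A)^(-1) x is at most s^(-1/2) ‖x‖ in L_2 and
at most ‖x‖ in V, up to constants. These are the endpoint bounds for β = γ, and the quadratic
estimate makes ‖x‖ square integrable in s. -/
theorem fracInt_mapsIntoLp_of_lt_half [IsFiniteMeasure μ] (hT : IsCoerciveOp T c) {ps q γ C : ℝ}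
    (hps : 2 < ps) (h0 : 0 < γ) (h1 : γ < 1 / 2) (hq : 1 / q = (1 - 2 * γ) / 2 + 2 * γ / ps)
    (hC : ∀ v, eLpNorm (ι v) (ENNReal.ofReal ps) μ ≤ ENNReal.ofReal (C * ‖v‖)) :
    MapsIntoLp (fracInt T ι γ) (ENNReal.ofReal q) := by
  have hc := hT.pos
  have hs0 := sin_div_pi_pos h0 (by linarith : γ < 1)
  set κ := Real.sin (Real.pi * γ) / Real.pi / γ with hκ
  have hκ0 : 0 < κ := by positivity
  set M₀ := κ * (‖T‖ / √c) with hM₀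
  set M₁ := κ * (|C| * (1 + ‖T‖ / c)) with hM₁
  have hM₀0 : 0 ≤ M₀ := by positivity
  have hM₁0 : 0 ≤ M₁ := by positivity
  refine mapsIntoLp_of_integral (ι := ι) (M := M₀ + M₁ + 1) hT le_rfl hps h0 h1 hq (by positivity)
    (Φ := fun ψ s => (κ : ℂ) • (((s ^ (-γ) : ℝ) : ℂ) •
      (resol T ι s ψ - (s : ℂ) • resol T ι s (resol T ι s ψ)))) ?_ ?_ ?_ ?_
  · intro ψ
    exact (fracInt_eq_integral_sub hT h0 (by linarith) ψ).1.smul (κ : ℂ)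
  · intro ψ
    rw [integral_smul]
    exact (fracInt_eq_integral_sub hT h0 (by linarith) ψ).2
  · intro ψ s hs
    set x := solve T ι s ψ with hx
    have hb : eLpNorm (resol T ι s ψ - (s : ℂ) • resol T ι s (resol T ι s ψ) : Lp E 2 μ)
        (ENNReal.ofReal 2) μ ≤ ENNReal.ofReal (‖T‖ / √c * (s ^ (-(1 / 2) : ℝ) * ‖x‖)) := by
      rw [ENNReal.ofReal_ofNat, ← ENNReal.ofReal_toReal (Lp.eLpNorm_ne_top _), ← Lp.norm_def]
      exact ENNReal.ofReal_le_ofReal (norm_sub_resol_le hT hs x)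
    refine (eLpNorm_weight_smul hκ0.le (Real.rpow_nonneg hs.le _) hb).trans
      (ENNReal.ofReal_le_ofReal ?_)
    rw [sub_eq_add_neg (-γ), Real.rpow_add hs]
    calc _ = s ^ (-γ) * s ^ (-(1 / 2) : ℝ) * (M₀ * ‖x‖) := by rw [hM₀]; ring
      _ ≤ _ := by gcongr; linarith
  · intro ψ s hs
    set x := solve T ι s ψ with hx
    have hb : eLpNorm (resol T ι s ψ - (s : ℂ) • resol T ι s (resol T ι s ψ) : Lp E 2 μ)
        (ENNReal.ofReal ps) μ ≤ ENNReal.ofReal (|C| * ((1 + ‖T‖ / c) * ‖x‖)) := by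
      have e : resol T ι s ψ - (s : ℂ) • resol T ι s (resol T ι s ψ) =
          ι (x - (s : ℂ) • solve T ι s (ι x)) := by
        rw [map_sub, map_smul]; rfl
      rw [e]
      refine (hC _).trans (ENNReal.ofReal_le_ofReal ?_)
      exact mul_le_mul (le_abs_self C) (norm_sub_solve_le hT hs x) (norm_nonneg _) (abs_nonneg _)
    refine (eLpNorm_weight_smul hκ0.le (Real.rpow_nonneg hs.le _) hb).trans
      (ENNReal.ofReal_le_ofReal ?_)
    calc _ = s ^ (-γ) * (M₁ * ‖x‖) := by rw [hM₁]; ring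
      _ ≤ _ := by gcongr; linarith

/-- The same scheme one half-step higher, β = γ - 1/2. Now (s + A)^(-1) x is of order ‖x‖/s in V ⊆
L_ps and, as A^(-1) of a vector of norm s^(-1/2) ‖x‖, of order s^(-1/2) ‖x‖ in L_p. -/
theorem fracInt_mapsIntoLp_of_half_lt [IsFiniteMeasure μ] (hT : IsCoerciveOp T c)
    {ps p q γ C C' : ℝ} (hps : 2 < ps) (hp : ps < p) (h0 : 1 / 2 < γ) (h1 : γ < 1)
    (hq : 1 / q = (2 - 2 * γ) / ps + (2 * γ - 1) / p)
    (hC : ∀ v, eLpNorm (ι v) (ENNReal.ofReal ps) μ ≤ ENNReal.ofReal (C * ‖v‖))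
    (hC' : ∀ w, eLpNorm (resol T ι 0 w) (ENNReal.ofReal p) μ ≤ ENNReal.ofReal (C' * ‖w‖)) :
    MapsIntoLp (fracInt T ι γ) (ENNReal.ofReal q) := by
  have hc := hT.pos
  have h0' : 0 < γ := by linarith
  have hs0 := sin_div_pi_pos h0' h1
  have h1' : 0 < 1 - γ := by linarith
  set κ := Real.sin (Real.pi * γ) / Real.pi / (1 - γ) with hκ
  have hκ0 : 0 < κ := by positivity
  set M₀ := κ * (|C| * (‖T‖ / c)) with hM₀
  set M₁ := κ * (|C'| * (‖T‖ / √c)) with hM₁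
  have hM₀0 : 0 ≤ M₀ := by positivity
  have hM₁0 : 0 ≤ M₁ := by positivity
  refine mapsIntoLp_of_integral (ι := ι) (M := M₀ + M₁ + 1) (β := γ - 1 / 2) hT hps.le hp
    (by linarith) (by linarith) (by rw [hq]; ring) (by positivity)
    (Φ := fun ψ s => (κ : ℂ) • (((s ^ (1 - γ) : ℝ) : ℂ) • resol T ι s (resol T ι s ψ))) ?_ ?_ ?_ ?_
  · intro ψ
    exact (fracInt_eq_integral_sq hT h0' h1 ψ).1.smul (κ : ℂ)
  · intro ψ
    rw [integral_smul]
    exact (fracInt_eq_integral_sq hT h0' h1 ψ).2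
  · intro ψ s hs
    set x := solve T ι s ψ with hx
    have hb : eLpNorm (resol T ι s (resol T ι s ψ) : Lp E 2 μ)
        (ENNReal.ofReal ps) μ ≤ ENNReal.ofReal (|C| * (‖T‖ / c / s * ‖x‖)) := by
      refine (hC (solve T ι s (ι x))).trans (ENNReal.ofReal_le_ofReal ?_)
      exact mul_le_mul (le_abs_self C) (norm_solve_embed_le hT hs x) (norm_nonneg _) (abs_nonneg _)
    refine (eLpNorm_weight_smul hκ0.le (Real.rpow_nonneg hs.le _) hb).trans
      (ENNReal.ofReal_le_ofReal ?_)
    have e : s ^ (-(γ - 1 / 2) - 1 / 2) = s ^ (1 - γ) / s := by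
      rw [← Real.rpow_sub_one hs.ne']; ring_nf
    rw [e]
    calc _ = s ^ (1 - γ) / s * (M₀ * ‖x‖) := by rw [hM₀]; ring
      _ ≤ _ := by gcongr; linarith
  · intro ψ s hs
    set x := solve T ι s ψ with hx
    have hb : eLpNorm (resol T ι s (resol T ι s ψ) : Lp E 2 μ)
        (ENNReal.ofReal p) μ ≤
          ENNReal.ofReal (|C'| * (‖T‖ / √c * (s ^ (-(1 / 2) : ℝ) * ‖x‖))) := by
      -- The identity (s + A)^(-1) = A^(-1)(1 - s (s + A)^(-1)) brings out A^(-1), the operator to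
      -- which `hC'` refers.
      have e : resol T ι s (resol T ι s ψ) = resol T ι 0 (ι x - (s : ℂ) • resol T ι s (ι x)) := by
        have h2 := congrArg (fun S : Lp E 2 μ →L[ℂ] Lp E 2 μ => S (ι x))
          (resol_zero_mul (ι := ι) hT hs.le)
        have h3 : (s : ℂ) • resol T ι 0 (resol T ι s (ι x)) =
          resol T ι 0 (ι x) - resol T ι s (ι x) := h2
        rw [map_sub, map_smul, h3, sub_sub_cancel]
        rfl
      rw [e]
      refine (hC' _).trans (ENNReal.ofReal_le_ofReal ?_)
      exact mul_le_mul (le_abs_self C') (norm_sub_resol_le hT hs x) (norm_nonneg _) (abs_nonneg _)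
    refine (eLpNorm_weight_smul hκ0.le (Real.rpow_nonneg hs.le _) hb).trans
      (ENNReal.ofReal_le_ofReal ?_)
    have e : s ^ (-(γ - 1 / 2)) = s ^ (1 - γ) * s ^ (-(1 / 2) : ℝ) := by
      rw [← Real.rpow_add hs]; ring_nf
    rw [e]
    calc _ = s ^ (1 - γ) * s ^ (-(1 / 2) : ℝ) * (M₁ * ‖x‖) := by rw [hM₁]; ring
      _ ≤ _ := by gcongr; linarith

end Embeddings

/-! ### Smallness of superposition operators -/

section Smallness

variable {X : Type*} [MeasurableSpace X] {μ : Measure X} {E F : Type*} [NormedAddCommGroup E]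
  [NormedAddCommGroup F]

theorem lintegral_norm_rpow_eq {m : ℝ} (hm : 0 < m) (f : X → E) :
    ∫⁻ x, ENNReal.ofReal (‖f x‖ ^ m) ∂μ = eLpNorm f (ENNReal.ofReal m) μ ^ m := by
  rw [eLpNorm_eq_lintegral_rpow_enorm_toReal (by simpa using hm) ENNReal.ofReal_ne_top,
    ENNReal.toReal_ofReal hm.le, ← ENNReal.rpow_mul, one_div_mul_cancel hm.ne', ENNReal.rpow_one]
  refine lintegral_congr fun x => ?_
  rw [← ofReal_norm, ENNReal.ofReal_rpow_of_nonneg (norm_nonneg _) hm.le]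

/-- Where y ≥ 2C, the growth bound gives y ≤ 2C |u|^(m/k). Hence y^k ≤ min(y, 2C)^k + (2C)^k |u|^m.
The first term goes by dominated convergence on a finite measure space, the second because u_j → 0
in L_m. -/
theorem tendsto_eLpNorm_quotient [IsFiniteMeasure μ] {C m k : ℝ} (hC : 0 < C) (hm : 0 < m)
    (hk : 0 < k) {u : ℕ → X → E} {y : ℕ → X → ℝ} (hym : ∀ j, AEStronglyMeasurable (y j) μ)
    (hy0 : ∀ j x, 0 ≤ y j x)
    (hu : Tendsto (fun j => eLpNorm (u j) (ENNReal.ofReal m) μ) atTop (𝓝 0))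
    (hy : ∀ j, ∀ᵐ x ∂μ, y j x ≤ C * (1 + ‖u j x‖ ^ (m / k)))
    (hlim : ∀ᵐ x ∂μ, Tendsto (fun j => y j x) atTop (𝓝 0)) :
    Tendsto (fun j => eLpNorm (y j) (ENNReal.ofReal k) μ) atTop (𝓝 0) := by
  have h1 : Tendsto (fun j => ∫⁻ x, ENNReal.ofReal (min (y j x) (2 * C) ^ k) ∂μ) atTop
      (𝓝 (∫⁻ _, 0 ∂μ)) := by
    refine tendsto_lintegral_of_dominated_convergence' (fun _ => ENNReal.ofReal ((2 * C) ^ k))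
      ?_ ?_ ?_ ?_
    · intro j
      exact (((hym j).aemeasurable.min aemeasurable_const).pow_const k).ennreal_ofReal
    · intro j
      refine ae_of_all _ fun x => ENNReal.ofReal_le_ofReal ?_
      exact Real.rpow_le_rpow (le_min (hy0 j x) (by positivity)) (min_le_right _ _) hk.le
    · rw [lintegral_const]
      exact ENNReal.mul_ne_top ENNReal.ofReal_ne_top (measure_ne_top _ _)
    · filter_upwards [hlim] with x hx
      have h2 : Tendsto (fun j => min (y j x) (2 * C) ^ k) atTop (𝓝 (min 0 (2 * C) ^ k)) :=
        (hx.min tendsto_const_nhds).rpow_const (Or.inr hk.le)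
      rw [min_eq_left (by positivity), Real.zero_rpow hk.ne'] at h2
      simpa using ENNReal.tendsto_ofReal h2
  rw [lintegral_zero] at h1
  have h2 : Tendsto (fun j => ENNReal.ofReal ((2 * C) ^ k) *
      eLpNorm (u j) (ENNReal.ofReal m) μ ^ m) atTop (𝓝 0) := by
    have h3 := (ENNReal.continuous_rpow_const (y := m)).tendsto 0 |>.comp hu
    rw [ENNReal.zero_rpow_of_pos hm] at h3
    simpa using ENNReal.Tendsto.const_mul h3 (Or.inr (ENNReal.ofReal_ne_top (r := (2 * C) ^ k)))
  have h3 : ∀ j, eLpNorm (y j) (ENNReal.ofReal k) μ ^ k ≤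
      ∫⁻ x, ENNReal.ofReal (min (y j x) (2 * C) ^ k) ∂μ +
        ENNReal.ofReal ((2 * C) ^ k) * eLpNorm (u j) (ENNReal.ofReal m) μ ^ m := by
    intro j
    rw [← lintegral_norm_rpow_eq hk, ← lintegral_norm_rpow_eq hm,
      ← lintegral_const_mul' _ _ ENNReal.ofReal_ne_top, ← lintegral_add_left']
    · refine lintegral_mono_ae ?_
      filter_upwards [hy j] with x hx
      rw [← ENNReal.ofReal_mul (by positivity), ← ENNReal.ofReal_add
        (Real.rpow_nonneg (le_min (hy0 j x) (by positivity)) _) (by positivity),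
        Real.norm_of_nonneg (hy0 j x)]
      refine ENNReal.ofReal_le_ofReal ?_
      rcases le_total (y j x) (2 * C) with h4 | h4
      · rw [min_eq_left h4]
        have : 0 ≤ (2 * C) ^ k * ‖u j x‖ ^ m := by positivity
        linarith
      · have h5 : y j x ≤ 2 * C * ‖u j x‖ ^ (m / k) := by nlinarith
        have h6 := Real.rpow_le_rpow (hy0 j x) h5 hk.le
        rw [Real.mul_rpow (by positivity) (by positivity), ← Real.rpow_mul (norm_nonneg _),
          div_mul_cancel₀ _ hk.ne'] at h6
        have : 0 ≤ min (y j x) (2 * C) ^ k :=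
          Real.rpow_nonneg (le_min (hy0 j x) (by positivity)) _
        linarith
    · exact (((hym j).aemeasurable.min aemeasurable_const).pow_const k).ennreal_ofReal
  have h4 : Tendsto (fun j => eLpNorm (y j) (ENNReal.ofReal k) μ ^ k) atTop (𝓝 0) := by
    refine tendsto_of_tendsto_of_tendsto_of_le_of_le tendsto_const_nhds ?_ (fun _ => zero_le) h3
    simpa using h1.add h2
  have h5 := (ENNReal.continuous_rpow_const (y := k⁻¹)).tendsto 0 |>.comp h4
  rw [ENNReal.zero_rpow_of_pos (inv_pos.2 hk)] at h5
  refine h5.congr fun j => ?_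
  rw [Function.comp_apply, ENNReal.rpow_rpow_inv hk.ne']

/-- A multivalued superposition operator of growth `|u| + |u| ^ (1 + m / k)` whose values are
`o(|u|)` pointwise is `o(‖u‖)` from `L_m` into `L_q`, where `1 / q = 1 / k + 1 / m`. -/
theorem exists_eLpNorm_superposition_le [IsFiniteMeasure μ] {g : X → E → Set F} {C m k ε : ℝ}
    {q : ℝ≥0∞} [hq : ENNReal.HolderTriple (ENNReal.ofReal k) (ENNReal.ofReal m) q] (hC : 0 < C)
    (hm : 0 < m) (hk : 0 < k) (hε : 0 < ε)
    (hg : ∀ᵐ x ∂μ, ∀ u, ∀ v ∈ g x u, ‖v‖ ≤ C * (‖u‖ + ‖u‖ ^ (1 + m / k)))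
    (hs : ∀ᵐ x ∂μ, ∀ δ > 0, ∀ᶠ u in 𝓝 (0 : E), ∀ v ∈ g x u, ‖v‖ ≤ δ * ‖u‖) :
    ∃ δ > 0, ∀ (u : X → E) (w : X → F), AEStronglyMeasurable u μ → AEStronglyMeasurable w μ →
      (∀ᵐ x ∂μ, w x ∈ g x (u x)) → eLpNorm u (ENNReal.ofReal m) μ ≤ ENNReal.ofReal δ →
        eLpNorm w q μ ≤ ENNReal.ofReal ε * eLpNorm u (ENNReal.ofReal m) μ := by
  by_contra! hcon
  choose u w hum hwm hw hu hn using fun j : ℕ => hcon (1 / (j + 1)) (by positivity)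
  have hu0 : Tendsto (fun j => eLpNorm (u j) (ENNReal.ofReal m) μ) atTop (𝓝 0) := by
    refine tendsto_of_tendsto_of_tendsto_of_le_of_le tendsto_const_nhds ?_ (fun _ => zero_le) hu
    simpa using ENNReal.tendsto_ofReal (tendsto_one_div_add_atTop_nhds_zero_nat (𝕜 := ℝ))
  have hmeas : TendstoInMeasure μ u atTop (0 : X → E) := by
    refine tendstoInMeasure_of_tendsto_eLpNorm (p := ENNReal.ofReal m) (by simpa using hm) hum
      aestronglyMeasurable_zero ?_
    simpa using hu0
  obtain ⟨ns, hns, hae⟩ := hmeas.exists_seq_tendsto_ae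
  -- Where u = 0 the quotient is 0 by convention. This is harmless, since the growth bound forces w
  -- = 0 there.
  set y : ℕ → X → ℝ := fun j x => ‖w j x‖ / ‖u j x‖ with hy
  have hym : ∀ j, AEStronglyMeasurable (y j) μ := fun j =>
    ((hwm j).norm.aemeasurable.div (hum j).norm.aemeasurable).aestronglyMeasurable
  have hw' : ∀ j, ∀ᵐ x ∂μ, ‖w j x‖ = y j x * ‖u j x‖ := by
    intro j
    filter_upwards [hw j, hg] with x hx hgx
    rcases (norm_nonneg (u j x)).eq_or_lt with h0 | h0
    · have h1 := hgx _ _ hx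
      rw [← h0, Real.zero_rpow (by positivity), add_zero, mul_zero] at h1
      rw [← h0, mul_zero]
      exact le_antisymm h1 (norm_nonneg _)
    · rw [hy]
      exact (div_mul_cancel₀ _ h0.ne').symm
  have hyC : ∀ j, ∀ᵐ x ∂μ, y j x ≤ C * (1 + ‖u j x‖ ^ (m / k)) := by
    intro j
    filter_upwards [hw j, hg] with x hx hgx
    rcases (norm_nonneg (u j x)).eq_or_lt with h0 | h0
    · simp only [hy, ← h0, div_zero]
      positivity
    · have h1 := hgx _ _ hx
      rw [Real.rpow_add h0, Real.rpow_one] at h1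
      simp only [hy]
      rw [div_le_iff₀ h0]
      linarith
  have hlim : ∀ᵐ x ∂μ, Tendsto (fun j => y (ns j) x) atTop (𝓝 0) := by
    filter_upwards [hae, hs, ae_all_iff.2 hw] with x hx hsx hwx
    refine tendsto_order.2 ⟨fun a ha => Eventually.of_forall fun j =>
      ha.trans_le (by simp only [hy]; positivity), fun a ha => ?_⟩
    filter_upwards [hx.eventually (hsx (a / 2) (by positivity))] with j hj
    have h1 := hj _ (hwx (ns j))
    rcases (norm_nonneg (u (ns j) x)).eq_or_lt with h0 | h0
    · simpa only [hy, ← h0, div_zero] using ha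
    · simp only [hy]
      rw [div_lt_iff₀ h0]
      nlinarith
  have key := tendsto_eLpNorm_quotient (μ := μ) hC hm hk (u := fun j => u (ns j))
    (y := fun j => y (ns j)) (fun j => hym _) (fun j x => by simp only [hy]; positivity)
    (hu0.comp hns.tendsto_atTop) (fun j => hyC _) hlim
  have hbound : ∀ j, eLpNorm (w j) q μ ≤
      eLpNorm (y j) (ENNReal.ofReal k) μ * eLpNorm (u j) (ENNReal.ofReal m) μ := by
    intro j
    have h1 := eLpNorm_le_eLpNorm_mul_eLpNorm'_of_norm (p := ENNReal.ofReal k)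
      (q := ENNReal.ofReal m) (r := q) (hym j) (hum j) (fun a b => a * ‖b‖) 1
      (ae_of_all _ fun x => by simp)
    rw [ENNReal.coe_one, one_mul] at h1
    refine le_trans (eLpNorm_mono_ae ?_) h1
    filter_upwards [hw' j] with x hx
    rw [hx]
    exact le_abs_self _
  obtain ⟨j, hj⟩ := ((ENNReal.tendsto_nhds_zero.1 key) (ENNReal.ofReal ε) (by simpa using hε)).exists
  exact absurd ((hbound (ns j)).trans (mul_le_mul_left hj _)) (not_le.2 (hn _))

end Smallness

/-! ### Hölder pairings -/

section Pairing

variable {X : Type*} [MeasurableSpace X] {μ : Measure X} {E : Type*} [NormedAddCommGroup E]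
  [InnerProductSpace ℂ E]

theorem integrable_inner_and_norm_integral_le {q q' : ℝ≥0∞} [ENNReal.HolderTriple q q' 1]
    {φ v : X → E} {K M : ℝ} (hφ : AEStronglyMeasurable φ μ) (hv : AEStronglyMeasurable v μ)
    (hK : 0 ≤ K) (hM : 0 ≤ M) (hφK : eLpNorm φ q μ ≤ ENNReal.ofReal K)
    (hvM : eLpNorm v q' μ ≤ ENNReal.ofReal M) :
    Integrable (fun x => inner ℂ (φ x) (v x)) μ ∧ ‖∫ x, inner ℂ (φ x) (v x) ∂μ‖ ≤ K * M := by
  have h1 := eLpNorm_le_eLpNorm_mul_eLpNorm'_of_norm (p := q) (q := q') (r := 1) hφ hv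
    (fun a b => inner ℂ a b) 1 (ae_of_all _ fun x => by
      rw [NNReal.coe_one, one_mul]; exact norm_inner_le_norm _ _)
  rw [ENNReal.coe_one, one_mul] at h1
  have h2 := h1.trans (mul_le_mul' hφK hvM)
  rw [← ENNReal.ofReal_mul hK] at h2
  refine ⟨memLp_one_iff_integrable.1 ⟨hφ.inner hv, h2.trans_lt ENNReal.ofReal_lt_top⟩, ?_⟩
  rw [← ENNReal.ofReal_le_ofReal_iff (by positivity), ofReal_norm]
  rw [eLpNorm_one_eq_lintegral_enorm] at h2
  exact (enorm_integral_le_lintegral_enorm _).trans h2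

theorem inv_ofReal_one_div {a : ℝ} (ha : 0 < a) :
    (ENNReal.ofReal (1 / a))⁻¹ = ENNReal.ofReal a := by
  rw [one_div, ENNReal.ofReal_inv_of_pos ha, inv_inv]

end Pairing

/-! ### The linear part: multiplication by a matrix -/

section Multiplier

variable {d n : ℕ} {Ω : Set (EuclideanSpace ℝ (Fin d))}
  {Bt : EuclideanSpace ℝ (Fin d) → Matrix (Fin n) (Fin n) ℂ}

theorem norm_toLp_le_sum (y : Fin n → ℂ) : ‖WithLp.toLp 2 y‖ ≤ ∑ i, ‖y i‖ := by
  rw [EuclideanSpace.norm_eq]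
  refine Real.sqrt_le_iff.2 ⟨by positivity, ?_⟩
  exact Finset.sum_sq_le_sq_sum_of_nonneg fun i _ => norm_nonneg _

theorem norm_multiplier_le (u : EuclideanSpace ℝ (Fin d) → Cn n) (x : EuclideanSpace ℝ (Fin d)) :
    ‖multiplier Bt u x‖ ≤ (∑ i, ∑ j, ‖Bt x i j‖) * ‖u x‖ := by
  refine (norm_toLp_le_sum _).trans ?_
  rw [Finset.sum_mul]
  refine Finset.sum_le_sum fun i _ => ?_
  rw [Finset.sum_mul]
  change ‖∑ j, Bt x i j * u x j‖ ≤ _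
  refine (norm_sum_le _ _).trans (Finset.sum_le_sum fun j _ => ?_)
  rw [norm_mul]
  exact mul_le_mul_of_nonneg_left (PiLp.norm_apply_le (u x) j) (norm_nonneg _)

theorem aestronglyMeasurable_multiplier
    (hBt : ∀ i j, AEStronglyMeasurable (fun x => Bt x i j) (volume.restrict Ω))
    {u : EuclideanSpace ℝ (Fin d) → Cn n} (hu : AEStronglyMeasurable u (volume.restrict Ω)) :
    AEStronglyMeasurable (multiplier Bt u) (volume.restrict Ω) := by
  have h1 : AEMeasurable (fun x => (Bt x).mulVec (u x)) (volume.restrict Ω) := by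
    refine aemeasurable_pi_iff.2 fun i => ?_
    change AEMeasurable (fun x => ∑ j, Bt x i j * u x j) (volume.restrict Ω)
    refine Finset.aemeasurable_fun_sum _ fun j _ => (hBt i j).aemeasurable.mul ?_
    exact ((EuclideanSpace.proj (𝕜 := ℂ) j).continuous.comp_aestronglyMeasurable hu).aemeasurable
  exact ((PiLp.continuous_toLp 2 _).measurable.comp_aemeasurable h1).aestronglyMeasurable

/-- Hölder lands in L_ρ with 1/ρ = 1/r + 1/m, and finiteness of the measure allows the descent to
the smaller exponent q'. Reciprocals cover r = ∞ at once. -/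
theorem exists_eLpNorm_multiplier_le [IsFiniteMeasure (volume.restrict Ω)] {r q' : ℝ≥0∞}
    {m κ : ℝ} (hr : 1 ≤ r) (hm : 0 < m) (hκ : 0 < κ) (hrm : r⁻¹.toReal + 1 / m ≤ κ)
    (hq' : q'⁻¹ = ENNReal.ofReal κ)
    (hBt : ∀ i j, MemLp (fun x => Bt x i j) r (volume.restrict Ω)) :
    ∃ K : ℝ, 0 ≤ K ∧ ∀ u : EuclideanSpace ℝ (Fin d) → Cn n,
      AEStronglyMeasurable u (volume.restrict Ω) →
      eLpNorm (multiplier Bt u) q' (volume.restrict Ω) ≤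
        ENNReal.ofReal K * eLpNorm u (ENNReal.ofReal m) (volume.restrict Ω) := by
  set μ := volume.restrict Ω
  set β : EuclideanSpace ℝ (Fin d) → ℝ := fun x => ∑ i, ∑ j, ‖Bt x i j‖ with hβ
  have hβr : MemLp β r μ :=
    memLp_finsetSum _ fun i _ => memLp_finsetSum _ fun j _ => (hBt i j).norm
  set ρ : ℝ≥0∞ := (r⁻¹ + (ENNReal.ofReal m)⁻¹)⁻¹ with hρ
  have htri : ENNReal.HolderTriple r (ENNReal.ofReal m) ρ := ⟨by rw [hρ, inv_inv]⟩
  have hρq : q' ≤ ρ := by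
    rw [hρ, ENNReal.le_inv_iff_le_inv, hq', ← ENNReal.ofReal_toReal (ne_top_of_le_ne_top
      ENNReal.one_ne_top (ENNReal.inv_le_one.2 hr)), ← ENNReal.ofReal_inv_of_pos hm,
      ← ENNReal.ofReal_add ENNReal.toReal_nonneg (by positivity)]
    rw [one_div] at hrm
    exact ENNReal.ofReal_le_ofReal hrm
  set D : ℝ≥0∞ := eLpNorm β r μ * μ univ ^ (1 / q'.toReal - 1 / ρ.toReal) with hD
  have hDtop : D ≠ ⊤ := by
    refine ENNReal.mul_ne_top hβr.eLpNorm_ne_top (ENNReal.rpow_ne_top_of_nonneg ?_ (measure_ne_top _ _))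
    rw [one_div, one_div, ← ENNReal.toReal_inv, ← ENNReal.toReal_inv, sub_nonneg]
    refine ENNReal.toReal_mono ?_ (ENNReal.inv_le_inv.2 hρq)
    rw [hq']
    exact ENNReal.ofReal_ne_top
  refine ⟨D.toReal, ENNReal.toReal_nonneg, fun u hu => ?_⟩
  rw [ENNReal.ofReal_toReal hDtop]
  have h1 := eLpNorm_le_eLpNorm_mul_rpow_measure_univ hρq
    (aestronglyMeasurable_multiplier (fun i j => (hBt i j).aestronglyMeasurable) hu)
  have h2 := eLpNorm_le_eLpNorm_mul_eLpNorm'_of_norm (p := r) (q := ENNReal.ofReal m) (r := ρ)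
    hβr.aestronglyMeasurable hu (fun a b => a * ‖b‖) 1 (ae_of_all _ fun x => by simp)
  rw [ENNReal.coe_one, one_mul] at h2
  have h3 : eLpNorm (multiplier Bt u) ρ μ ≤ eLpNorm (fun x => β x * ‖u x‖) ρ μ :=
    eLpNorm_mono fun x => (norm_multiplier_le u x).trans (le_abs_self _)
  calc _ ≤ _ := h1
    _ ≤ eLpNorm β r μ * eLpNorm u (ENNReal.ofReal m) μ *
        μ univ ^ (1 / q'.toReal - 1 / ρ.toReal) := by gcongr; exact h3.trans h2
    _ = _ := by rw [hD]; ring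

theorem multiplier_add (u v : L2 Ω n) : multiplier Bt (u + v : L2 Ω n) =ᵐ[volume.restrict Ω]
    fun x => multiplier Bt u x + multiplier Bt v x := by
  filter_upwards [Lp.coeFn_add u v] with x hx
  rw [multiplier, hx, Pi.add_apply, WithLp.ofLp_add, Matrix.mulVec_add, WithLp.toLp_add]
  rfl

theorem multiplier_smul (z : ℂ) (u : L2 Ω n) : multiplier Bt (z • u : L2 Ω n) =ᵐ[volume.restrict Ω]
    fun x => z • multiplier Bt u x := by
  filter_upwards [Lp.coeFn_smul z u] with x hx
  rw [multiplier, hx, Pi.smul_apply, WithLp.ofLp_smul, Matrix.mulVec_smul, WithLp.toLp_smul]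
  rfl

end Multiplier

/-! ### Pointwise properties of the remainder -/

section Nonlinearity

variable {d n : ℕ} {Ω : Set (EuclideanSpace ℝ (Fin d))}
  {ft gt : ℝ → EuclideanSpace ℝ (Fin d) → Cn n → Set (Cn n)}
  {Bt : EuclideanSpace ℝ (Fin d) → Matrix (Fin n) (Fin n) ℂ} {σ σ' : ℝ}

theorem IsLinearizable.sub_multiplier_mem (hft : IsLinearizable Ω ft gt Bt σ)
    (hΩ : MeasurableSet Ω) {t : ℝ} (ht : 0 ≤ t) {u : L2 Ω n}
    {v : EuclideanSpace ℝ (Fin d) → Cn n} (hv : v ∈ superposition Ω ft t u) :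
    ∀ᵐ x ∂volume.restrict Ω, v x - multiplier Bt u x ∈ gt t x (u x) := by
  filter_upwards [hv.2, ae_restrict_mem hΩ] with x hx hxΩ
  rw [hft.decomp t ht x hxΩ] at hx
  obtain ⟨w, hw, hwv⟩ := hx
  have : v x - multiplier Bt u x = w := by
    rw [← hwv, multiplier, add_sub_cancel_left]
  rwa [this]

/-- |u|^σ ≤ |u| + |u|^σ' for 1 ≤ σ ≤ σ', so σ may be raised to the exponent that is critical for
Hölder's inequality. -/
theorem IsLinearizable.growth_le (hft : IsLinearizable Ω ft gt Bt σ) (hσ : 1 ≤ σ) (hσ' : σ ≤ σ') :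
    ∃ C : ℝ, 0 < C ∧ ∀ᵐ x ∂volume.restrict Ω, ∀ t : ℝ, 0 ≤ t → ∀ u : Cn n, ∀ v ∈ gt t x u,
      ‖v‖ ≤ C * (‖u‖ + ‖u‖ ^ σ') := by
  obtain ⟨C, hC, h⟩ := hft.growth
  refine ⟨2 * C, by positivity, ?_⟩
  filter_upwards [h] with x hx t ht u v hv
  have h1 : ‖u‖ ^ σ ≤ ‖u‖ + ‖u‖ ^ σ' := by
    rcases le_total ‖u‖ 1 with h2 | h2
    · have h3 : ‖u‖ ^ σ ≤ ‖u‖ := by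
        rcases (norm_nonneg u).eq_or_lt with h0 | h0
        · rw [← h0, Real.zero_rpow (by linarith)]
        · simpa using Real.rpow_le_rpow_of_exponent_ge h0 h2 hσ
      have : 0 ≤ ‖u‖ ^ σ' := by positivity
      linarith
    · have := Real.rpow_le_rpow_of_exponent_le h2 hσ'
      linarith [norm_nonneg u]
  have h0 : 0 ≤ ‖u‖ ^ σ' := by positivity
  nlinarith [hx t ht u v hv]

theorem IsLinearizable.eventually_norm_le (hft : IsLinearizable Ω ft gt Bt σ) (hσ : 1 ≤ σ) :
    ∀ᵐ x ∂volume.restrict Ω, ∀ δ > 0, ∀ᶠ u in 𝓝 (0 : Cn n),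
      ∀ v ∈ {v | ∃ t : ℝ, 0 < t ∧ v ∈ gt t x u}, ‖v‖ ≤ δ * ‖u‖ := by
  obtain ⟨C, hC, hg⟩ := hft.growth
  filter_upwards [hft.small, hg] with x hx hgx δ hδ
  have h1 := (ENNReal.tendsto_nhds_zero.1 hx) (ENNReal.ofReal δ) (by simpa using hδ)
  rw [eventually_nhdsWithin_iff] at h1
  filter_upwards [h1] with u hu v hv
  obtain ⟨t, ht, hv⟩ := hv
  -- The limit assumption concerns u ≠ 0 only; at u = 0 the growth bound gives v = 0.
  rcases eq_or_ne u 0 with rfl | hu0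
  · have := hgx t ht.le 0 v hv
    rw [norm_zero, Real.zero_rpow (by linarith), add_zero, mul_zero] at this
    simpa using this
  · have h2 := hu hu0
    have h3 : ‖v‖ₑ ≤ ⨆ t ∈ Ioi (0 : ℝ), ⨆ v ∈ gt t x u, ‖v‖ₑ :=
      le_iSup₂_of_le t ht (le_iSup₂_of_le v hv le_rfl)
    have h4 : ‖v‖ₑ / ‖u‖ₑ ≤ ENNReal.ofReal δ := (ENNReal.div_le_div_right h3 _).trans h2
    rw [ENNReal.div_le_iff (by simpa using hu0) (by simp), ← ofReal_norm, ← ofReal_norm,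
      ← ENNReal.ofReal_mul hδ.le] at h4
    exact (ENNReal.ofReal_le_ofReal_iff (by positivity)).1 h4

end Nonlinearity

/-! ### Hypothesis (B_γ) from embeddings -/

section Hypothesis

variable {d n : ℕ} {Ω : Set (EuclideanSpace ℝ (Fin d))} {A : L2 Ω n →ₗ.[ℂ] L2 Ω n} {α γ : ℝ}
  {ft gt : ℝ → EuclideanSpace ℝ (Fin d) → Cn n → Set (Cn n)}
  {Bt : EuclideanSpace ℝ (Fin d) → Matrix (Fin n) (Fin n) ℂ} {σ : ℝ}

/-- The embedding L_{q'} ⊆ H_{-γ}, dual to D((A*)^γ) ⊆ L_q. -/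
theorem exists_extrap_bound (hN : HasNegPow A γ) {q q' : ℝ≥0∞} [ENNReal.HolderTriple q q' 1]
    (hE : MapsIntoLp (negPow A.adjoint γ) q) :
    ∃ K : ℝ, 0 ≤ K ∧ ∀ (v : EuclideanSpace ℝ (Fin d) → Cn n) (M : ℝ), 0 ≤ M →
      AEStronglyMeasurable v (volume.restrict Ω) →
      eLpNorm v q' (volume.restrict Ω) ≤ ENNReal.ofReal M →
      (∃ F : Extrap A γ, Represents γ v F) ∧
        ∀ F : Extrap A γ, Represents γ v F → ‖F‖ ≤ K * M := by
  obtain ⟨K, hK, hE⟩ := hE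
  refine ⟨K, hK, fun v M hM hv hvM => ?_⟩
  have h := fun ψ : L2 Ω n => integrable_inner_and_norm_integral_le
    (Lp.aestronglyMeasurable (negPow A.adjoint γ ψ)) hv (by positivity) hM (hE ψ) hvM
  have h2 : ∀ ψ : L2 Ω n,
      ‖∫ x in Ω, inner ℂ (negPow A.adjoint γ ψ x) (v x)‖ ≤ K * M * ‖ψ‖ := fun ψ =>
    (h ψ).2.trans (le_of_eq (by ring))
  exact ⟨exists_represents hN (fun ψ => (h ψ).1) h2,
    fun F hF => hF.norm_le hN (by positivity) h2⟩

/-- Linearity of B comes for free: the element of H_{-γ} represented by a function is unique. -/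
theorem exists_multiplier_extrap (hN : HasNegPow A γ) {K : ℝ}
    (h : ∀ u : PowDom A α, ∃ F : Extrap A γ,
      Represents γ (multiplier Bt (PowDom.val A α u)) F ∧ ‖F‖ ≤ K * ‖u‖) :
    ∃ B : PowDom A α →L[ℂ] Extrap A γ,
      ∀ u : PowDom A α, Represents γ (multiplier Bt (PowDom.val A α u)) (B u) := by
  choose F hF hFK using h
  let B : PowDom A α →ₗ[ℂ] Extrap A γ :=
    { toFun := F
      map_add' := fun u v => (hF (u + v)).unique hN
        (((hF u).add hN (hF v)).congr (by rw [map_add]; exact (multiplier_add _ _).symm))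
      map_smul' := fun z u => (hF (z • u)).unique hN
        (((hF u).smul hN z).congr (by rw [map_smul]; exact (multiplier_smul _ _).symm)) }
  exact ⟨B.mkContinuous K hFK, hF⟩

/-- The hypothesis `(B_γ)` holds for a superposition operator if `H_α` embeds into `L_m` and
`D((A*) ^ γ)` embeds into `L_q`, under the growth conditions of Hölder's inequality. -/
theorem satisfiesB_of_mapsIntoLp (hΩ : MeasurableSet Ω) [IsFiniteMeasure (volume.restrict Ω)]
    (hN : HasNegPow A γ) {m Cα : ℝ} {q r : ℝ≥0∞} (hm : 0 < m) (hq : 1 ≤ q) (hr : 1 ≤ r)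
    (hσ : 1 ≤ σ) (hmq : 1 / m + q⁻¹.toReal < 1) (hσq : σ / m + q⁻¹.toReal ≤ 1)
    (hrq : r⁻¹.toReal + 1 / m + q⁻¹.toReal ≤ 1)
    (hα : ∀ u : PowDom A α, eLpNorm (PowDom.val A α u) (ENNReal.ofReal m) (volume.restrict Ω) ≤
      ENNReal.ofReal (Cα * ‖u‖))
    (hE : MapsIntoLp (negPow A.adjoint γ) q)
    (hBt : ∀ i j, MemLp (fun x => Bt x i j) r (volume.restrict Ω))
    (hft : IsLinearizable Ω ft gt Bt σ)
    (heq : ∀ t : ℝ, 0 < t → (0 : EuclideanSpace ℝ (Fin d) → Cn n) ∈ superposition Ω ft t 0) :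
    SatisfiesB A α γ ft Bt := by
  have hqtop : q⁻¹ ≠ ⊤ := ne_top_of_le_ne_top ENNReal.one_ne_top (ENNReal.inv_le_one.2 hq)
  -- κ = 1/q' for the exponent q' conjugate to q; the values of f should lie in L_{q'}.
  set κ := 1 - q⁻¹.toReal with hκ
  have hm1 : 0 < 1 / m := by positivity
  have hκ0 : 0 < κ := by linarith
  have hκm : 0 < κ - 1 / m := by linarith
  set q' := ENNReal.ofReal (1 / κ) with hq'
  have hq'inv : q'⁻¹ = ENNReal.ofReal κ := inv_ofReal_one_div hκ0
  have htri1 : ENNReal.HolderTriple q q' 1 := by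
    refine ⟨?_⟩
    rw [hq'inv, ← ENNReal.ofReal_toReal hqtop, ← ENNReal.ofReal_add ENNReal.toReal_nonneg hκ0.le,
      hκ, add_sub_cancel, ENNReal.ofReal_one, inv_one]
  -- 1/k = 1/q' - 1/m is what Hölder leaves for the quotient |v|/|u|. The critical growth is 1 + m/k
  -- = m/q', and `hσq` says precisely that σ does not exceed it.
  set k := 1 / (κ - 1 / m) with hk
  have hk0 : 0 < k := by positivity
  have htri2 : ENNReal.HolderTriple (ENNReal.ofReal k) (ENNReal.ofReal m) q' := by
    refine ⟨?_⟩
    rw [hq'inv, hk, inv_ofReal_one_div hκm, ← ENNReal.ofReal_inv_of_pos hm,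
      ← ENNReal.ofReal_add hκm.le (by positivity), one_div, sub_add_cancel]
  have hσ' : σ ≤ 1 + m / k := by
    have h1 : m / k = m * κ - 1 := by
      rw [hk]; field_simp
    have h2 : σ / m ≤ κ := by linarith
    rw [div_le_iff₀ hm] at h2
    linarith
  have hq'm : q' ≤ ENNReal.ofReal m := by
    refine ENNReal.ofReal_le_ofReal ?_
    rw [one_div_le hκ0 hm]
    linarith
  obtain ⟨K, hK, hKF⟩ := exists_extrap_bound (q' := q') hN hE
  obtain ⟨D, hD, hDu⟩ := exists_eLpNorm_multiplier_le hr hm hκ0 (by linarith) hq'inv hBt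
  obtain ⟨C, hC, hg⟩ := hft.growth_le hσ hσ'
  have hBm := fun i j => (hBt i j).aestronglyMeasurable
  have hum : ∀ u : PowDom A α, AEStronglyMeasurable (PowDom.val A α u) (volume.restrict Ω) :=
    fun u => Lp.aestronglyMeasurable _
  have hα' : ∀ u : PowDom A α, eLpNorm (PowDom.val A α u) (ENNReal.ofReal m) (volume.restrict Ω) ≤
      ENNReal.ofReal (|Cα| * ‖u‖) := fun u =>
    (hα u).trans (ENNReal.ofReal_le_ofReal (by gcongr; exact le_abs_self _))
  have hmult : ∀ u : PowDom A α, eLpNorm (multiplier Bt (PowDom.val A α u)) q'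
      (volume.restrict Ω) ≤ ENNReal.ofReal (D * (|Cα| * ‖u‖)) := fun u => by
    rw [ENNReal.ofReal_mul hD]
    exact (hDu _ (hum u)).trans (mul_le_mul_right (hα' u) _)
  obtain ⟨B, hB⟩ : ∃ B : PowDom A α →L[ℂ] Extrap A γ,
      ∀ u : PowDom A α, Represents γ (multiplier Bt (PowDom.val A α u)) (B u) := by
    refine exists_multiplier_extrap (K := K * (D * |Cα|)) hN fun u => ?_
    obtain ⟨⟨F, hF⟩, h⟩ := hKF _ _ (by positivity)
      (aestronglyMeasurable_multiplier hBm (hum u)) (hmult u)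
    exact ⟨F, hF, (h F hF).trans (le_of_eq (by ring))⟩
  have hinto : MapsIntoExtrap A α γ ft := by
    intro t ht u v hv
    set w : EuclideanSpace ℝ (Fin d) → Cn n := fun x => v x - multiplier Bt (PowDom.val A α u) x
      with hw
    have hwm : AEStronglyMeasurable w (volume.restrict Ω) :=
      hv.1.sub (aestronglyMeasurable_multiplier hBm (hum u))
    have hmem : MemLp (PowDom.val A α u) (ENNReal.ofReal m) (volume.restrict Ω) :=
      ⟨hum u, (hα u).trans_lt ENNReal.ofReal_lt_top⟩
    have h1 : MemLp (fun x => ‖PowDom.val A α u x‖ + ‖PowDom.val A α u x‖ ^ (1 + m / k)) q'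
        (volume.restrict Ω) := by
      refine (hmem.mono_exponent hq'm).norm.add ⟨?_, ?_⟩
      · exact ((hum u).norm.aemeasurable.pow_const _).aestronglyMeasurable
      · rw [eLpNorm_norm_rpow _ (by positivity), hq', ← ENNReal.ofReal_mul (by positivity)]
        have e : 1 / κ * (1 + m / k) = m := by
          rw [hk]; field_simp; ring
        rw [e]
        exact ENNReal.rpow_lt_top_of_nonneg (by positivity) hmem.eLpNorm_ne_top
    have h2 : MemLp w q' (volume.restrict Ω) := by
      refine h1.of_le_mul (c := C) hwm ?_
      filter_upwards [hg, hft.sub_multiplier_mem hΩ ht hv] with x hx hwx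
      rw [Real.norm_of_nonneg (by positivity)]
      exact hx t ht _ _ hwx
    obtain ⟨⟨F, hF⟩, -⟩ := hKF w (eLpNorm w q' (volume.restrict Ω)).toReal ENNReal.toReal_nonneg
      hwm (by rw [ENNReal.ofReal_toReal h2.eLpNorm_ne_top])
    refine ⟨F + B u, (hF.add hN (hB u)).congr (ae_of_all _ fun x => ?_)⟩
    simp only [hw, sub_add_cancel]
  refine ⟨hinto, B, hB, ?_, ⟨univ, isOpen_univ, mem_univ _, Subset.rfl⟩, ?_⟩
  · intro t ht
    refine ⟨0, by rw [map_zero]; exact heq t ht, (represents_iff hN).2 fun ψ => ?_⟩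
    simp
  · have hgt : ∀ᵐ x ∂volume.restrict Ω, ∀ u : Cn n, ∀ v ∈ {v | ∃ t : ℝ, 0 < t ∧ v ∈ gt t x u},
        ‖v‖ ≤ C * (‖u‖ + ‖u‖ ^ (1 + m / k)) := by
      filter_upwards [hg] with x hx u v hv
      obtain ⟨t, ht, hv⟩ := hv
      exact hx t ht.le u v hv
    rw [ENNReal.tendsto_nhds_zero]
    intro ε hε
    obtain ⟨ε', hε', hε''⟩ : ∃ ε' : ℝ, 0 < ε' ∧ ENNReal.ofReal ε' ≤ ε := by
      obtain ⟨a, ha, ha'⟩ := ENNReal.lt_iff_exists_nnreal_btwn.1 hε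
      exact ⟨a, by exact_mod_cast ha, by rw [ENNReal.ofReal_coe_nnreal]; exact ha'.le⟩
    set η := ε' / (K * |Cα| + 1) with hη
    have hη0 : 0 < η := by positivity
    obtain ⟨δ, hδ, h⟩ := exists_eLpNorm_superposition_le (q := q') hC hm hk0 hη0 hgt
      (hft.eventually_norm_le hσ)
    have hball : ∀ᶠ u : PowDom A α in 𝓝 0, ‖u‖ < δ / (|Cα| + 1) := by
      have : Tendsto (fun u : PowDom A α => ‖u‖) (𝓝 0) (𝓝 0) := tendsto_norm_zero
      exact this.eventually (gt_mem_nhds (by positivity))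
    filter_upwards [hball.filter_mono nhdsWithin_le_nhds] with u hu
    refine ENNReal.div_le_of_le_mul ?_
    refine iSup₂_le fun t ht => iSup₂_le fun F hF => ?_
    obtain ⟨v, hv, hvF⟩ := hF
    have ht0 : 0 < t := ht
    set w : EuclideanSpace ℝ (Fin d) → Cn n := fun x => v x - multiplier Bt (PowDom.val A α u) x
      with hw
    have hwm : AEStronglyMeasurable w (volume.restrict Ω) :=
      hv.1.sub (aestronglyMeasurable_multiplier hBm (hum u))
    have hsmall : |Cα| * ‖u‖ ≤ δ := by
      have h1 : ‖u‖ * (|Cα| + 1) < δ := (lt_div_iff₀ (by positivity)).1 hu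
      nlinarith [norm_nonneg u]
    have hwq : eLpNorm w q' (volume.restrict Ω) ≤ ENNReal.ofReal (η * (|Cα| * ‖u‖)) := by
      rw [ENNReal.ofReal_mul hη0.le]
      refine (h _ w (hum u) hwm ?_ ((hα' u).trans (ENNReal.ofReal_le_ofReal hsmall))).trans
        (mul_le_mul_right (hα' u) _)
      filter_upwards [hft.sub_multiplier_mem hΩ ht0.le hv] with x hx
      exact ⟨t, ht0, hx⟩
    have hFB := (hKF w _ (by positivity) hwm hwq).2 _ (hvF.sub hN (hB u))
    have hle : ‖F - B u‖ ≤ ε' * ‖u‖ := by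
      refine hFB.trans ?_
      have h1 : K * |Cα| * η ≤ ε' := by
        rw [hη, mul_div_assoc', div_le_iff₀ (by positivity)]
        nlinarith
      calc _ = K * |Cα| * η * ‖u‖ := by ring
        _ ≤ _ := by gcongr
    rw [← ofReal_norm, ← ofReal_norm]
    refine (ENNReal.ofReal_le_ofReal hle).trans ?_
    rw [ENNReal.ofReal_mul hε'.le]
    gcongr

end Hypothesis

/-! ### Consequences of the Kato property -/

section Kato

variable {H : Type*} [NormedAddCommGroup H] [InnerProductSpace ℂ H] [CompleteSpace H]
  {V : Type*} [NormedAddCommGroup V] [InnerProductSpace ℂ V] [CompleteSpace V]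
  {T : V →L[ℂ] V} {ι : V →L[ℂ] H} {c : ℝ} {A : H →ₗ.[ℂ] H}

theorem IsKatoOperator.exists_isInverseResol (hA : IsKatoOperator ι A) (hι : DenseRange ι) :
    ∃ (T : V →L[ℂ] V) (c : ℝ), IsCoerciveOp T c ∧ IsInverseResol A T ι := by
  obtain ⟨⟨a, ⟨C, -, hC⟩, ⟨c, hc, ha⟩, rfl⟩, -⟩ := hA
  obtain ⟨T, hT, haT⟩ := exists_isCoerciveOp hC hc ha
  exact ⟨T, c, hT, isInverseResol_formOperator hT hι haT⟩

/-- J is A^(1/2) restricted to V, bounded by the equivalence of norms. It is linear because A^(-1/2)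
is injective. -/
theorem IsKatoOperator.exists_half (hA : IsKatoOperator ι A) (hι : DenseRange ι)
    (hT : IsCoerciveOp T c) (h : IsInverseResol A T ι) :
    ∃ J : V →L[ℂ] H, ∀ v, fracInt T ι (1 / 2) (J v) = ι v := by
  obtain ⟨-, hr, b, C, hb, hbC⟩ := hA
  have hN : HasNegPow A (1 / 2) := h.hasNegPow hT hι (by norm_num) (by norm_num)
  have hex : ∀ v : V, ∃ z : H, negPow A (1 / 2) z = ι v ∧ ‖z‖ ≤ C * ‖v‖ := by
    intro v
    obtain ⟨u, hu⟩ : ι v ∈ range (PowDom.val A (1 / 2)) := hr ▸ mem_range_self v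
    exact ⟨PowDom.pow A (1 / 2) u, by rw [negPow_pow hN.nonneg hN.injective, hu],
      (hbC u v hu).2⟩
  choose j hj hjC using hex
  let J : V →ₗ[ℂ] H :=
    { toFun := j
      map_add' := fun u v => hN.injective (by rw [hj, map_add, map_add, hj, hj])
      map_smul' := fun z u => hN.injective (by rw [hj, map_smul, RingHom.id_apply, map_smul, hj]) }
  refine ⟨J.mkContinuous C hjC, fun v => ?_⟩
  rw [← h.negPow_eq hT (by norm_num) (by norm_num)]
  exact hj v

end Kato

/-! ### Embeddings of H_α and of D((A*)^γ) -/

section Exponents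

/-- The map `ι : V → L_2` is bounded from `V` into `L_p`. -/
def BoundedIntoLp {d n : ℕ} {Ω : Set (EuclideanSpace ℝ (Fin d))} {V : Type*}
    [NormedAddCommGroup V] [NormedSpace ℂ V] (ι : V →L[ℂ] L2 Ω n) (p : ℝ≥0∞) : Prop :=
  ∃ C : ℝ, ∀ v, eLpNorm (ι v) p (volume.restrict Ω) ≤ ENNReal.ofReal (C * ‖v‖)

variable {d n : ℕ} {Ω : Set (EuclideanSpace ℝ (Fin d))} {A : L2 Ω n →ₗ.[ℂ] L2 Ω n} {γ : ℝ}
  {V : Type*} [NormedAddCommGroup V] [InnerProductSpace ℂ V] [CompleteSpace V]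
  {T : V →L[ℂ] V} {ι : V →L[ℂ] L2 Ω n} {c : ℝ}

theorem eLpNorm_val_zero_le (hN : HasNegPow A 0) (u : PowDom A 0) :
    eLpNorm (PowDom.val A 0 u) (ENNReal.ofReal 2) (volume.restrict Ω) ≤
      ENNReal.ofReal (1 * ‖u‖) := by
  have h := negPow_pow le_rfl hN.injective u
  rw [negPow_zero] at h
  rw [← h, one_mul, PowDom.norm_eq, Lp.norm_def, ENNReal.ofReal_toReal (Lp.eLpNorm_ne_top _),
    ENNReal.ofReal_ofNat]
  exact le_rfl

theorem IsKatoOperator.eLpNorm_val_half_le {p : ℝ≥0∞} (hA : IsKatoOperator ι A)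
    (hp : BoundedIntoLp ι p) :
    ∃ C : ℝ, ∀ u : PowDom A (1 / 2), eLpNorm (PowDom.val A (1 / 2) u) p (volume.restrict Ω) ≤
      ENNReal.ofReal (C * ‖u‖) := by
  obtain ⟨-, hr, b, C₁, hb, hbC⟩ := hA
  obtain ⟨C, hC⟩ := hp
  refine ⟨|C| / b, fun u => ?_⟩
  obtain ⟨v, hv⟩ : PowDom.val A (1 / 2) u ∈ range ι := hr ▸ mem_range_self u
  rw [← hv]
  refine (hC v).trans (ENNReal.ofReal_le_ofReal ?_)
  have h1 := (hbC u v hv.symm).1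
  rw [div_mul_eq_mul_div, le_div_iff₀ hb]
  calc C * ‖v‖ * b ≤ |C| * ‖v‖ * b := by gcongr; exact le_abs_self C
    _ = |C| * (b * ‖v‖) := by ring
    _ ≤ _ := by gcongr

/-- The range of (A*)^(-γ) lies in V. Above 1/2 coercivity suffices; only γ = 1/2 needs the Kato
property. -/
theorem mapsIntoLp_negPow_of_half_le {q : ℝ≥0∞} (hA : IsKatoOperator ι A) (hι : DenseRange ι)
    (hT : IsCoerciveOp T c) (h : IsInverseResol A T ι) (h0 : 1 / 2 ≤ γ) (h1 : γ < 1)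
    (hq : BoundedIntoLp ι q) :
    MapsIntoLp (negPow A.adjoint γ) q := by
  obtain ⟨C, hC⟩ := hq
  rw [(h.adjoint hT hι).negPow_eq hT.adjoint (by linarith) h1]
  rcases h0.eq_or_lt with rfl | h0
  · obtain ⟨J, hJ⟩ := hA.exists_half hι hT h
    obtain ⟨W, hW⟩ := exists_fracInt_half_adjoint hT hι hJ
    exact mapsIntoLp_of_factor hC W hW
  · obtain ⟨W, hW⟩ := exists_fracInt_eq_of_half_lt hT.adjoint ι h0 h1
    exact mapsIntoLp_of_factor hC W hW

theorem mapsIntoLp_negPow_of_lt_half [IsFiniteMeasure (volume.restrict Ω)] {ps q : ℝ}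
    (hι : DenseRange ι) (hT : IsCoerciveOp T c) (h : IsInverseResol A T ι) (hps : 2 < ps)
    (h0 : 0 ≤ γ) (h1 : γ < 1 / 2) (hq : 1 / q = (1 - 2 * γ) / 2 + 2 * γ / ps)
    (hV : BoundedIntoLp ι (ENNReal.ofReal ps)) :
    MapsIntoLp (negPow A.adjoint γ) (ENNReal.ofReal q) := by
  obtain ⟨C, hC⟩ := hV
  rcases h0.eq_or_lt with rfl | h0
  · have : q = 2 := by
      rw [mul_zero, sub_zero, zero_div, add_zero] at hq
      simpa using hq
    rw [negPow_zero, this, ENNReal.ofReal_ofNat]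
    exact mapsIntoLp_one
  · rw [(h.adjoint hT hι).negPow_eq hT.adjoint h0 (by linarith)]
    exact fracInt_mapsIntoLp_of_lt_half hT.adjoint hps h0 h1 hq hC

theorem mapsIntoLp_negPow_of_domain [IsFiniteMeasure (volume.restrict Ω)] {ps p q : ℝ}
    (hA : IsKatoOperator ι A) (hι : DenseRange ι) (hT : IsCoerciveOp T c)
    (h : IsInverseResol A T ι) (hps : 2 < ps) (hp : ps < p) (h0 : 1 / 2 ≤ γ) (h1 : γ < 1)
    (hq : 1 / q = (2 - 2 * γ) / ps + (2 * γ - 1) / p)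
    (hV : BoundedIntoLp ι (ENNReal.ofReal ps))
    (hD : DomainEmbedsInLp A.adjoint (ENNReal.ofReal p)) :
    MapsIntoLp (negPow A.adjoint γ) (ENNReal.ofReal q) := by
  rcases h0.eq_or_lt with rfl | h0
  · have : q = ps := by
      have h2 : 1 / q = 1 / ps := by rw [hq]; ring
      simpa using h2
    rw [this]
    exact mapsIntoLp_negPow_of_half_le hA hι hT h le_rfl h1 hV
  · obtain ⟨C, hC⟩ := hV
    obtain ⟨C', hC'⟩ := hD
    rw [(h.adjoint hT hι).negPow_eq hT.adjoint (by linarith) h1]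
    -- The graph norm of (A*)^(-1) w is at most (‖(A*)^(-1)‖ + 1) ‖w‖, whence this constant.
    refine fracInt_mapsIntoLp_of_half_lt (C' := |C'| * (‖resol T.adjoint ι 0‖ + 1)) hT.adjoint hps hp
      h0 h1 hq hC fun w => ?_
    obtain ⟨y, hy, hy'⟩ := (LinearPMap.mem_graph_iff _).1 ((h.adjoint hT hι _ w).2 rfl)
    have h2 := hC' y
    dsimp only at hy hy'
    rw [hy, hy'] at h2
    refine h2.trans (ENNReal.ofReal_le_ofReal ?_)
    rw [mul_assoc]
    refine mul_le_mul (le_abs_self _) ?_ (by positivity) (abs_nonneg _)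
    rw [add_mul, one_mul]
    exact add_le_add_left ((resol T.adjoint ι 0).le_opNorm w) _

theorem toReal_inv_ofReal {q : ℝ} (hq : 0 < q) : (ENNReal.ofReal q)⁻¹.toReal = 1 / q := by
  rw [ENNReal.toReal_inv, ENNReal.toReal_ofReal hq.le, one_div]

theorem toReal_inv_lt {a : ℝ} {r : ℝ≥0∞} (ha : 0 < a) (hr : ENNReal.ofReal a < r) :
    r⁻¹.toReal < 1 / a := by
  refine ENNReal.toReal_lt_of_lt_ofReal ?_
  rw [one_div, ENNReal.ofReal_inv_of_pos ha]
  exact ENNReal.inv_lt_inv.2 hr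

end Exponents

/-! ### The three cases -/

section Cases

variable {d n : ℕ} {Ω : Set (EuclideanSpace ℝ (Fin d))} {A : L2 Ω n →ₗ.[ℂ] L2 Ω n}
  {V : Type*} [NormedAddCommGroup V] [InnerProductSpace ℂ V] [CompleteSpace V]
  {ι : V →L[ℂ] L2 Ω n} {ft gt : ℝ → EuclideanSpace ℝ (Fin d) → Cn n → Set (Cn n)}
  {Bt : EuclideanSpace ℝ (Fin d) → Matrix (Fin n) (Fin n) ℂ} {r : ℝ≥0∞} {σ ps : ℝ}

theorem satisfiesB_zero_of_boundedIntoLp (hd : 1 ≤ d) (hΩ : MeasurableSet Ω)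
    [IsFiniteMeasure (volume.restrict Ω)] (hps : 2 < ps)
    (hι : DenseRange ι) (hA : IsKatoOperator ι A) (hV : BoundedIntoLp ι (ENNReal.ofReal ps))
    (hr : 1 ≤ r) (hσ : 1 ≤ σ) (hBt : ∀ i j, MemLp (fun x => Bt x i j) r (volume.restrict Ω))
    (hft : IsLinearizable Ω ft gt Bt σ)
    (heq : ∀ t : ℝ, 0 < t → (0 : EuclideanSpace ℝ (Fin d) → Cn n) ∈ superposition Ω ft t 0)
    (hV1 : d = 1 → BoundedIntoLp ι ⊤)
    (hV2 : d = 2 → ∀ q : ℝ, 2 < q → BoundedIntoLp ι (ENNReal.ofReal q))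
    (hr1 : d = 1 → r = 2) (hr2 : d = 2 → 2 < r)
    (hr3 : 3 ≤ d → r = ENNReal.ofReal (2 * ps / (ps - 2)))
    (hσ1 : d = 1 → σ = 2) (hσ2 : d = 2 → σ < 2) (hσ3 : 3 ≤ d → σ = 2 - 2 / ps)
    {γ : ℝ} (h0 : 1 / 2 ≤ γ) (h1 : γ < 1) : SatisfiesB A 0 γ ft Bt := by
  obtain ⟨T, c, hT, hAT⟩ := hA.exists_isInverseResol hι
  have hN : ∀ γ : ℝ, 0 ≤ γ → γ < 1 → HasNegPow A γ := fun γ h0 h1 => hAT.hasNegPow hT hι h0 h1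
  have hN0 := hN 0 le_rfl zero_lt_one
  have hps0 : 0 < ps := by linarith
  have hy : 1 / ps < 1 / 2 := one_div_lt_one_div_of_lt (by norm_num) hps
  have hy0 : 0 < 1 / ps := by positivity
  -- Since γ ≥ 1/2, any q with V ⊆ L_q will do: q = ∞ for d = 1, a large q for d = 2, and q = p_*
  -- for d ≥ 3, where σ and r turn the last two conditions into equalities.
  obtain ⟨q, hq, hE, hmq, hσq, hrq⟩ : ∃ q : ℝ≥0∞, 1 ≤ q ∧ BoundedIntoLp ι q ∧
      1 / 2 + q⁻¹.toReal < 1 ∧ σ / 2 + q⁻¹.toReal ≤ 1 ∧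
      r⁻¹.toReal + 1 / 2 + q⁻¹.toReal ≤ 1 := by
    rcases (show d = 1 ∨ d = 2 ∨ 3 ≤ d by omega) with h | h | h
    · refine ⟨⊤, le_top, hV1 h, ?_⟩
      rw [hσ1 h, hr1 h]
      norm_num
    · have hr' := toReal_inv_lt (a := 2) (by norm_num) (by simpa using hr2 h)
      -- The slack left by r > 2 and σ < 2. The exponent q = 2 + 1/a exceeds 2 and has 1/q ≤ a.
      set a := min (1 / 2 - r⁻¹.toReal) (1 - σ / 2) with ha
      have ha0 : 0 < a := lt_min (by linarith) (by linarith [hσ2 h])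
      have hq0 : 2 < 2 + 1 / a := by
        have : 0 < 1 / a := by positivity
        linarith
      have hqa : 1 / (2 + 1 / a) ≤ a := by
        rw [one_div_le (by positivity) ha0]
        linarith
      have hq2 : 1 / (2 + 1 / a) < 1 / 2 := one_div_lt_one_div_of_lt (by norm_num) hq0
      have ha1 : a ≤ 1 / 2 - r⁻¹.toReal := min_le_left _ _
      have ha2 : a ≤ 1 - σ / 2 := min_le_right _ _
      refine ⟨ENNReal.ofReal (2 + 1 / a), ENNReal.one_le_ofReal.2 (by linarith), hV2 h _ hq0, ?_⟩
      rw [toReal_inv_ofReal (by linarith)]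
      exact ⟨by linarith, by linarith, by linarith⟩
    · refine ⟨ENNReal.ofReal ps, ENNReal.one_le_ofReal.2 (by linarith), hV, ?_⟩
      have h2 : 0 < ps - 2 := by linarith
      have h3 : 1 / (2 * ps / (ps - 2)) = 1 / 2 - 1 / ps := by field_simp
      rw [toReal_inv_ofReal hps0, hr3 h, toReal_inv_ofReal (by positivity), hσ3 h, h3]
      refine ⟨by linarith, le_of_eq (by ring), le_of_eq (by ring)⟩
  exact satisfiesB_of_mapsIntoLp hΩ (hN γ (by linarith) h1) two_pos hq hr hσ hmq hσq
    hrq (eLpNorm_val_zero_le hN0) (mapsIntoLp_negPow_of_half_le hA hι hT hAT h0 h1 hE)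
    hBt hft heq

theorem satisfiesB_zero_of_domainEmbedsInLp (hΩ : MeasurableSet Ω)
    [IsFiniteMeasure (volume.restrict Ω)] (hps : 2 < ps)
    (hι : DenseRange ι) (hA : IsKatoOperator ι A) (hV : BoundedIntoLp ι (ENNReal.ofReal ps))
    (hr : 1 ≤ r) (hσ : 1 ≤ σ) (hBt : ∀ i j, MemLp (fun x => Bt x i j) r (volume.restrict Ω))
    (hft : IsLinearizable Ω ft gt Bt σ)
    (heq : ∀ t : ℝ, 0 < t → (0 : EuclideanSpace ℝ (Fin d) → Cn n) ∈ superposition Ω ft t 0)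
    {p : ℝ} (hp : ps < p) (hD : DomainEmbedsInLp A.adjoint (ENNReal.ofReal p))
    (hrp : ENNReal.ofReal (2 * p / (p - 2)) < r) (hσp : σ < 2 - 2 / p) {γ₀ γ₁ : ℝ}
    (hγ₀ : γ₀ = ((σ - 2) * ps * p - 2 * ps + 4 * p) / (4 * (p - ps)))
    (hγ₁ : γ₁ = (2 * p * ps * r⁻¹.toReal - (p * ps + 2 * ps - 4 * p)) / (4 * (p - ps))) :
    γ₀ < 1 ∧ γ₁ < 1 ∧
      ∀ γ : ℝ, max (max γ₀ γ₁) (1 / 2) ≤ γ → γ < 1 → SatisfiesB A 0 γ ft Bt := by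
  obtain ⟨T, c, hT, hAT⟩ := hA.exists_isInverseResol hι
  have hN : ∀ γ : ℝ, 0 ≤ γ → γ < 1 → HasNegPow A γ := fun γ h0 h1 => hAT.hasNegPow hT hι h0 h1
  have hN0 := hN 0 le_rfl zero_lt_one
  have hps0 : 0 < ps := by linarith
  have hy : 1 / ps < 1 / 2 := one_div_lt_one_div_of_lt (by norm_num) hps
  have hy0 : 0 < 1 / ps := by positivity
  have hp0 : 0 < p := by linarith
  have hx0 : 0 < 1 / p := by positivity
  have hxy : 1 / p < 1 / ps := one_div_lt_one_div_of_lt hps0 hp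
  have hpps : 0 < p - ps := by linarith
  have hr' := toReal_inv_lt (div_pos (by linarith) (by linarith)) hrp
  have h2 : 0 < p - 2 := by linarith
  have h3 : 1 / (2 * p / (p - 2)) = 1 / 2 - 1 / p := by field_simp
  rw [h3] at hr'
  set ρ := r⁻¹.toReal with hρ
  have hden : 0 < 4 * (1 / ps - 1 / p) := by linarith
  -- Dividing numerator and denominator by p p_* makes everything linear in 1/p and 1/p_*. Then γ₀
  -- and γ₁ are the solutions γ of σ/2 + z = 1 and 1/r + 1/2 + z = 1, for the reciprocal exponent z
  -- below.
  have e0 : γ₀ = (σ - 2 - 2 * (1 / p) + 4 * (1 / ps)) / (4 * (1 / ps - 1 / p)) := by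
    rw [hγ₀, div_eq_div_iff (by positivity) hden.ne']
    field_simp
  have e1 : γ₁ = (2 * ρ - 1 - 2 * (1 / p) + 4 * (1 / ps)) / (4 * (1 / ps - 1 / p)) := by
    rw [hγ₁, div_eq_div_iff (by positivity) hden.ne']
    field_simp
    ring
  have hσp' : σ < 2 - 2 * (1 / p) := by rwa [mul_one_div]
  refine ⟨by rw [e0, div_lt_one hden]; linarith, by rw [e1, div_lt_one hden]; linarith,
    fun γ hγ hγ1 => ?_⟩
  have hγ2 : 1 / 2 ≤ γ := (le_max_right _ _).trans hγ
  have hγ3 : γ₀ ≤ γ := (le_max_left _ _).trans ((le_max_left _ _).trans hγ)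
  have hγ4 : γ₁ ≤ γ := (le_max_right _ _).trans ((le_max_left _ _).trans hγ)
  rw [e0, div_le_iff₀ hden] at hγ3
  rw [e1, div_le_iff₀ hden] at hγ4
  set x := 1 / p with hx
  set y := 1 / ps with hy
  -- z = 1/q for the exponent q of the embedding D((A*)^γ) ⊆ L_q. It decreases in γ from 1/p_* at
  -- 1/2 towards 1/p at 1.
  set z := (2 - 2 * γ) * y + (2 * γ - 1) * x with hz
  have hz0 : 0 < z := by nlinarith
  have hz1 : z < 1 / 2 := by nlinarith
  have hzq : (ENNReal.ofReal (1 / z))⁻¹.toReal = z := by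
    rw [toReal_inv_ofReal (by positivity), one_div_one_div]
  have hE : MapsIntoLp (negPow A.adjoint γ) (ENNReal.ofReal (1 / z)) :=
    mapsIntoLp_negPow_of_domain hA hι hT hAT hps hp hγ2 hγ1
      (by rw [one_div_one_div, hz, hx, hy]; ring) hV hD
  refine satisfiesB_of_mapsIntoLp hΩ (hN γ (by linarith) hγ1) two_pos
    (ENNReal.one_le_ofReal.2 ?_) hr hσ ?_ ?_ ?_ (eLpNorm_val_zero_le hN0) hE hBt hft heq
  · rw [le_div_iff₀ hz0]; linarith
  · rw [hzq]; linarith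
  · rw [hzq, hz]; linarith
  · rw [hzq, hz]; linarith

theorem satisfiesB_half_of_boundedIntoLp (hΩ : MeasurableSet Ω)
    [IsFiniteMeasure (volume.restrict Ω)] (hps : 2 < ps)
    (hι : DenseRange ι) (hA : IsKatoOperator ι A) (hV : BoundedIntoLp ι (ENNReal.ofReal ps))
    (hr : 1 ≤ r) (hσ : 1 ≤ σ) (hBt : ∀ i j, MemLp (fun x => Bt x i j) r (volume.restrict Ω))
    (hft : IsLinearizable Ω ft gt Bt σ)
    (heq : ∀ t : ℝ, 0 < t → (0 : EuclideanSpace ℝ (Fin d) → Cn n) ∈ superposition Ω ft t 0)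
    (hrp : ENNReal.ofReal (ps / (ps - 2)) < r) (hσp : σ < ps - 1) {γ₀ γ₁ : ℝ}
    (hγ₀ : γ₀ = (2 * σ - ps) / (2 * ps - 4)) (hγ₁ : γ₁ = ps / (ps - 2) * r⁻¹.toReal - 1 / 2) :
    γ₀ < 1 / 2 ∧ γ₁ < 1 / 2 ∧
      ∀ γ : ℝ, max (max 0 γ₀) γ₁ ≤ γ → γ < 1 / 2 → SatisfiesB A (1 / 2) γ ft Bt := by
  obtain ⟨T, c, hT, hAT⟩ := hA.exists_isInverseResol hι
  have hN : ∀ γ : ℝ, 0 ≤ γ → γ < 1 → HasNegPow A γ := fun γ h0 h1 => hAT.hasNegPow hT hι h0 h1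
  have hps0 : 0 < ps := by linarith
  have hy : 1 / ps < 1 / 2 := one_div_lt_one_div_of_lt (by norm_num) hps
  have hy0 : 0 < 1 / ps := by positivity
  have h2 : 0 < ps - 2 := by linarith
  have hr' := toReal_inv_lt (by positivity) hrp
  have h3 : 1 / (ps / (ps - 2)) = 1 - 2 * (1 / ps) := by field_simp
  rw [h3] at hr'
  set ρ := r⁻¹.toReal with hρ
  have hden : 0 < 2 - 4 * (1 / ps) := by linarith
  -- Now m = p_*: γ₀ and γ₁ solve σ/p_* + z = 1 and 1/r + 1/p_* + z = 1 with z = 1/2 - γ (1 -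
  -- 2/p_*).
  have e0 : γ₀ = (2 * σ * (1 / ps) - 1) / (2 - 4 * (1 / ps)) := by
    rw [hγ₀, div_eq_div_iff (by linarith) hden.ne']
    field_simp
  have hden1 : 0 < 1 - 2 * (1 / ps) := by linarith
  have e1 : γ₁ = ρ / (1 - 2 * (1 / ps)) - 1 / 2 := by
    rw [hγ₁, ← h3]
    field_simp
  have hσp' : σ * (1 / ps) < 1 - 1 / ps := by
    rw [mul_one_div, div_lt_iff₀ hps0]
    field_simp
    linarith
  have hρ1 : ρ / (1 - 2 * (1 / ps)) < 1 := by rw [div_lt_one hden1]; exact hr'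
  refine ⟨by rw [e0, div_lt_iff₀ hden]; linarith, by rw [e1]; linarith, fun γ hγ hγ1 => ?_⟩
  have hγ0 : 0 ≤ γ := (le_max_left _ _).trans ((le_max_left _ _).trans hγ)
  have hγ3 : γ₀ ≤ γ := (le_max_right _ _).trans ((le_max_left _ _).trans hγ)
  have hγ4 : γ₁ ≤ γ := (le_max_right _ _).trans hγ
  rw [e0, div_le_iff₀ hden] at hγ3
  rw [e1, sub_le_iff_le_add, div_le_iff₀ hden1] at hγ4
  set z := (1 - 2 * γ) / 2 + 2 * γ / ps with hz
  have hz' : z = 1 / 2 - γ * (1 - 2 * (1 / ps)) := by rw [hz]; ring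
  have hz0 : 0 < z := by
    have h4 : 0 < (1 - 2 * γ) / 2 := by linarith
    have h5 : 0 ≤ 2 * γ / ps := by positivity
    linarith
  have hz1 : z ≤ 1 / 2 := by
    have := mul_nonneg hγ0 hden1.le
    linarith
  have hzq : (ENNReal.ofReal (1 / z))⁻¹.toReal = z := by
    rw [toReal_inv_ofReal (by positivity), one_div_one_div]
  have hE : MapsIntoLp (negPow A.adjoint γ) (ENNReal.ofReal (1 / z)) :=
    mapsIntoLp_negPow_of_lt_half hι hT hAT hps hγ0 hγ1 (by rw [one_div_one_div]) hV
  obtain ⟨C, hC⟩ := hA.eLpNorm_val_half_le hV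
  refine satisfiesB_of_mapsIntoLp hΩ (hN γ hγ0 (by linarith)) hps0
    (ENNReal.one_le_ofReal.2 ?_) hr hσ ?_ ?_ ?_ hC hE hBt hft heq
  · rw [le_div_iff₀ hz0]; linarith
  · rw [hzq]; linarith
  · rw [hzq, hz', ← mul_one_div]; linarith
  · rw [hzq, hz']; linarith

end Cases

end KatoScale

open KatoScale in
theorem proposition5p2 {d n : ℕ} (hd : 1 ≤ d)
    (Ω : Set (EuclideanSpace ℝ (Fin d))) (hΩ : IsOpen Ω) (hΩfin : volume Ω < ⊤)
    -- the exponent of the Sobolev embedding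
    (ps : ℝ) (hps : 2 < ps) (hps3 : 3 ≤ d → ps = 2 * d / (d - 2))
    -- the space `V`
    (V : Submodule ℂ (L2Jet Ω n)) (hVW : V ≤ W12 Ω n) (hVclosed : IsClosed (V : Set (L2Jet Ω n)))
    (hVdense : DenseRange (toL2 V)) (hVSobolev : EmbedsInLp V (ENNReal.ofReal ps))
    -- the operator `A`
    (A : L2 Ω n →ₗ.[ℂ] L2 Ω n) (hA : IsKatoOperator (toL2 V) A)
    -- the nonlinearity, with equilibrium `u₀ = 0`
    (ft gt : ℝ → EuclideanSpace ℝ (Fin d) → Cn n → Set (Cn n))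
    (Bt : EuclideanSpace ℝ (Fin d) → Matrix (Fin n) (Fin n) ℂ)
    (r : ℝ≥0∞) (hr : 1 ≤ r) (σ : ℝ) (hσ : 1 ≤ σ)
    (hBt : ∀ i j, MemLp (fun x => Bt x i j) r (volume.restrict Ω))
    (hft : IsLinearizable Ω ft gt Bt σ)
    (heq : ∀ t : ℝ, 0 < t → (0 : EuclideanSpace ℝ (Fin d) → Cn n) ∈ superposition Ω ft t 0) :
    -- the case `α = 0`
    ((d = 1 → EmbedsInLp V ⊤) →
      (d = 2 → ∀ q : ℝ, 2 < q → EmbedsInLp V (ENNReal.ofReal q)) →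
      (d = 1 → r = 2) → (d = 2 → 2 < r) →
      (3 ≤ d → r = ENNReal.ofReal (2 * ps / (ps - 2))) →
      (d = 1 → σ = 2) → (d = 2 → σ < 2) → (3 ≤ d → σ = 2 - 2 / ps) →
      ∀ γ : ℝ, 1 / 2 ≤ γ → γ < 1 → SatisfiesB A 0 γ ft Bt) ∧
    -- the case `α = 0` if `D(A*)` embeds into `L_p`
    (∀ p : ℝ, ps < p → DomainEmbedsInLp A.adjoint (ENNReal.ofReal p) →
      ENNReal.ofReal (2 * p / (p - 2)) < r → σ < 2 - 2 / p →
      ∀ γ₀ γ₁ : ℝ,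
        γ₀ = ((σ - 2) * ps * p - 2 * ps + 4 * p) / (4 * (p - ps)) →
        γ₁ = (2 * p * ps * r⁻¹.toReal - (p * ps + 2 * ps - 4 * p)) / (4 * (p - ps)) →
        γ₀ < 1 ∧ γ₁ < 1 ∧
          ∀ γ : ℝ, max (max γ₀ γ₁) (1 / 2) ≤ γ → γ < 1 → SatisfiesB A 0 γ ft Bt) ∧
    -- the case `α = 1/2`
    (ENNReal.ofReal (ps / (ps - 2)) < r → σ < ps - 1 →
      ∀ γ₀ γ₁ : ℝ,
        γ₀ = (2 * σ - ps) / (2 * ps - 4) →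
        γ₁ = ps / (ps - 2) * r⁻¹.toReal - 1 / 2 →
        γ₀ < 1 / 2 ∧ γ₁ < 1 / 2 ∧
          ∀ γ : ℝ, max (max 0 γ₀) γ₁ ≤ γ → γ < 1 / 2 → SatisfiesB A (1 / 2) γ ft Bt) := by
  -- Closedness makes V a Hilbert space, as Lax–Milgram and the adjoint of the inclusion require.
  have hVc : CompleteSpace V := hVclosed.completeSpace_coe
  have hfin : IsFiniteMeasure (volume.restrict Ω) := ⟨by rwa [Measure.restrict_apply_univ]⟩
  refine ⟨fun hV1 hV2 hr1 hr2 hr3 hσ1 hσ2 hσ3 γ h0 h1 => ?_, fun p hp hD hrp hσp γ₀ γ₁ hγ₀ hγ₁ => ?_,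
    fun hrp hσp γ₀ γ₁ hγ₀ hγ₁ => ?_⟩
  · have key := @satisfiesB_zero_of_boundedIntoLp d n Ω A V _ _ hVc (toL2 V) ft gt Bt r σ ps
    exact key hd hΩ.measurableSet hps hVdense hA hVSobolev hr hσ hBt hft heq hV1 hV2 hr1 hr2 hr3
      hσ1 hσ2 hσ3 h0 h1
  · have key := @satisfiesB_zero_of_domainEmbedsInLp d n Ω A V _ _ hVc (toL2 V) ft gt Bt r σ ps
    exact key hΩ.measurableSet hps hVdense hA hVSobolev hr hσ hBt hft heq hp hD hrp hσp hγ₀ hγ₁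
  · have key := @satisfiesB_half_of_boundedIntoLp d n Ω A V _ _ hVc (toL2 V) ft gt Bt r σ ps
    exact key hΩ.measurableSet hps hVdense hA hVSobolev hr hσ hBt hft heq hrp hσp hγ₀ hγ₁
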